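/- **Setting.** Let $n_1,n_2\ge 1$ and $\delta\in(0,1]$. $\mathcal D(\mathbb R^n)$ is the space of smooth compactly supported complex-valued functions on $\mathbb R^n$; all pairings $\langle\cdot,\cdot\rangle$ are bilinear. For a Banach space $B$, a function $K:\{(x,y)\in\mathbb R^{2n}:x\ne y\}\to B$ is a $B$-valued $\delta$-CZ kernel if for some $C$ $$\|K(x,y)\|_B\le \frac{C}{|x-y|^{n}}\ (x\ne y),\qquad \|K(x,y)-K(x,y')\|_B,\ \|K(y,x)-K(y',x)\|_B\le C\frac{|y-y'|^\delta}{|x-y|^{n+\delta}}\ \text{ if } 0\ne|x-y|\ge 2|y-y'|;$$ the smallest such $C$ is denoted $\|K\|_{B,\delta}$. $\delta\mathrm{CZO}(\mathbb R^n)$ is the space of bounded operators $S$ on $L^2(\mathbb R^n)$ such that, for some $\mathbb C$-valued $\delta$-CZ kernel $K$, $\langle Sf,g\rangle=\iint K(x,y)f(y)g(x)\,dx\,dy$ for all $f,g\in\mathcal D(\mathbb R^n)$ with disjoint supports; its norm is $\|S\|_{L^2\to L^2}+\|K\|_{\mathbb C,\delta}$. A *bi-parameter $\delta$-CZO* is a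 continuous linear operator $T:\mathcal D(\mathbb R^{n_1})\otimes\mathcal D(\mathbb R^{n_2})\to(\mathcal D(\mathbb R^{n_1})\otimes\mathcal D(\mathbb R^{n_2}))'$ such that * for $\{i,j\}=\{1,2\}$ there is a $\delta\mathrm{CZO}(\mathbb R^{n_j})$-valued $\delta$-CZ kernel $K_i$ on $\mathbb R^{n_i}$ with $\langle T(f_1\otimes f_2),g_1\otimes g_2\rangle=\iint f_i(y)g_i(x)\langle K_i(x,y)f_j,g_j\rangle\,dx\,dy$ for all test functions for which $f_i,g_i$ have disjoint supports; * $T$ and its partial transpose $T_t$, defined by $\langle T_t(g_1\otimes f_2),f_1\otimes g_2\rangle=\langle T(f_1\otimes f_2),g_1\otimes g_2\rangle$, extend to bounded operators on $L^2(\mathbb R^{n_1}\times\mathbb R^{n_2})$. *Full cancellation.* In the expressions below, $1$ is understood as the limit as $R\to\infty$ of dilated cutoffs $\chi(\cdot/R)$, where $\chi\in\mathcal D$ equals $1$ near the origin; if two entries are $1$, the two dilation parameters tend to infinity jointly. $T$ is *fully cancellative* if, for all $f_i,g_i\in\mathcal D(\mathbb R^{n_i})$, $$\langle T(1\otimes1),g_1\otimes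 g_2\rangle=\langle T(1\otimes f_2),g_1\otimes1\rangle=\langle T(f_1\otimes1),1\otimes g_2\rangle=\langle T(f_1\otimes f_2),1\otimes1\rangle=0,$$ $$\langle T(1\otimes f_2),g_1\otimes g_2\rangle=\langle T(f_1\otimes1),g_1\otimes g_2\rangle=\langle T(f_1\otimes f_2),1\otimes g_2\rangle=\langle T(f_1\otimes f_2),g_1\otimes1\rangle=0,$$ where in each expression the function paired with a $1$ in the same variable is required to have mean zero. *Product weak compactness.* For $i=1,2$ fix a real-valued $\psi_i\in\mathcal D(\mathbb R^{n_i})$ supported in the unit ball with $\int\psi_i=0$ and $\int_0^\infty|\widehat{\psi_i}(t\xi)|^2\,\frac{dt}{t}=1$ for all $\xi\ne0$, where $\widehat{f}(\xi)=\int f(x)e^{-2\pi i x\cdot\xi}\,dx$. For $z=(z_1,z_2)$ with $z_i=(x_i,t_i)\in\mathbb R^{n_i}\times(0,\infty)$ put $\psi_z=\psi_{1,z_1}\otimes\psi_{2,z_2}$, where $\psi_{i,z_i}=t_i^{-n_i/2}\psi_i\big(\frac{\cdot-x_i}{t_i}\big)$. Let $D(z_i,R)$ be the ball of radius $R$ about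 $z_i$ for the hyperbolic metric $ds^2=(dx^2+dt^2)/t^2$ on $\mathbb R^{n_i}\times(0,\infty)$. $T$ has the *product weak compactness property* if for every $R>0$ $$\lim_{N\to\infty}\ \sup_{z\notin D((0,1),N)\times D((0,1),N)}\ \sup_{w\in D(z_1,R)\times D(z_2,R)}|\langle T\psi_z,\psi_w\rangle|=0.$$ **Theorem.** If a fully cancellative bi-parameter $\delta$-CZO $T$ satisfies the product weak compactness property, then (the bounded extension of) $T$ is compact on $L^2(\mathbb R^{n_1}\times\mathbb R^{n_2})$. -/

import Mathlib

namespace BiParam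

open MeasureTheory Filter Topology TensorProduct
open scoped Distributions

noncomputable section

/-! ### Test functions and `L²` -/

/-- The Euclidean space `ℝⁿ`. -/
abbrev Euc (n : ℕ) : Type := EuclideanSpace ℝ (Fin n)

/-- The space of smooth compactly supported functions `ℝⁿ → ℂ`, with its usual topology. -/
abbrev Test (n : ℕ) : Type := 𝓓((⊤ : TopologicalSpace.Opens (Euc n)), ℂ)

/-- `L²(ℝⁿ)`. -/
abbrev L2 (n : ℕ) : Type := Lp ℂ 2 (volume : Measure (Euc n))

/-- `L²(ℝⁿ¹ × ℝⁿ²)`. -/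
abbrev L2Prod (n₁ n₂ : ℕ) : Type := Lp ℂ 2 (volume : Measure (Euc n₁ × Euc n₂))

/-- A test function as an element of `L²(ℝⁿ)`. -/
def toL2 {n : ℕ} (f : Test n) : L2 n :=
  (f.continuous.memLp_of_hasCompactSupport (p := 2) (μ := volume) f.hasCompactSupport).toLp f

/-- The function `f₁ ⊗ f₂`, that is `(x₁, x₂) ↦ f₁(x₁) f₂(x₂)`. -/
def tensorFun {n₁ n₂ : ℕ} (f₁ : Test n₁) (f₂ : Test n₂) : Euc n₁ × Euc n₂ → ℂ :=
  fun p => f₁ p.1 * f₂ p.2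

lemma continuous_tensorFun {n₁ n₂ : ℕ} (f₁ : Test n₁) (f₂ : Test n₂) :
    Continuous (tensorFun f₁ f₂) :=
  (f₁.continuous.comp continuous_fst).mul (f₂.continuous.comp continuous_snd)

lemma hasCompactSupport_tensorFun {n₁ n₂ : ℕ} (f₁ : Test n₁) (f₂ : Test n₂) :
    HasCompactSupport (tensorFun f₁ f₂) := by
  refine HasCompactSupport.intro
    (f₁.hasCompactSupport.isCompact.prod f₂.hasCompactSupport.isCompact) ?_
  rintro ⟨x, y⟩ h
  by_cases hx : x ∈ tsupport f₁
  · have hy : y ∉ tsupport f₂ := fun hy => h ⟨hx, hy⟩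
    simp [tensorFun, image_eq_zero_of_notMem_tsupport hy]
  · simp [tensorFun, image_eq_zero_of_notMem_tsupport hx]

/-- `f₁ ⊗ f₂` as an element of `L²(ℝⁿ¹ × ℝⁿ²)`. -/
def tensorL2 {n₁ n₂ : ℕ} (f₁ : Test n₁) (f₂ : Test n₂) : L2Prod n₁ n₂ :=
  ((continuous_tensorFun f₁ f₂).memLp_of_hasCompactSupport (p := 2) (μ := volume)
    (hasCompactSupport_tensorFun f₁ f₂)).toLp (tensorFun f₁ f₂)

/-- The bilinear pairing `⟨u, g⟩ = ∫ u g` of `u ∈ L²(ℝⁿ)` with a test function. -/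
def pair {n : ℕ} (u : L2 n) (g : Test n) : ℂ := ∫ x, u x * g x

/-- The bilinear pairing `⟨u, g₁ ⊗ g₂⟩ = ∫ u (g₁ ⊗ g₂)` for `u ∈ L²(ℝⁿ¹ × ℝⁿ²)`. -/
def pairProd {n₁ n₂ : ℕ} (u : L2Prod n₁ n₂) (g₁ : Test n₁) (g₂ : Test n₂) : ℂ :=
  ∫ p, u p * tensorFun g₁ g₂ p

/-- The test function `y ↦ f ((y - x) / t)`, for `t > 0`. -/
def rescale {n : ℕ} (x : Euc n) (t : Set.Ioi (0 : ℝ)) (f : Test n) : Test n where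
  toFun y := f ((t : ℝ)⁻¹ • (y - x))
  contDiff' := by
    have h : ContDiff ℝ ((⊤ : ℕ∞) : WithTop ℕ∞) fun y : Euc n => (t : ℝ)⁻¹ • (y - x) :=
      (contDiff_id.sub contDiff_const).const_smul _
    exact f.contDiff.comp h
  hasCompactSupport' :=
    f.hasCompactSupport.comp_homeomorph ((Homeomorph.subRight x).trans
      (Homeomorph.smulOfNeZero ((t : ℝ)⁻¹) (inv_ne_zero t.2.ne')))
  tsupport_subset' := fun _ _ => trivial

/-! ### One-parameter Calderón–Zygmund kernels and operators -/

/-- `K` is a `B`-valued `δ`-Calderón–Zygmund kernel on `ℝⁿ` with constant `C`. Only the values of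
`K` off the diagonal matter. -/
structure IsCZKernel {B : Type} [NormedAddCommGroup B] {n : ℕ} (δ C : ℝ)
    (K : Euc n → Euc n → B) : Prop where
  nonneg : 0 ≤ C
  size : ∀ x y, x ≠ y → ‖K x y‖ ≤ C / ‖x - y‖ ^ n
  smooth_right : ∀ x y y', x ≠ y → ‖y - y'‖ ≤ ‖x - y‖ / 2 →
    ‖K x y - K x y'‖ ≤ C * ‖y - y'‖ ^ δ / ‖x - y‖ ^ ((n : ℝ) + δ)
  smooth_left : ∀ x y y', x ≠ y → ‖y - y'‖ ≤ ‖x - y‖ / 2 →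
    ‖K y x - K y' x‖ ≤ C * ‖y - y'‖ ^ δ / ‖x - y‖ ^ ((n : ℝ) + δ)

/-- `⟨S f, g⟩ = ∬ K(x, y) f(y) g(x) dx dy` for all test functions `f, g` with disjoint supports
(the integral being absolutely convergent, as it is for every Calderón–Zygmund kernel). -/
def HasKernel {n : ℕ} (S : L2 n →L[ℂ] L2 n) (K : Euc n → Euc n → ℂ) : Prop :=
  ∀ f g : Test n, Disjoint (tsupport f) (tsupport g) →
    Integrable (fun p : Euc n × Euc n => K p.1 p.2 * f p.2 * g p.1) ∧
    pair (S (toL2 f)) g = ∫ p : Euc n × Euc n, K p.1 p.2 * f p.2 * g p.1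

/-- The constants `C` for which `S` has a `δ`-Calderón–Zygmund kernel with constant `C`. -/
def kernelConstants (δ : ℝ) {n : ℕ} (S : L2 n →L[ℂ] L2 n) : Set ℝ :=
  {C | ∃ K : Euc n → Euc n → ℂ, IsCZKernel δ C K ∧ HasKernel S K}

lemma kernelConstants_nonneg {δ : ℝ} {n : ℕ} {S : L2 n →L[ℂ] L2 n} {C : ℝ}
    (h : C ∈ kernelConstants δ S) : 0 ≤ C := by
  obtain ⟨K, hK, -⟩ := h
  exact hK.nonneg

lemma kernelConstants_bddBelow (δ : ℝ) {n : ℕ} (S : L2 n →L[ℂ] L2 n) :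
    BddBelow (kernelConstants δ S) := ⟨0, fun _ h => kernelConstants_nonneg h⟩

lemma pair_add {n : ℕ} (u v : L2 n) (g : Test n) : pair (u + v) g = pair u g + pair v g := by
  have hg : MemLp g 2 (volume : Measure (Euc n)) :=
    g.continuous.memLp_of_hasCompactSupport g.hasCompactSupport
  have key : ∀ w : L2 n, Integrable (fun x => w x * g x) := fun w =>
    (Lp.memLp w).integrable_mul hg
  unfold pair
  rw [← integral_add (key u) (key v)]
  refine integral_congr_ae ?_
  filter_upwards [Lp.coeFn_add u v] with x hx
  rw [hx, Pi.add_apply, add_mul]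

lemma pair_smul {n : ℕ} (c : ℂ) (u : L2 n) (g : Test n) : pair (c • u) g = c * pair u g := by
  unfold pair
  rw [← integral_const_mul]
  refine integral_congr_ae ?_
  filter_upwards [Lp.coeFn_smul c u] with x hx
  rw [hx, Pi.smul_apply, smul_eq_mul, mul_assoc]

lemma kernelConstants_add {δ : ℝ} {n : ℕ} {S S' : L2 n →L[ℂ] L2 n} {C C' : ℝ}
    (h : C ∈ kernelConstants δ S) (h' : C' ∈ kernelConstants δ S') :
    C + C' ∈ kernelConstants δ (S + S') := by
  obtain ⟨K, hK, hS⟩ := h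
  obtain ⟨K', hK', hS'⟩ := h'
  refine ⟨fun x y => K x y + K' x y, ⟨add_nonneg hK.nonneg hK'.nonneg, ?_, ?_, ?_⟩, ?_⟩
  · intro x y hxy
    rw [add_div]
    exact (norm_add_le _ _).trans (add_le_add (hK.size x y hxy) (hK'.size x y hxy))
  · intro x y y' hxy hy
    rw [add_mul, add_div, add_sub_add_comm]
    exact (norm_add_le _ _).trans
      (add_le_add (hK.smooth_right x y y' hxy hy) (hK'.smooth_right x y y' hxy hy))
  · intro x y y' hxy hy
    rw [add_mul, add_div, add_sub_add_comm]
    exact (norm_add_le _ _).trans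
      (add_le_add (hK.smooth_left x y y' hxy hy) (hK'.smooth_left x y y' hxy hy))
  · intro f g hfg
    obtain ⟨hi, he⟩ := hS f g hfg
    obtain ⟨hi', he'⟩ := hS' f g hfg
    have e : (fun p : Euc n × Euc n => (K p.1 p.2 + K' p.1 p.2) * f p.2 * g p.1) =
        fun p => K p.1 p.2 * f p.2 * g p.1 + K' p.1 p.2 * f p.2 * g p.1 := by
      funext p; ring
    refine ⟨by rw [e]; exact hi.add hi', ?_⟩
    rw [e, integral_add hi hi', ← he, ← he', ← pair_add]
    rfl

lemma kernelConstants_smul {δ : ℝ} {n : ℕ} {S : L2 n →L[ℂ] L2 n} {C : ℝ} (c : ℂ)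
    (h : C ∈ kernelConstants δ S) : ‖c‖ * C ∈ kernelConstants δ (c • S) := by
  obtain ⟨K, hK, hS⟩ := h
  refine ⟨fun x y => c * K x y, ⟨mul_nonneg (norm_nonneg _) hK.nonneg, ?_, ?_, ?_⟩, ?_⟩
  · intro x y hxy
    rw [mul_div_assoc, norm_mul]
    exact mul_le_mul_of_nonneg_left (hK.size x y hxy) (norm_nonneg _)
  · intro x y y' hxy hy
    rw [mul_assoc, mul_div_assoc, ← mul_sub, norm_mul]
    exact mul_le_mul_of_nonneg_left (hK.smooth_right x y y' hxy hy) (norm_nonneg _)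
  · intro x y y' hxy hy
    rw [mul_assoc, mul_div_assoc, ← mul_sub, norm_mul]
    exact mul_le_mul_of_nonneg_left (hK.smooth_left x y y' hxy hy) (norm_nonneg _)
  · intro f g hfg
    obtain ⟨hi, he⟩ := hS f g hfg
    have e : (fun p : Euc n × Euc n => c * K p.1 p.2 * f p.2 * g p.1) =
        fun p => c * (K p.1 p.2 * f p.2 * g p.1) := by
      funext p; ring
    refine ⟨by rw [e]; exact hi.const_mul c, ?_⟩
    rw [e, integral_const_mul, ← he, ← pair_smul]
    rfl

lemma zero_mem_kernelConstants (δ : ℝ) (n : ℕ) :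
    (0 : ℝ) ∈ kernelConstants δ (0 : L2 n →L[ℂ] L2 n) := by
  refine ⟨fun _ _ => 0, ⟨le_rfl, by simp, by simp, by simp⟩, ?_⟩
  intro f g _
  refine ⟨by simp, ?_⟩
  have h := pair_smul 0 (0 : L2 n) g
  rw [zero_smul, zero_mul] at h
  simpa using h

/-- The bounded operators on `L²(ℝⁿ)` which have a `δ`-Calderón–Zygmund kernel. -/
def czoSubmodule (δ : ℝ) (n : ℕ) : Submodule ℂ (L2 n →L[ℂ] L2 n) where
  carrier := {S | (kernelConstants δ S).Nonempty}
  add_mem' := fun ⟨_, h⟩ ⟨_, h'⟩ => ⟨_, kernelConstants_add h h'⟩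
  zero_mem' := ⟨0, zero_mem_kernelConstants δ n⟩
  smul_mem' := fun c _ ⟨_, h⟩ => ⟨_, kernelConstants_smul c h⟩

/-- The space `δCZO(ℝⁿ)` of `δ`-Calderón–Zygmund operators. It is a copy of `czoSubmodule δ n`
which does not carry the operator norm, but the norm
`‖T‖ = ‖T‖_{L² → L²} + ‖K‖_δ`, where `‖K‖_δ` is the smallest kernel constant. -/
def CZO (δ : ℝ) (n : ℕ) : Type := czoSubmodule δ n

namespace CZO

variable {δ : ℝ} {n : ℕ}

instance : AddCommGroup (CZO δ n) := inferInstanceAs (AddCommGroup (czoSubmodule δ n))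

instance : Module ℂ (CZO δ n) := inferInstanceAs (Module ℂ (czoSubmodule δ n))

/-- The bounded operator on `L²(ℝⁿ)` underlying a Calderón–Zygmund operator. -/
def toCLM (S : CZO δ n) : L2 n →L[ℂ] L2 n := Subtype.val (p := (· ∈ czoSubmodule δ n)) S

/-- `‖K‖_δ` for the kernel `K` of `S`. -/
def kernelNorm (S : CZO δ n) : ℝ := sInf (kernelConstants δ S.toCLM)

lemma toCLM_add (S S' : CZO δ n) : (S + S').toCLM = S.toCLM + S'.toCLM := rfl

lemma toCLM_neg (S : CZO δ n) : (-S).toCLM = -S.toCLM := rfl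

lemma toCLM_zero : (0 : CZO δ n).toCLM = 0 := rfl

lemma toCLM_injective : Function.Injective (toCLM : CZO δ n → _) := Subtype.val_injective

lemma nonempty (S : CZO δ n) : (kernelConstants δ S.toCLM).Nonempty :=
  Subtype.prop (p := (· ∈ czoSubmodule δ n)) S

lemma kernelNorm_nonneg (S : CZO δ n) : 0 ≤ S.kernelNorm :=
  le_csInf S.nonempty fun _ h => kernelConstants_nonneg h

lemma kernelNorm_zero : (0 : CZO δ n).kernelNorm = 0 :=
  le_antisymm (csInf_le (kernelConstants_bddBelow δ _) (zero_mem_kernelConstants δ n))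
    (kernelNorm_nonneg _)

lemma kernelNorm_add_le (S S' : CZO δ n) :
    (S + S').kernelNorm ≤ S.kernelNorm + S'.kernelNorm := by
  refine le_of_forall_pos_le_add fun ε hε => ?_
  obtain ⟨a, ha, ha'⟩ := exists_lt_of_csInf_lt S.nonempty
    (show S.kernelNorm < S.kernelNorm + ε / 2 by linarith)
  obtain ⟨b, hb, hb'⟩ := exists_lt_of_csInf_lt S'.nonempty
    (show S'.kernelNorm < S'.kernelNorm + ε / 2 by linarith)
  have h : (S + S').kernelNorm ≤ a + b :=
    csInf_le (kernelConstants_bddBelow δ _) (by rw [toCLM_add]; exact kernelConstants_add ha hb)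
  linarith

lemma kernelNorm_neg_le (S : CZO δ n) : (-S).kernelNorm ≤ S.kernelNorm := by
  refine le_csInf S.nonempty fun C hC => csInf_le (kernelConstants_bddBelow δ _) ?_
  have h := kernelConstants_smul (-1) hC
  rw [norm_neg, norm_one, one_mul] at h
  rwa [toCLM_neg, ← neg_one_smul ℂ S.toCLM]

instance : NormedAddCommGroup (CZO δ n) :=
  AddGroupNorm.toNormedAddCommGroup
    { toFun := fun S => ‖S.toCLM‖ + S.kernelNorm
      map_zero' := by rw [toCLM_zero, kernelNorm_zero, norm_zero, add_zero]
      add_le' := fun S S' => by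
        rw [toCLM_add]
        linarith [norm_add_le S.toCLM S'.toCLM, kernelNorm_add_le S S']
      neg' := fun S => by
        have h := kernelNorm_neg_le (-S)
        rw [neg_neg] at h
        rw [toCLM_neg, norm_neg, le_antisymm (kernelNorm_neg_le S) h]
      eq_zero_of_map_eq_zero' := fun S h => by
        have h0 := kernelNorm_nonneg S
        have h1 := norm_nonneg S.toCLM
        exact toCLM_injective (by rw [toCLM_zero]; exact norm_eq_zero.1 (by linarith)) }

lemma norm_def (S : CZO δ n) : ‖S‖ = ‖S.toCLM‖ + S.kernelNorm := rfl

/-- `⟨S f, g⟩` for `S ∈ δCZO(ℝⁿ)` and test functions `f, g`. -/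
def form (S : CZO δ n) (f g : Test n) : ℂ := pair (S.toCLM (toL2 f)) g

end CZO

/-! ### Bi-parameter singular integral operators -/

/-- The algebraic tensor product `𝓓(ℝⁿ¹) ⊗ 𝓓(ℝⁿ²)`. -/
abbrev TestTensor (n₁ n₂ : ℕ) : Type := Test n₁ ⊗[ℂ] Test n₂

/-- Linear operators from `𝓓(ℝⁿ¹) ⊗ 𝓓(ℝⁿ²)` to its dual, written `T u v = ⟨T u, v⟩`. Continuity is
the separate condition `BiOp.IsContinuous`. -/
abbrev BiOp (n₁ n₂ : ℕ) : Type := TestTensor n₁ n₂ →ₗ[ℂ] Module.Dual ℂ (TestTensor n₁ n₂)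

namespace BiOp

variable {n₁ n₂ : ℕ}

/-- Continuity of `T : 𝓓(ℝⁿ¹) ⊗ 𝓓(ℝⁿ²) → (𝓓(ℝⁿ¹) ⊗ 𝓓(ℝⁿ²))'`, where a linear map on
`𝓓(ℝⁿ¹) ⊗ 𝓓(ℝⁿ²)` is continuous when the corresponding bilinear map on `𝓓(ℝⁿ¹) × 𝓓(ℝⁿ²)` is, and
the dual carries the weak-* topology. -/
structure IsContinuous (T : BiOp n₁ n₂) : Prop where
  apply : ∀ u : TestTensor n₁ n₂, Continuous fun g : Test n₁ × Test n₂ => T u (g.1 ⊗ₜ g.2)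
  weakStar : ∀ v : TestTensor n₁ n₂, Continuous fun f : Test n₁ × Test n₂ => T (f.1 ⊗ₜ f.2) v

/-- The partial transpose: `⟨T_t (g₁ ⊗ f₂), f₁ ⊗ g₂⟩ = ⟨T (f₁ ⊗ f₂), g₁ ⊗ g₂⟩`. -/
def partialTranspose (T : BiOp n₁ n₂) : BiOp n₁ n₂ :=
  TensorProduct.curry
    (TensorProduct.lift T ∘ₗ
      (TensorProduct.tensorTensorTensorComm ℂ (Test n₁) (Test n₁) (Test n₂) (Test n₂)).toLinearMap ∘ₗ
      TensorProduct.map (TensorProduct.comm ℂ (Test n₁) (Test n₁)).toLinearMap LinearMap.id ∘ₗ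
      (TensorProduct.tensorTensorTensorComm ℂ (Test n₁) (Test n₂) (Test n₁) (Test n₂)).toLinearMap)

lemma partialTranspose_apply (T : BiOp n₁ n₂) (f₁ g₁ : Test n₁) (f₂ g₂ : Test n₂) :
    T.partialTranspose (g₁ ⊗ₜ f₂) (f₁ ⊗ₜ g₂) = T (f₁ ⊗ₜ f₂) (g₁ ⊗ₜ g₂) := by
  simp [partialTranspose]

/-- The bounded operator `S` on `L²(ℝⁿ¹ × ℝⁿ²)` extends `T`. -/
def IsL2Extension (T : BiOp n₁ n₂) (S : L2Prod n₁ n₂ →L[ℂ] L2Prod n₁ n₂) : Prop :=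
  ∀ (f₁ g₁ : Test n₁) (f₂ g₂ : Test n₂),
    pairProd (S (tensorL2 f₁ f₂)) g₁ g₂ = T (f₁ ⊗ₜ f₂) (g₁ ⊗ₜ g₂)

/-- `T` is bounded on `L²(ℝⁿ¹ × ℝⁿ²)`. -/
def IsL2Bounded (T : BiOp n₁ n₂) : Prop :=
  ∃ S : L2Prod n₁ n₂ →L[ℂ] L2Prod n₁ n₂, T.IsL2Extension S

/-- `T` is compact on `L²(ℝⁿ¹ × ℝⁿ²)`. -/
def IsL2Compact (T : BiOp n₁ n₂) : Prop :=
  ∃ S : L2Prod n₁ n₂ →L[ℂ] L2Prod n₁ n₂, T.IsL2Extension S ∧ IsCompactOperator S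

/-- `T` is a bi-parameter `δ`-singular integral operator: it is continuous, and in each parameter
it is given, on pairs of functions with disjoint supports in that parameter, by a
`δ`-Calderón–Zygmund kernel with values in the `δ`-Calderón–Zygmund operators in the other parameter. -/
structure IsSingularIntegral (δ : ℝ) (T : BiOp n₁ n₂) : Prop where
  continuous : T.IsContinuous
  kernel₁ : ∃ (C : ℝ) (K₁ : Euc n₁ → Euc n₁ → CZO δ n₂), IsCZKernel δ C K₁ ∧
    ∀ (f₁ g₁ : Test n₁) (f₂ g₂ : Test n₂), Disjoint (tsupport f₁) (tsupport g₁) →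
      Integrable (fun p : Euc n₁ × Euc n₁ => f₁ p.2 * g₁ p.1 * (K₁ p.1 p.2).form f₂ g₂) ∧
      T (f₁ ⊗ₜ f₂) (g₁ ⊗ₜ g₂) =
        ∫ p : Euc n₁ × Euc n₁, f₁ p.2 * g₁ p.1 * (K₁ p.1 p.2).form f₂ g₂
  kernel₂ : ∃ (C : ℝ) (K₂ : Euc n₂ → Euc n₂ → CZO δ n₁), IsCZKernel δ C K₂ ∧
    ∀ (f₁ g₁ : Test n₁) (f₂ g₂ : Test n₂), Disjoint (tsupport f₂) (tsupport g₂) →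
      Integrable (fun p : Euc n₂ × Euc n₂ => f₂ p.2 * g₂ p.1 * (K₂ p.1 p.2).form f₁ g₁) ∧
      T (f₁ ⊗ₜ f₂) (g₁ ⊗ₜ g₂) =
        ∫ p : Euc n₂ × Euc n₂, f₂ p.2 * g₂ p.1 * (K₂ p.1 p.2).form f₁ g₁

/-- `T` is a bi-parameter `δ`-CZO: a bi-parameter `δ`-singular integral operator such that `T` and
its partial transpose are bounded on `L²(ℝⁿ¹ × ℝⁿ²)`. -/
structure IsCZO (δ : ℝ) (T : BiOp n₁ n₂) : Prop where
  isSingularIntegral : T.IsSingularIntegral δ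
  bounded : T.IsL2Bounded
  bounded_partialTranspose : T.partialTranspose.IsL2Bounded

end BiOp

/-! ### Cancellation -/

/-- `g` has mean zero. -/
def MeanZero {n : ℕ} (g : Test n) : Prop := ∫ x, g x = 0

/-- `χ` is a smooth cutoff function: it equals `1` near the origin. Its dilates `χ(·/R)` tend to the
constant function `1` as `R → ∞`. -/
def IsCutoff {n : ℕ} (χ : Test n) : Prop := ∀ᶠ x in 𝓝 (0 : Euc n), χ x = 1

/-- The dilate `χ(·/R)`. -/
def dilate {n : ℕ} (χ : Test n) (R : Set.Ioi (0 : ℝ)) : Test n := rescale 0 R χ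

namespace BiOp

variable {n₁ n₂ : ℕ}

/-- `T` is top-level cancellative:
`⟨T(1 ⊗ 1), · ⊗ ·⟩ = ⟨T(1 ⊗ ·), · ⊗ 1⟩ = ⟨T(· ⊗ 1), 1 ⊗ ·⟩ = ⟨T(· ⊗ ·), 1 ⊗ 1⟩ = 0`.
As usual, `1` stands for the limit of smooth cutoffs, and a function paired with `1` in the same
parameter is a test function of mean zero. -/
structure IsTopLevelCancellative (T : BiOp n₁ n₂) : Prop where
  one_one_dot_dot : ∀ (χ₁ : Test n₁) (χ₂ : Test n₂), IsCutoff χ₁ → IsCutoff χ₂ →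
    ∀ (g₁ : Test n₁) (g₂ : Test n₂), MeanZero g₁ → MeanZero g₂ →
      Tendsto (fun R : Set.Ioi (0 : ℝ) × Set.Ioi (0 : ℝ) =>
        T (dilate χ₁ R.1 ⊗ₜ dilate χ₂ R.2) (g₁ ⊗ₜ g₂)) atTop (𝓝 0)
  one_dot_dot_one : ∀ (χ₁ : Test n₁) (χ₂ : Test n₂), IsCutoff χ₁ → IsCutoff χ₂ →
    ∀ (g₁ : Test n₁) (f₂ : Test n₂), MeanZero g₁ → MeanZero f₂ →
      Tendsto (fun R : Set.Ioi (0 : ℝ) × Set.Ioi (0 : ℝ) =>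
        T (dilate χ₁ R.1 ⊗ₜ f₂) (g₁ ⊗ₜ dilate χ₂ R.2)) atTop (𝓝 0)
  dot_one_one_dot : ∀ (χ₁ : Test n₁) (χ₂ : Test n₂), IsCutoff χ₁ → IsCutoff χ₂ →
    ∀ (f₁ : Test n₁) (g₂ : Test n₂), MeanZero f₁ → MeanZero g₂ →
      Tendsto (fun R : Set.Ioi (0 : ℝ) × Set.Ioi (0 : ℝ) =>
        T (f₁ ⊗ₜ dilate χ₂ R.2) (dilate χ₁ R.1 ⊗ₜ g₂)) atTop (𝓝 0)
  dot_dot_one_one : ∀ (χ₁ : Test n₁) (χ₂ : Test n₂), IsCutoff χ₁ → IsCutoff χ₂ →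
    ∀ (f₁ : Test n₁) (f₂ : Test n₂), MeanZero f₁ → MeanZero f₂ →
      Tendsto (fun R : Set.Ioi (0 : ℝ) × Set.Ioi (0 : ℝ) =>
        T (f₁ ⊗ₜ f₂) (dilate χ₁ R.1 ⊗ₜ dilate χ₂ R.2)) atTop (𝓝 0)

/-- `T` is fully cancellative: it is top-level cancellative and
`⟨T(1 ⊗ ·), · ⊗ ·⟩ = ⟨T(· ⊗ 1), · ⊗ ·⟩ = ⟨T(· ⊗ ·), 1 ⊗ ·⟩ = ⟨T(· ⊗ ·), · ⊗ 1⟩ = 0`. -/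
structure IsFullyCancellative (T : BiOp n₁ n₂) : Prop extends T.IsTopLevelCancellative where
  one_dot_dot_dot : ∀ χ₁ : Test n₁, IsCutoff χ₁ →
    ∀ (g₁ : Test n₁) (f₂ g₂ : Test n₂), MeanZero g₁ →
      Tendsto (fun R : Set.Ioi (0 : ℝ) => T (dilate χ₁ R ⊗ₜ f₂) (g₁ ⊗ₜ g₂)) atTop (𝓝 0)
  dot_one_dot_dot : ∀ χ₂ : Test n₂, IsCutoff χ₂ →
    ∀ (f₁ g₁ : Test n₁) (g₂ : Test n₂), MeanZero g₂ →
      Tendsto (fun R : Set.Ioi (0 : ℝ) => T (f₁ ⊗ₜ dilate χ₂ R) (g₁ ⊗ₜ g₂)) atTop (𝓝 0)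
  dot_dot_one_dot : ∀ χ₁ : Test n₁, IsCutoff χ₁ →
    ∀ (f₁ : Test n₁) (f₂ g₂ : Test n₂), MeanZero f₁ →
      Tendsto (fun R : Set.Ioi (0 : ℝ) => T (f₁ ⊗ₜ f₂) (dilate χ₁ R ⊗ₜ g₂)) atTop (𝓝 0)
  dot_dot_dot_one : ∀ χ₂ : Test n₂, IsCutoff χ₂ →
    ∀ (f₁ g₁ : Test n₁) (f₂ : Test n₂), MeanZero f₂ →
      Tendsto (fun R : Set.Ioi (0 : ℝ) => T (f₁ ⊗ₜ f₂) (g₁ ⊗ₜ dilate χ₂ R)) atTop (𝓝 0)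

end BiOp

/-! ### Wavelets and the product weak compactness property -/

/-- The upper half-space `ℝⁿ × (0, ∞)`, with points `z = (x, t)`. -/
abbrev UpperHalf (n : ℕ) : Type := Euc n × Set.Ioi (0 : ℝ)

namespace UpperHalf

variable {n : ℕ}

/-- The point `(0, 1)`. -/
def base : UpperHalf n := (0, ⟨1, Set.mem_Ioi.2 one_pos⟩)

/-- The distance of the hyperbolic metric `ds² = (dx² + dt²) / t²`; this is
`d(z, w) = 2 arsinh (|z - w| / (2 √(t s)))` for `z = (x, t)` and `w = (y, s)`. -/
def hdist (z w : UpperHalf n) : ℝ :=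
  2 * Real.arsinh (√(‖z.1 - w.1‖ ^ 2 + ((z.2 : ℝ) - w.2) ^ 2) / (2 * √((z.2 : ℝ) * w.2)))

end UpperHalf

/-- `f_z = t^{-n/2} f((· - x)/t)` for `z = (x, t)`. -/
def atPoint {n : ℕ} (f : Test n) (z : UpperHalf n) : Test n :=
  (((z.2 : ℝ) ^ (-(n : ℝ) / 2) : ℝ) : ℂ) • rescale z.1 z.2 f

open scoped FourierTransform in
/-- `ψ` is a (real-valued, smooth) mother wavelet supported in the unit ball. -/
structure IsMotherWavelet {n : ℕ} (ψ : Test n) : Prop where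
  real : ∀ x, (ψ x).im = 0
  support : tsupport ψ ⊆ Metric.closedBall 0 1
  meanZero : MeanZero ψ
  calderon : ∀ ξ : Euc n, ξ ≠ 0 →
    ∫ t in Set.Ioi (0 : ℝ), ‖𝓕 (ψ : Euc n → ℂ) (t • ξ)‖ ^ 2 / t = 1

/-- The product weak compactness property of `T` with respect to the mother wavelets `ψ₁, ψ₂`:
for every `R > 0`, `sup_{w ∈ D(z₁, R) × D(z₂, R)} |⟨T ψ_z, ψ_w⟩| → 0` as `z = (z₁, z₂)` leaves the
sets `D((0,1), N) × D((0,1), N)`, where `ψ_z = ψ_{z₁} ⊗ ψ_{z₂}`. -/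
def BiOp.ProductWeakCompactness {n₁ n₂ : ℕ} (ψ₁ : Test n₁) (ψ₂ : Test n₂) (T : BiOp n₁ n₂) :
    Prop :=
  ∀ R : ℝ, 0 < R → ∀ ε : ℝ, 0 < ε → ∃ N : ℝ,
    ∀ (z₁ : UpperHalf n₁) (z₂ : UpperHalf n₂),
      (N ≤ UpperHalf.hdist UpperHalf.base z₁ ∨ N ≤ UpperHalf.hdist UpperHalf.base z₂) →
      ∀ (w₁ : UpperHalf n₁) (w₂ : UpperHalf n₂),
        UpperHalf.hdist z₁ w₁ < R → UpperHalf.hdist z₂ w₂ < R →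
        ‖T (atPoint ψ₁ z₁ ⊗ₜ atPoint ψ₂ z₂) (atPoint ψ₁ w₁ ⊗ₜ atPoint ψ₂ w₂)‖ ≤ ε

end

end BiParam

/-!
The product wavelets `ψ_z = ψ_{z₁} ⊗ ψ_{z₂}` form a continuous Parseval frame of `L²`, with respect
to the product of the hyperbolic measures `dx dt / t^(n+1)`: this is Calderón's reproducing formula,
which follows from Plancherel's theorem in each variable (`lintegral_waveletTransform`,
`isParsevalFrame_biWavelet`). The proof studies the matrix `⟨T ψ_z, ψ_w⟩` in this frame.

The matrix is almost diagonal in both parameters (`BiOp.exists_norm_le_almostDiag_mul`). In one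
parameter this is the classical estimate for a cancellative Calderón–Zygmund operator. It is proved
for bilinear forms `b` which are bounded on `L²`, decay off the diagonal against mean-zero functions,
and satisfy `b(1, ·) = b(·, 1) = 0` (`IsCZForm`, `exists_norm_le_almostDiag`). The slices of `T` with
fixed functions in the first parameter are such forms, by full cancellation. The constant of a slice
is bounded by the product of the `L²` norms of the fixed functions, and also by their off-diagonal
interaction, as the kernel of `T` takes values in the Calderón–Zygmund operators. Both bounds pass to
the matrix in the second parameter, which says that the slices of `T` at wavelets in the second
parameter are again cancellative forms; a second use of the one-parameter estimate gives the product.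

If `z₁, w₁` or `z₂, w₂` are far apart in the hyperbolic metric, a part of the almost diagonal decay
can be exchanged for a small factor. If both pairs are close, the almost diagonal kernel is bounded
from below, and weak compactness makes the matrix entry small unless `z` lies in a bounded box. So
the matrix is at most `η` times an almost diagonal one for all columns outside a box
(`BiOp.exists_box_norm_le`), and by Schur's test its part outside the box has norm `O(η)`. What is
left is `S ∘ P`, where `P` is the Bochner integral over the box of the rank-one operators
`⟨ψ_z, ·⟩ ψ_z` and hence compact. The operator is a norm limit of such compact operators
(`IsParsevalFrame.isCompactOperator`).
-/

namespace BiParam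

open MeasureTheory Filter Topology TensorProduct
open scoped Distributions

noncomputable section

/-! ### Norms of test functions -/

variable {n n₁ n₂ : ℕ}

/-- The volume of the unit ball of `ℝⁿ`. -/
def unitVol (n : ℕ) : ℝ := (volume : Measure (Euc n)).real (Metric.ball 0 1)

lemma unitVol_nonneg (n : ℕ) : 0 ≤ unitVol n := measureReal_nonneg

lemma Test.memLp (f : Test n) (p : ENNReal) : MemLp f p (volume : Measure (Euc n)) :=
  f.continuous.memLp_of_hasCompactSupport f.hasCompactSupport

lemma Test.integrable (f : Test n) : Integrable f (volume : Measure (Euc n)) :=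
  f.continuous.integrable_of_hasCompactSupport f.hasCompactSupport

lemma norm_sq_toLp {α : Type*} [MeasurableSpace α] {μ : Measure α} {f : α → ℂ}
    (hf : MemLp f 2 μ) : ‖hf.toLp f‖ ^ 2 = ∫ x, ‖f x‖ ^ 2 ∂μ := by
  rw [Lp.norm_toLp, hf.eLpNorm_eq_integral_rpow_norm (by simp) (by simp), ENNReal.toReal_ofReal]
  · simp only [ENNReal.toReal_ofNat, Real.rpow_ofNat]
    have h : 0 ≤ ∫ x, ‖f x‖ ^ 2 ∂μ := integral_nonneg fun _ => by positivity
    rw [← Real.rpow_natCast, ← Real.rpow_mul h]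
    norm_num
  · exact Real.rpow_nonneg (integral_nonneg fun _ => by positivity) _

lemma norm_toL2_sq (f : Test n) : ‖toL2 f‖ ^ 2 = ∫ x, ‖f x‖ ^ 2 := norm_sq_toLp _

lemma norm_tensorL2 (f₁ : Test n₁) (f₂ : Test n₂) :
    ‖tensorL2 f₁ f₂‖ = ‖toL2 f₁‖ * ‖toL2 f₂‖ := by
  have h : ‖tensorL2 f₁ f₂‖ ^ 2 = (‖toL2 f₁‖ * ‖toL2 f₂‖) ^ 2 := by
    rw [mul_pow, norm_toL2_sq, norm_toL2_sq, ← integral_prod_mul]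
    refine (norm_sq_toLp _).trans ?_
    simp [tensorFun, mul_pow, Measure.volume_eq_prod]
  exact (pow_left_inj₀ (norm_nonneg _) (by positivity) two_ne_zero).1 h

lemma norm_integral_mul_le_toLp {α : Type*} [MeasurableSpace α] {μ : Measure α} (u : Lp ℂ 2 μ)
    {g : α → ℂ} (hg : MemLp g 2 μ) : ‖∫ x, u x * g x ∂μ‖ ≤ ‖u‖ * ‖hg.toLp g‖ := by
  have hg' : MemLp (fun x => (starRingEnd ℂ) (g x)) 2 μ := hg.star
  have e : inner ℂ (hg'.toLp _) u = ∫ x, u x * g x ∂μ := by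
    rw [MeasureTheory.L2.inner_def]
    refine integral_congr_ae ?_
    filter_upwards [hg'.coeFn_toLp] with x hx
    rw [hx]
    simp
  have e' : ‖hg'.toLp _‖ = ‖hg.toLp g‖ := by
    refine (pow_left_inj₀ (norm_nonneg _) (norm_nonneg _) two_ne_zero).1 ?_
    rw [norm_sq_toLp, norm_sq_toLp]
    simp
  rw [← e, mul_comm, ← e']
  exact norm_inner_le_norm _ _

lemma norm_pair_le (u : L2 n) (g : Test n) : ‖pair u g‖ ≤ ‖u‖ * ‖toL2 g‖ :=
  norm_integral_mul_le_toLp u (g.memLp 2)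

lemma norm_pairProd_le (u : L2Prod n₁ n₂) (g₁ : Test n₁) (g₂ : Test n₂) :
    ‖pairProd u g₁ g₂‖ ≤ ‖u‖ * (‖toL2 g₁‖ * ‖toL2 g₂‖) := by
  rw [← norm_tensorL2]
  exact norm_integral_mul_le_toLp u _

lemma integral_norm_pow_le (f : Test n) {y : Euc n} {r B : ℝ} (hr : 0 ≤ r)
    (hf : ∀ x, f x ≠ 0 → ‖x - y‖ ≤ r) (hB : ∀ x, ‖f x‖ ≤ B) {k : ℕ} (hk : k ≠ 0) :
    ∫ x, ‖f x‖ ^ k ≤ B ^ k * (r ^ n * unitVol n) := by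
  have h0 : ∀ x ∉ Metric.closedBall y r, ‖f x‖ ^ k = 0 := fun x hx => by
    by_contra h
    refine hx ?_
    rw [mem_closedBall_iff_norm]
    exact hf x fun h' => h (by simp [h', hk])
  rw [← setIntegral_eq_integral_of_forall_compl_eq_zero h0]
  refine (le_abs_self _).trans ?_
  have h := norm_setIntegral_le_of_norm_le_const (μ := volume) (s := Metric.closedBall y r)
    (f := fun x => ‖f x‖ ^ k) (C := B ^ k) (isCompact_closedBall y r).measure_lt_top
    (fun x _ => by
      rw [Real.norm_of_nonneg (by positivity)]
      exact pow_le_pow_left₀ (norm_nonneg _) (hB x) k)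
  rw [Measure.addHaar_real_closedBall _ _ hr] at h
  simpa [unitVol] using h

lemma norm_toL2_le (f : Test n) {y : Euc n} {r B : ℝ} (hr : 0 ≤ r) (hB0 : 0 ≤ B)
    (hf : ∀ x, f x ≠ 0 → ‖x - y‖ ≤ r) (hB : ∀ x, ‖f x‖ ≤ B) :
    ‖toL2 f‖ ≤ B * (r ^ ((n : ℝ) / 2) * √(unitVol n)) := by
  have h := integral_norm_pow_le f hr hf hB two_ne_zero
  rw [← norm_toL2_sq] at h
  refine (pow_le_pow_iff_left₀ (norm_nonneg _) (by positivity) two_ne_zero).1 (h.trans_eq ?_)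
  rw [mul_pow, mul_pow, Real.sq_sqrt (unitVol_nonneg n), ← Real.rpow_natCast (r ^ _),
    ← Real.rpow_mul hr, ← Real.rpow_natCast r n]
  norm_num

lemma integral_norm_le (f : Test n) {y : Euc n} {r B : ℝ} (hr : 0 ≤ r)
    (hf : ∀ x, f x ≠ 0 → ‖x - y‖ ≤ r) (hB : ∀ x, ‖f x‖ ≤ B) :
    ∫ x, ‖f x‖ ≤ B * (r ^ n * unitVol n) := by
  simpa using integral_norm_pow_le f hr hf hB one_ne_zero

/-! ### Operations on test functions -/

/-- The pointwise product of two test functions. -/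
def mulTest (f g : Test n) : Test n where
  toFun x := f x * g x
  contDiff' := f.contDiff.mul g.contDiff
  hasCompactSupport' := f.hasCompactSupport.mul_right
  tsupport_subset' := fun _ _ => trivial

@[simp] lemma mulTest_apply (f g : Test n) (x : Euc n) : mulTest f g x = f x * g x := rfl

lemma atPoint_apply (f : Test n) (z : UpperHalf n) (u : Euc n) :
    atPoint f z u = (((z.2 : ℝ) ^ (-(n : ℝ) / 2) : ℝ) : ℂ) * f ((z.2 : ℝ)⁻¹ • (u - z.1)) := rfl

lemma norm_inv_smul_sub {t : ℝ} (ht : 0 < t) (u x : Euc n) : ‖t⁻¹ • (u - x)‖ = ‖u - x‖ / t := by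
  rw [norm_smul, norm_inv, Real.norm_of_nonneg ht.le, inv_mul_eq_div]

/-- There is a smooth cutoff function with values of modulus at most one which equals one on the
ball of radius two and is supported in the ball of radius four. -/
lemma exists_cutoff (n : ℕ) : ∃ χ : Test n, (∀ x, ‖x‖ ≤ 2 → χ x = 1) ∧ (∀ x, ‖χ x‖ ≤ 1) ∧
    (∀ x, ‖1 - χ x‖ ≤ 1) ∧ ∀ x, χ x ≠ 0 → ‖x‖ ≤ 4 := by
  let c : ContDiffBump (0 : Euc n) := ⟨2, 4, by norm_num, by norm_num⟩
  refine ⟨⟨fun x => (c x : ℂ), Complex.ofRealCLM.contDiff.comp c.contDiff,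
    c.hasCompactSupport.comp_left (g := ((↑) : ℝ → ℂ)) Complex.ofReal_zero,
      fun _ _ => trivial⟩, fun x hx => ?_, fun x => ?_, fun x => ?_, fun x hx => ?_⟩
  · change ((c x : ℝ) : ℂ) = 1
    rw [c.one_of_mem_closedBall (by simpa using hx), Complex.ofReal_one]
  · change ‖((c x : ℝ) : ℂ)‖ ≤ 1
    rw [Complex.norm_real, Real.norm_of_nonneg c.nonneg]
    exact c.le_one
  · change ‖1 - ((c x : ℝ) : ℂ)‖ ≤ 1
    rw [← Complex.ofReal_one, ← Complex.ofReal_sub, Complex.norm_real,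
      Real.norm_of_nonneg (sub_nonneg.2 c.le_one)]
    linarith [c.nonneg (x := x)]
  · change ((c x : ℝ) : ℂ) ≠ 0 at hx
    have : x ∈ Function.support c := fun h => hx (by simp [h])
    rw [c.support_eq, mem_ball_zero_iff] at this
    exact this.le

lemma isCutoff_of_eq_one {χ : Test n} (h : ∀ x, ‖x‖ ≤ 2 → χ x = 1) : IsCutoff χ := by
  filter_upwards [Metric.ball_mem_nhds (0 : Euc n) two_pos] with x hx
  exact h x (mem_ball_zero_iff.1 hx).le

lemma dilate_eq_one {χ : Test n} (h : ∀ x, ‖x‖ ≤ 2 → χ x = 1) (R : Set.Ioi (0 : ℝ)) {u : Euc n}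
    (hu : ‖u‖ ≤ R) : dilate χ R u = 1 := by
  have hR : (0 : ℝ) < R := R.2
  refine h _ ?_
  rw [norm_inv_smul_sub hR, sub_zero]
  exact ((div_le_one hR).2 hu).trans one_le_two

/-! ### The decay weight -/

/-- The weight `s^ε / (s + |v|)^(n + ε)`, an approximate identity at scale `s`. -/
def decayWeight (ε s : ℝ) (v : Euc n) : ℝ := s ^ ε / (s + ‖v‖) ^ ((n : ℝ) + ε)

lemma decayWeight_nonneg {ε s : ℝ} (hs : 0 ≤ s) (v : Euc n) : 0 ≤ decayWeight ε s v := by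
  unfold decayWeight; positivity

lemma continuous_decayWeight {ε s : ℝ} (hs : 0 < s) : Continuous (decayWeight (n := n) ε s) := by
  unfold decayWeight
  refine continuous_const.div ((continuous_const.add continuous_norm).rpow_const fun v => ?_)
    fun v => ?_
  · exact Or.inl (add_pos_of_pos_of_nonneg hs (norm_nonneg v)).ne'
  · exact (Real.rpow_pos_of_pos (add_pos_of_pos_of_nonneg hs (norm_nonneg v)) _).ne'

lemma decayWeight_eq_scaled {ε s : ℝ} (hs : 0 < s) (v : Euc n) :
    decayWeight ε s v = (s ^ n)⁻¹ * (fun v => (1 + ‖v‖) ^ (-((n : ℝ) + ε))) (s⁻¹ • v) := by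
  have h : 1 + ‖s⁻¹ • v‖ = (s + ‖v‖) / s := by
    rw [norm_smul, norm_inv, Real.norm_of_nonneg hs.le]
    field_simp
  simp only [h]
  rw [Real.rpow_neg (by positivity), Real.div_rpow (by positivity) hs.le, decayWeight,
    ← Real.rpow_natCast, Real.rpow_add hs]
  field_simp

lemma integrable_decayWeight {ε s : ℝ} (hε : 0 < ε) (hs : 0 < s) (y : Euc n) :
    Integrable fun u : Euc n => decayWeight ε s (u - y) := by
  have h : Integrable (decayWeight (n := n) ε s) := by
    rw [funext (decayWeight_eq_scaled hs)]
    refine Integrable.const_mul ?_ _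
    have h0 : Integrable (fun v : Euc n => (1 + ‖v‖) ^ (-((n : ℝ) + ε))) :=
      integrable_one_add_norm (by simp [hε])
    exact (integrable_comp_smul_iff (volume : Measure (Euc n)) _ (inv_ne_zero hs.ne')).2 h0
  exact h.comp_sub_right y

lemma integral_decayWeight {ε s : ℝ} (hs : 0 < s) (y : Euc n) :
    ∫ u : Euc n, decayWeight ε s (u - y) = ∫ v : Euc n, (1 + ‖v‖) ^ (-((n : ℝ) + ε)) := by
  rw [integral_sub_right_eq_self (decayWeight (n := n) ε s), funext (decayWeight_eq_scaled hs),
    integral_const_mul,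
    Measure.integral_comp_inv_smul volume (fun v : Euc n => (1 + ‖v‖) ^ (-((n : ℝ) + ε)))]
  have : (0 : ℝ) < s ^ n := by positivity
  simp only [finrank_euclideanSpace, Fintype.card_fin, abs_of_pos this, smul_eq_mul]
  field_simp

/-- The total mass of the decay weight, which does not depend on the scale. -/
def weightMass (n : ℕ) (ε : ℝ) : ℝ := ∫ v : Euc n, (1 + ‖v‖) ^ (-((n : ℝ) + ε))

lemma weightMass_nonneg (n : ℕ) (ε : ℝ) : 0 ≤ weightMass n ε :=
  integral_nonneg fun _ => by positivity

/-! ### Cancellative Calderón–Zygmund forms of one parameter -/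

/-- A bilinear form on test functions with the properties of `⟨S f, g⟩`, where `S` is a cancellative
`δ`-Calderón–Zygmund operator of norm at most `A`. The kernel enters only through the decay of the
form on a mean-zero function supported in the ball of radius `s` about `y` and a function vanishing
on the ball of radius `2s`. Unlike the existence of a kernel, this is visibly preserved by
averages of forms. -/
structure IsCZForm (δ A : ℝ) (b : Test n →ₗ[ℂ] Test n →ₗ[ℂ] ℂ) : Prop where
  bound : ∀ f g, ‖b f g‖ ≤ A * (‖toL2 f‖ * ‖toL2 g‖)
  decay_right : ∀ (f g : Test n) (y : Euc n) (s : ℝ), 0 < s → MeanZero g →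
    (∀ x, g x ≠ 0 → ‖x - y‖ ≤ s) → (∀ x, f x ≠ 0 → 2 * s ≤ ‖x - y‖) →
    ‖b f g‖ ≤ A * ((∫ x, ‖g x‖) * ∫ u, ‖f u‖ * decayWeight δ s (u - y))
  decay_left : ∀ (f g : Test n) (y : Euc n) (s : ℝ), 0 < s → MeanZero f →
    (∀ x, f x ≠ 0 → ‖x - y‖ ≤ s) → (∀ x, g x ≠ 0 → 2 * s ≤ ‖x - y‖) →
    ‖b f g‖ ≤ A * ((∫ x, ‖f x‖) * ∫ u, ‖g u‖ * decayWeight δ s (u - y))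
  cancel_left : ∀ χ, IsCutoff χ → ∀ g, MeanZero g →
    Tendsto (fun R : Set.Ioi (0 : ℝ) => b (dilate χ R) g) atTop (𝓝 0)
  cancel_right : ∀ χ, IsCutoff χ → ∀ f, MeanZero f →
    Tendsto (fun R : Set.Ioi (0 : ℝ) => b f (dilate χ R)) atTop (𝓝 0)

lemma IsCZForm.flip {δ A : ℝ} {b : Test n →ₗ[ℂ] Test n →ₗ[ℂ] ℂ} (h : IsCZForm δ A b) :
    IsCZForm δ A b.flip where
  bound f g := by rw [mul_comm ‖toL2 f‖]; exact h.bound g f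
  decay_right f g := h.decay_left g f
  decay_left f g := h.decay_right g f
  cancel_left := h.cancel_right
  cancel_right := h.cancel_left

/-- `f` is a bump of norm about one at the scale `t` around `x`: it is supported in the ball of
radius `t`, of size `t^(-n/2)`, and Lipschitz with the corresponding constant. -/
structure IsBump (M : ℝ) (x : Euc n) (t : ℝ) (f : Test n) : Prop where
  support : ∀ u, f u ≠ 0 → ‖u - x‖ ≤ t
  bound : ∀ u, ‖f u‖ ≤ M * t ^ (-(n : ℝ) / 2)
  lipschitz : ∀ u v, ‖f u - f v‖ ≤ M * t ^ (-(n : ℝ) / 2) * (‖u - v‖ / t)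

lemma exists_isBump_atPoint (ψ : Test n) (hψ : tsupport ψ ⊆ Metric.closedBall 0 1) :
    ∃ M : ℝ, 0 ≤ M ∧ ∀ z : UpperHalf n, IsBump M z.1 z.2 (atPoint ψ z) := by
  obtain ⟨L, hL⟩ := ContDiff.lipschitzWith_of_hasCompactSupport ψ.hasCompactSupport ψ.contDiff
    (by simp)
  obtain ⟨M, hM⟩ := ψ.continuous.bounded_above_of_compact_support ψ.hasCompactSupport
  refine ⟨max M L, (L.2).trans (le_max_right _ _), fun z => ?_⟩
  have ht : (0 : ℝ) < z.2 := z.2.2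
  have hp : (0 : ℝ) < (z.2 : ℝ) ^ (-(n : ℝ) / 2) := Real.rpow_pos_of_pos ht _
  refine ⟨fun u hu => ?_, fun u => ?_, fun u v => ?_⟩
  · rw [atPoint_apply] at hu
    have h := hψ (subset_tsupport _ (right_ne_zero_of_mul hu))
    rw [mem_closedBall_zero_iff, norm_inv_smul_sub ht] at h
    exact (div_le_one ht).1 h
  · rw [atPoint_apply, norm_mul, Complex.norm_real, Real.norm_of_nonneg hp.le, mul_comm]
    exact mul_le_mul_of_nonneg_right ((hM _).trans (le_max_left _ _)) hp.le
  · rw [atPoint_apply, atPoint_apply, ← mul_sub, norm_mul, Complex.norm_real,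
      Real.norm_of_nonneg hp.le, mul_comm (max M L), mul_assoc]
    refine mul_le_mul_of_nonneg_left ((hL.norm_sub_le _ _).trans ?_) hp.le
    have e : (z.2 : ℝ)⁻¹ • (u - z.1) - (z.2 : ℝ)⁻¹ • (v - z.1) = (z.2 : ℝ)⁻¹ • (u - v) := by
      rw [← smul_sub]; congr 1; abel
    rw [e, norm_inv_smul_sub ht]
    exact mul_le_mul_of_nonneg_right (le_max_right _ _) (by positivity)

lemma meanZero_atPoint {ψ : Test n} (hψ : MeanZero ψ) (z : UpperHalf n) :
    MeanZero (atPoint ψ z) := by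
  unfold MeanZero at *
  simp only [atPoint_apply]
  rw [integral_const_mul,
    integral_sub_right_eq_self (fun u : Euc n => ψ ((z.2 : ℝ)⁻¹ • u)),
    Measure.integral_comp_inv_smul volume (fun u : Euc n => ψ u), hψ]
  simp

section

variable {δ A M t s : ℝ} {b : Test n →ₗ[ℂ] Test n →ₗ[ℂ] ℂ} {f g : Test n} {x y : Euc n}

lemma IsBump.integral_norm_le (hf : IsBump M x t f) (ht : 0 < t) :
    ∫ u, ‖f u‖ ≤ M * unitVol n * t ^ ((n : ℝ) / 2) := by
  refine (BiParam.integral_norm_le f ht.le hf.support hf.bound).trans_eq ?_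
  have e : t ^ (-(n : ℝ) / 2) * t ^ n = t ^ ((n : ℝ) / 2) := by
    rw [← Real.rpow_natCast, ← Real.rpow_add ht]; congr 1; ring
  rw [← e]; ring

lemma IsBump.norm_toL2_le (hM : 0 ≤ M) (hf : IsBump M x t f) (ht : 0 < t) :
    ‖toL2 f‖ ≤ M * √(unitVol n) := by
  refine (BiParam.norm_toL2_le f ht.le (by positivity) hf.support hf.bound).trans_eq ?_
  have e : t ^ (-(n : ℝ) / 2) * t ^ ((n : ℝ) / 2) = 1 := by
    rw [← Real.rpow_add ht, ← add_div, neg_add_cancel, zero_div, Real.rpow_zero]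
  linear_combination M * √(unitVol n) * e

/-- Off-diagonal estimate: the form on two bumps whose distance exceeds the larger scale. -/
lemma IsCZForm.norm_le_of_far (hb : IsCZForm δ A b) (hδ : 0 < δ) (hA : 0 ≤ A) (hM : 0 ≤ M)
    (ht : 0 < t) (hs : 0 < s) (hst : s ≤ t) (hf : IsBump M x t f) (hg : IsBump M y s g)
    (hg0 : MeanZero g) (hd : 3 * t ≤ ‖x - y‖) :
    ‖b f g‖ ≤ A * (M ^ 2 * unitVol n ^ 2 * 2 ^ ((n : ℝ) + δ)) *
      ((s / t) ^ ((n : ℝ) / 2 + δ) * (t / (t + ‖x - y‖)) ^ ((n : ℝ) + δ)) := by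
  have hd' : ∀ u, f u ≠ 0 → ‖x - y‖ - t ≤ ‖u - y‖ := fun u hu => by
    have h1 := hf.support u hu
    have h2 := norm_sub_le_norm_sub_add_norm_sub x u y
    rw [norm_sub_rev x u] at h2
    linarith
  have hn := unitVol_nonneg n
  set d := ‖x - y‖
  have hd0 : 0 ≤ d := norm_nonneg _
  have h := hb.decay_right f g y s hs hg0 hg.support fun u hu => by
    linarith [hd' u hu]
  have h1 : ∫ u, ‖f u‖ * decayWeight δ s (u - y) ≤
      M * unitVol n * t ^ ((n : ℝ) / 2) * (s ^ δ * 2 ^ ((n : ℝ) + δ) / (t + d) ^ ((n : ℝ) + δ)) := by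
    refine le_trans ?_ (mul_le_mul_of_nonneg_right (hf.integral_norm_le ht) (by positivity))
    rw [← integral_mul_const]
    refine integral_mono_of_nonneg
      (ae_of_all _ fun u => mul_nonneg (norm_nonneg _) (decayWeight_nonneg hs.le _))
      (f.integrable.norm.mul_const _) (ae_of_all _ fun u => ?_)
    by_cases hu : f u = 0
    · simp [hu]
    refine mul_le_mul_of_nonneg_left ?_ (norm_nonneg _)
    rw [mul_div_assoc, decayWeight, div_eq_mul_inv]
    refine mul_le_mul_of_nonneg_left ?_ (by positivity)
    rw [← Real.div_rpow (by positivity) (by positivity), ← Real.inv_rpow (by positivity)]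
    refine Real.rpow_le_rpow (by positivity) ?_ (by positivity)
    rw [inv_eq_one_div, div_le_div_iff₀ (by positivity) (by positivity)]
    linarith [hd' u hu]
  refine h.trans ?_
  have h2 := mul_le_mul (hg.integral_norm_le hs) h1 (integral_nonneg fun u =>
    mul_nonneg (norm_nonneg _) (decayWeight_nonneg hs.le _)) (by positivity)
  refine (mul_le_mul_of_nonneg_left h2 hA).trans_eq ?_
  rw [Real.div_rpow hs.le ht.le, Real.div_rpow ht.le (by positivity), Real.rpow_add hs,
    Real.rpow_add ht, Real.rpow_add ht, show t ^ (n : ℝ) = t ^ ((n : ℝ) / 2) * t ^ ((n : ℝ) / 2) by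
      rw [← Real.rpow_add ht, add_halves]]
  have : 0 < t ^ ((n : ℝ) / 2) := by positivity
  field_simp

/-- Near-diagonal estimate. The constant `f y` is subtracted from the bump `f` at the larger scale,
which does not change the form because of the cancellation. The difference is small at the
smaller scale near `y`, where the boundedness on `L²` applies, and away from `y` the
decay applies. -/
lemma IsCZForm.norm_le_of_near (hb : IsCZForm δ A b) (hδ : 0 < δ) (hδ1 : δ ≤ 1) (hA : 0 ≤ A)
    (hM : 0 ≤ M) (ht : 0 < t) (hs : 0 < s) (hst : s ≤ t) (hf : IsBump M x t f) (hg : IsBump M y s g)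
    (hg0 : MeanZero g) :
    ‖b f g‖ ≤ A * (M ^ 2 * unitVol n * (4 * 4 ^ ((n : ℝ) / 2) + 2 * weightMass n (δ / 2))) *
      (s / t) ^ ((n : ℝ) / 2 + δ / 2) := by
  obtain ⟨χ, hχ1, hχb, hχb', hχs⟩ := exists_cutoff n
  have hn := unitVol_nonneg n
  let χs : Test n := rescale y ⟨s, hs⟩ χ
  have hχs_apply : ∀ u, χs u = χ (s⁻¹ • (u - y)) := fun u => rfl
  set τ := t ^ (-(n : ℝ) / 2) with hτ
  have hτ0 : 0 < τ := Real.rpow_pos_of_pos ht _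
  have hτs : τ * s ^ ((n : ℝ) / 2) = (s / t) ^ ((n : ℝ) / 2) := by
    rw [Real.div_rpow hs.le ht.le, hτ, neg_div, Real.rpow_neg ht.le]
    field_simp
  have hst0 : 0 < s / t := by positivity
  have hst1 : s / t ≤ 1 := (div_le_one ht).2 hst
  -- the estimate for the cut-off constant removed, valid as soon as the cutoff is large enough
  have key : ∀ R : Set.Ioi (0 : ℝ), ‖y‖ + t + 4 * s ≤ R →
      ‖b (f - f y • dilate χ R) g‖ ≤
        A * (M ^ 2 * unitVol n * (4 * 4 ^ ((n : ℝ) / 2) + 2 * weightMass n (δ / 2))) *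
      (s / t) ^ ((n : ℝ) / 2 + δ / 2) := by
    intro R hR
    set h := f - f y • dilate χ R with hh
    have h_apply : ∀ u, h u = f u - f y * dilate χ R u := fun u => rfl
    have hnear : ∀ u, ‖u - y‖ ≤ t + 4 * s → ‖h u‖ ≤ M * τ * (‖u - y‖ / t) := fun u hu => by
      have : ‖u‖ ≤ R := by linarith [norm_le_norm_sub_add u y]
      rw [h_apply, dilate_eq_one hχ1 R this, mul_one]
      exact hf.lipschitz u y
    have hall : ∀ u, ‖h u‖ ≤ 2 * (M * τ) := fun u => by
      rw [h_apply]
      refine (norm_sub_le _ _).trans ?_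
      rw [norm_mul]
      have h1 := hf.bound u
      have h2 := mul_le_mul (hf.bound y) (hχb ((R : ℝ)⁻¹ • (u - 0))) (norm_nonneg _)
        (by positivity)
      change _ ≤ _ at h2
      have h3 : ‖dilate χ R u‖ = ‖χ ((R : ℝ)⁻¹ • (u - 0))‖ := rfl
      rw [h3]
      linarith
    -- the Hölder exponent `δ / 2` spends only half of the decay, and the rest is integrable
    have hpow : ∀ u, ‖h u‖ ≤ 2 * (M * τ) * ((s + ‖u - y‖) / t) ^ (δ / 2) := fun u => by
      rcases le_total ‖u - y‖ t with hu | hu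
      · have h0 : ‖u - y‖ / t ≤ 1 := (div_le_one ht).2 hu
        have h1 : ‖u - y‖ / t ≤ (‖u - y‖ / t) ^ (δ / 2) := by
          conv_lhs => rw [← Real.rpow_one (‖u - y‖ / t)]
          exact Real.rpow_le_rpow_of_exponent_ge_of_imp (by positivity) h0 (by linarith)
            (fun _ h => absurd h (by positivity))
        have h2 : (‖u - y‖ / t) ^ (δ / 2) ≤ ((s + ‖u - y‖) / t) ^ (δ / 2) :=
          Real.rpow_le_rpow (by positivity) (by gcongr; linarith) (by positivity)
        have h3 := hnear u (by linarith)
        have h4 := mul_le_mul_of_nonneg_left (h1.trans h2) (mul_nonneg hM hτ0.le)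
        have h5 : 0 ≤ M * τ * ((s + ‖u - y‖) / t) ^ (δ / 2) := by positivity
        linarith
      · have h1 : 1 ≤ ((s + ‖u - y‖) / t) ^ (δ / 2) :=
          Real.one_le_rpow ((one_le_div ht).2 (by linarith)) (by positivity)
        exact (hall u).trans (le_mul_of_one_le_right (by positivity) h1)
    -- the part near `y`
    have part1 : ‖b (mulTest h χs) g‖ ≤
        A * (M ^ 2 * unitVol n * (4 * 4 ^ ((n : ℝ) / 2))) * (s / t) ^ ((n : ℝ) / 2 + δ / 2) := by
      have hsupp : ∀ u, mulTest h χs u ≠ 0 → ‖u - y‖ ≤ 4 * s := fun u hu => by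
        have := hχs _ (right_ne_zero_of_mul hu)
        change ‖s⁻¹ • (u - y)‖ ≤ 4 at this
        rw [norm_inv_smul_sub hs] at this
        exact (div_le_iff₀ hs).1 this
      have hbd : ∀ u, ‖mulTest h χs u‖ ≤ M * τ * (4 * (s / t)) := fun u => by
        by_cases hu : mulTest h χs u = 0
        · rw [hu, norm_zero]; positivity
        have h4 := hsupp u hu
        rw [mulTest_apply, norm_mul]
        refine (mul_le_of_le_one_right (norm_nonneg _) (hχb _)).trans ?_
        refine (hnear u (by linarith)).trans (mul_le_mul_of_nonneg_left ?_ (by positivity))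
        rw [← mul_div_assoc]
        gcongr
      have h1 := BiParam.norm_toL2_le (mulTest h χs) (by positivity : (0 : ℝ) ≤ 4 * s)
        (by positivity) hsupp hbd
      have h2 := hg.norm_toL2_le hM hs
      refine (hb.bound _ _).trans ?_
      refine (mul_le_mul_of_nonneg_left (mul_le_mul h1 h2 (norm_nonneg _) (by positivity))
        hA).trans ?_
      have h3 : (s / t) * (s / t) ^ ((n : ℝ) / 2) ≤ (s / t) ^ ((n : ℝ) / 2 + δ / 2) := by
        rw [add_comm, Real.rpow_add hst0]
        refine mul_le_mul_of_nonneg_right ?_ (by positivity)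
        conv_lhs => rw [← Real.rpow_one (s / t)]
        exact Real.rpow_le_rpow_of_exponent_ge hst0 hst1 (by linarith)
      refine le_trans (le_of_eq ?_) (mul_le_mul_of_nonneg_left h3 (by positivity))
      rw [Real.mul_rpow (by norm_num) hs.le]
      have h4 := Real.mul_self_sqrt hn
      linear_combination (A * M ^ 2 * 4 * 4 ^ ((n : ℝ) / 2) * (s / t)) *
        (√(unitVol n) * √(unitVol n) * hτs + (s / t) ^ ((n : ℝ) / 2) * h4)
    -- the part away from `y`
    have part2 : ‖b (h - mulTest h χs) g‖ ≤
        A * (M ^ 2 * unitVol n * (2 * weightMass n (δ / 2))) *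
          (s / t) ^ ((n : ℝ) / 2 + δ / 2) := by
      have e : ∀ u, (h - mulTest h χs) u = h u * (1 - χs u) := fun u => by
        change h u - h u * χs u = _; ring
      have hw : ∀ u, ‖(h - mulTest h χs) u‖ * decayWeight δ s (u - y) ≤
          2 * (M * τ) * (s / t) ^ (δ / 2) * decayWeight (δ / 2) s (u - y) := fun u => by
        have h1 : ‖(h - mulTest h χs) u‖ ≤ 2 * (M * τ) * ((s + ‖u - y‖) / t) ^ (δ / 2) := by
          rw [e, norm_mul]
          exact (mul_le_of_le_one_right (norm_nonneg _) (hχb' _)).trans (hpow u)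
        refine (mul_le_mul_of_nonneg_right h1 (decayWeight_nonneg hs.le _)).trans_eq ?_
        have hp : 0 < s + ‖u - y‖ := by positivity
        rw [decayWeight, decayWeight, Real.div_rpow hp.le ht.le, Real.div_rpow hs.le ht.le,
          show (n : ℝ) + δ = (n : ℝ) + δ / 2 + δ / 2 by ring, Real.rpow_add hp _ (δ / 2),
          show s ^ δ = s ^ (δ / 2) * s ^ (δ / 2) by rw [← Real.rpow_add hs, add_halves]]
        field_simp
      have h1 := hb.decay_right (h - mulTest h χs) g y s hs hg0 hg.support fun u hu => by
        by_contra hlt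
        push Not at hlt
        refine hu ?_
        rw [e, hχs_apply, hχ1, sub_self, mul_zero]
        rw [norm_inv_smul_sub hs, div_le_iff₀ hs]
        exact hlt.le
      refine h1.trans ?_
      have h2 : ∫ u, ‖(h - mulTest h χs) u‖ * decayWeight δ s (u - y) ≤
          2 * (M * τ) * (s / t) ^ (δ / 2) * weightMass n (δ / 2) := by
        rw [weightMass, ← integral_decayWeight hs y, ← integral_const_mul]
        exact integral_mono_of_nonneg
          (ae_of_all _ fun u => mul_nonneg (norm_nonneg _) (decayWeight_nonneg hs.le _))
          ((integrable_decayWeight (by positivity) hs y).const_mul _) (ae_of_all _ hw)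
      refine (mul_le_mul_of_nonneg_left (mul_le_mul (hg.integral_norm_le hs) h2
        (integral_nonneg fun u => mul_nonneg (norm_nonneg _) (decayWeight_nonneg hs.le _))
        (by positivity)) hA).trans_eq ?_
      rw [Real.rpow_add hst0, ← hτs]
      ring
    have e : b h g = b (mulTest h χs) g + b (h - mulTest h χs) g := by
      rw [← LinearMap.add_apply, ← map_add, add_sub_cancel]
    rw [e]
    refine (norm_add_le _ _).trans ((add_le_add part1 part2).trans_eq ?_)
    ring
  have hlim : Tendsto (fun R : Set.Ioi (0 : ℝ) => ‖b (f - f y • dilate χ R) g‖) atTop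
      (𝓝 ‖b f g‖) := by
    have h := ((hb.cancel_left χ (isCutoff_of_eq_one hχ1) g hg0).const_mul (f y)).const_sub (b f g)
    rw [mul_zero, sub_zero] at h
    refine h.norm.congr fun R => ?_
    simp
  refine le_of_tendsto hlim ?_
  filter_upwards [eventually_ge_atTop (⟨‖y‖ + t + 4 * s, by
    have := norm_nonneg y
    exact Set.mem_Ioi.2 (by linarith)⟩ : Set.Ioi (0 : ℝ))] with R hR
  exact key R hR

end

/-- The almost diagonal kernel `(m/M)^(n/2 + α) (M/(M + |x - y|))^(n + α)` for `z = (x, t)` and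
`w = (y, s)`, where `m` and `M` are the minimum and the maximum of `t` and `s`. -/
def almostDiag (α : ℝ) (z w : UpperHalf n) : ℝ :=
  (min (z.2 : ℝ) w.2 / max (z.2 : ℝ) w.2) ^ ((n : ℝ) / 2 + α) *
    (max (z.2 : ℝ) w.2 / (max (z.2 : ℝ) w.2 + ‖z.1 - w.1‖)) ^ ((n : ℝ) + α)

lemma almostDiag_comm (α : ℝ) (z w : UpperHalf n) : almostDiag α z w = almostDiag α w z := by
  rw [almostDiag, almostDiag, min_comm, max_comm, norm_sub_rev]

lemma almostDiag_nonneg (α : ℝ) (z w : UpperHalf n) : 0 ≤ almostDiag α z w := by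
  have h1 : (0 : ℝ) < z.2 := z.2.2
  have h2 : (0 : ℝ) < w.2 := w.2.2
  unfold almostDiag
  positivity

/-- The wavelet matrix of a cancellative Calderón–Zygmund form is almost diagonal, with a constant
that is linear in the norm `A` of the form. -/
lemma exists_norm_le_almostDiag {ψ : Test n} (hψ : IsMotherWavelet ψ) {δ : ℝ} (hδ : 0 < δ)
    (hδ1 : δ ≤ 1) : ∃ C : ℝ, 0 ≤ C ∧ ∀ (A : ℝ) (b : Test n →ₗ[ℂ] Test n →ₗ[ℂ] ℂ), 0 ≤ A →
      IsCZForm δ A b → ∀ z w : UpperHalf n,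
        ‖b (atPoint ψ z) (atPoint ψ w)‖ ≤ C * A * almostDiag (δ / 2) z w := by
  obtain ⟨M, hM, hbump⟩ := exists_isBump_atPoint ψ hψ.support
  have hn := unitVol_nonneg n
  have hw := weightMass_nonneg n (δ / 2)
  set C₁ := M ^ 2 * unitVol n ^ 2 * 2 ^ ((n : ℝ) + δ) with hC₁
  set C₂ := M ^ 2 * unitVol n * (4 * 4 ^ ((n : ℝ) / 2) + 2 * weightMass n (δ / 2)) with hC₂
  have hC₁0 : 0 ≤ C₁ := by positivity
  have hC₂0 : 0 ≤ C₂ := by positivity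
  set C := C₁ + C₂ * 4 ^ ((n : ℝ) + δ / 2) with hC
  refine ⟨C, by positivity, ?_⟩
  have main : ∀ (A : ℝ) (b : Test n →ₗ[ℂ] Test n →ₗ[ℂ] ℂ), 0 ≤ A → IsCZForm δ A b →
      ∀ z w : UpperHalf n, (w.2 : ℝ) ≤ z.2 →
        ‖b (atPoint ψ z) (atPoint ψ w)‖ ≤ C * A * almostDiag (δ / 2) z w := by
    intro A b hA hb z w hzw
    have ht : (0 : ℝ) < z.2 := z.2.2
    have hs : (0 : ℝ) < w.2 := w.2.2
    have hmean := meanZero_atPoint hψ.meanZero w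
    rw [almostDiag, min_eq_right hzw, max_eq_left hzw]
    set t := (z.2 : ℝ)
    set s := (w.2 : ℝ)
    set d := ‖z.1 - w.1‖ with hd
    have hd0 : 0 ≤ d := norm_nonneg _
    have hr0 : 0 < s / t := by positivity
    have hr1 : s / t ≤ 1 := (div_le_one ht).2 hzw
    have hq0 : 0 < t / (t + d) := by positivity
    have hq1 : t / (t + d) ≤ 1 := (div_le_one (by positivity)).2 (by linarith)
    rcases le_total (3 * t) d with hfar | hnear
    · refine (hb.norm_le_of_far hδ hA hM ht hs hzw (hbump z) (hbump w) hmean hfar).trans ?_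
      rw [← hC₁]
      refine mul_le_mul ?_ (mul_le_mul
        (Real.rpow_le_rpow_of_exponent_ge hr0 hr1 (by linarith))
        (Real.rpow_le_rpow_of_exponent_ge hq0 hq1 (by linarith)) (by positivity) (by positivity))
        (by positivity) (by positivity)
      rw [mul_comm]
      refine mul_le_mul_of_nonneg_right ?_ hA
      rw [hC]
      exact le_add_of_nonneg_right (by positivity)
    · refine (hb.norm_le_of_near hδ hδ1 hA hM ht hs hzw (hbump z) (hbump w) hmean).trans ?_
      rw [← hC₂]
      have h1 : 1 ≤ 4 ^ ((n : ℝ) + δ / 2) * (t / (t + d)) ^ ((n : ℝ) + δ / 2) := by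
        rw [← Real.mul_rpow (by norm_num) hq0.le]
        refine Real.one_le_rpow ?_ (by positivity)
        rw [← mul_div_assoc, one_le_div (by positivity)]
        linarith
      have h2 : A * C₂ * (s / t) ^ ((n : ℝ) / 2 + δ / 2) * 1 ≤ A * C₂ *
          (s / t) ^ ((n : ℝ) / 2 + δ / 2) *
          (4 ^ ((n : ℝ) + δ / 2) * (t / (t + d)) ^ ((n : ℝ) + δ / 2)) :=
        mul_le_mul_of_nonneg_left h1 (by positivity)
      have h3 : 0 ≤ C₁ * A * ((s / t) ^ ((n : ℝ) / 2 + δ / 2) *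
          (t / (t + d)) ^ ((n : ℝ) + δ / 2)) := by positivity
      rw [hC]
      nlinarith [h2, h3]
  intro A b hA hb z w
  rcases le_total (w.2 : ℝ) (z.2 : ℝ) with h | h
  · exact main A b hA hb z w h
  · rw [almostDiag_comm]
    exact main A b.flip hA hb.flip w z h

/-! ### Decay of forms with Calderón–Zygmund kernels -/

lemma disjoint_tsupport_of_separated {f g : Test n} {y : Euc n} {s : ℝ} (hs : 0 < s)
    (hg : ∀ x, g x ≠ 0 → ‖x - y‖ ≤ s) (hf : ∀ x, f x ≠ 0 → 2 * s ≤ ‖x - y‖) :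
    Disjoint (tsupport f) (tsupport g) := by
  have hc : Continuous fun x : Euc n => ‖x - y‖ := by fun_prop
  have h1 : tsupport f ⊆ {x | 2 * s ≤ ‖x - y‖} :=
    closure_minimal hf (isClosed_le continuous_const hc)
  have h2 : tsupport g ⊆ {x | ‖x - y‖ ≤ s} := closure_minimal hg (isClosed_le hc continuous_const)
  refine Set.disjoint_left.2 fun x hx hx' => ?_
  have h3 : 2 * s ≤ ‖x - y‖ := h1 hx
  have h4 : ‖x - y‖ ≤ s := h2 hx'
  linarith

/-- The kernel bound behind the decay of a form: as `g` has mean zero, `κ y u` can be subtracted.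
Only sections of the kernel `κ` in its first variable are compared, so that no joint
measurability of `κ` is needed beyond the integrability of the whole integrand. -/
lemma norm_integral_kernel_le {κ : Euc n → Euc n → ℂ} {δ A : ℝ} (hδ : 0 < δ) (hA : 0 ≤ A)
    (hκ : ∀ x y y', x ≠ y → ‖y - y'‖ ≤ ‖x - y‖ / 2 →
      ‖κ y x - κ y' x‖ ≤ A * ‖y - y'‖ ^ δ / ‖x - y‖ ^ ((n : ℝ) + δ))
    {f g : Test n} (hint : Integrable fun p : Euc n × Euc n => f p.2 * g p.1 * κ p.1 p.2)
    {y : Euc n} {s : ℝ} (hs : 0 < s) (hg0 : MeanZero g) (hg : ∀ x, g x ≠ 0 → ‖x - y‖ ≤ s)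
    (hf : ∀ x, f x ≠ 0 → 2 * s ≤ ‖x - y‖) :
    ‖∫ p : Euc n × Euc n, f p.2 * g p.1 * κ p.1 p.2‖ ≤
      2 ^ ((n : ℝ) + δ) * A * ((∫ x, ‖g x‖) * ∫ u, ‖f u‖ * decayWeight δ s (u - y)) := by
  rw [Measure.volume_eq_prod] at hint ⊢
  rw [integral_prod_symm _ hint]
  have hwint : Integrable fun u => ‖f u‖ * decayWeight δ s (u - y) :=
    ((f.continuous.norm.mul ((continuous_decayWeight hs).comp (continuous_sub_right y)))
      |>.integrable_of_hasCompactSupport (f.hasCompactSupport.norm.mul_right))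
  rw [← integral_const_mul, ← integral_const_mul]
  refine norm_integral_le_of_norm_le ((hwint.const_mul _).const_mul _) ?_
  filter_upwards [hint.prod_left_ae] with u hu
  by_cases hfu : f u = 0
  · simp [hfu]
  have hd := hf u hfu
  have hd0 : 0 < ‖u - y‖ := by linarith
  have hne : u ≠ y := fun h => by simp [h] at hd0
  have e : ∫ x, f u * g x * κ x u = ∫ x, f u * g x * (κ x u - κ y u) := by
    have h0 : ∫ x, f u * g x * κ y u = 0 := by
      rw [integral_mul_const, integral_const_mul, hg0, mul_zero, zero_mul]
    have hi : Integrable fun x => f u * g x * κ y u := (g.integrable.const_mul _).mul_const _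
    calc ∫ x, f u * g x * κ x u
        = (∫ x, f u * g x * κ x u) - ∫ x, f u * g x * κ y u := by rw [h0, sub_zero]
      _ = ∫ x, f u * g x * (κ x u - κ y u) := by
        rw [← integral_sub hu hi]
        simp only [mul_sub]
  rw [e]
  have hb : ∀ x, ‖f u * g x * (κ x u - κ y u)‖ ≤
      ‖g x‖ * (‖f u‖ * (2 ^ ((n : ℝ) + δ) * A * decayWeight δ s (u - y))) := fun x => by
    by_cases hgx : g x = 0
    · simp [hgx]
    have hx := hg x hgx
    rw [norm_mul, norm_mul, mul_comm ‖f u‖, mul_assoc]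
    refine mul_le_mul_of_nonneg_left (mul_le_mul_of_nonneg_left ?_ (norm_nonneg _)) (norm_nonneg _)
    rw [norm_sub_rev]
    refine (hκ u y x hne (by rw [norm_sub_rev y x]; linarith)).trans ?_
    rw [norm_sub_rev y x, decayWeight, mul_div_assoc, mul_comm _ A, mul_assoc]
    refine mul_le_mul_of_nonneg_left ?_ hA
    have h1 : ‖x - y‖ ^ δ ≤ s ^ δ := Real.rpow_le_rpow (norm_nonneg _) hx hδ.le
    have h2 : (s + ‖u - y‖) ^ ((n : ℝ) + δ) ≤ 2 ^ ((n : ℝ) + δ) * ‖u - y‖ ^ ((n : ℝ) + δ) := by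
      rw [← Real.mul_rpow (by norm_num) hd0.le]
      exact Real.rpow_le_rpow (by positivity) (by linarith) (by positivity)
    rw [← mul_div_assoc, div_le_div_iff₀ (by positivity) (by positivity)]
    calc _ ≤ s ^ δ * (2 ^ ((n : ℝ) + δ) * ‖u - y‖ ^ ((n : ℝ) + δ)) :=
          mul_le_mul h1 h2 (by positivity) (by positivity)
      _ = _ := by ring
  refine (norm_integral_le_of_norm_le (g.integrable.norm.mul_const _) (ae_of_all _ hb)).trans_eq ?_
  rw [integral_mul_const]
  ring

lemma norm_integral_kernel_le_swap {κ : Euc n → Euc n → ℂ} {δ A : ℝ} (hδ : 0 < δ) (hA : 0 ≤ A)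
    (hκ : ∀ x y y', x ≠ y → ‖y - y'‖ ≤ ‖x - y‖ / 2 →
      ‖κ x y - κ x y'‖ ≤ A * ‖y - y'‖ ^ δ / ‖x - y‖ ^ ((n : ℝ) + δ))
    {f g : Test n} (hint : Integrable fun p : Euc n × Euc n => f p.2 * g p.1 * κ p.1 p.2)
    {y : Euc n} {s : ℝ} (hs : 0 < s) (hf0 : MeanZero f) (hf : ∀ x, f x ≠ 0 → ‖x - y‖ ≤ s)
    (hg : ∀ x, g x ≠ 0 → 2 * s ≤ ‖x - y‖) :
    ‖∫ p : Euc n × Euc n, f p.2 * g p.1 * κ p.1 p.2‖ ≤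
      2 ^ ((n : ℝ) + δ) * A * ((∫ x, ‖f x‖) * ∫ u, ‖g u‖ * decayWeight δ s (u - y)) := by
  have h := norm_integral_kernel_le (κ := fun x y => κ y x) hδ hA hκ (f := g) (g := f)
    (by
      refine (hint.swap).congr (ae_of_all _ fun p => ?_)
      simp only [Function.comp_apply, Prod.fst_swap, Prod.snd_swap]
      ring) hs hf0 hf hg
  refine le_trans (le_of_eq ?_) h
  rw [Measure.volume_eq_prod, ← integral_prod_swap]
  congr 2
  funext p
  simp only [Prod.fst_swap, Prod.snd_swap]
  ring

namespace CZO

variable {δ : ℝ}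

lemma norm_toCLM_le (S : CZO δ n) : ‖S.toCLM‖ ≤ ‖S‖ := by
  rw [norm_def]; linarith [S.kernelNorm_nonneg]

lemma kernelNorm_le (S : CZO δ n) : S.kernelNorm ≤ ‖S‖ := by
  rw [norm_def]; linarith [norm_nonneg S.toCLM]

lemma form_sub (S S' : CZO δ n) (f g : Test n) : (S - S').form f g = S.form f g - S'.form f g := by
  have h : (S - S').toCLM (toL2 f) + S'.toCLM (toL2 f) = S.toCLM (toL2 f) := by
    rw [← add_apply, ← toCLM_add, sub_add_cancel]
  rw [form, form, form, ← h, pair_add, add_sub_cancel_right]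

lemma norm_form_le (S : CZO δ n) (f g : Test n) :
    ‖S.form f g‖ ≤ ‖S‖ * (‖toL2 f‖ * ‖toL2 g‖) := by
  rw [← mul_assoc]
  refine (norm_pair_le _ _).trans (mul_le_mul_of_nonneg_right ?_ (norm_nonneg _))
  exact (S.toCLM.le_opNorm _).trans
    (mul_le_mul_of_nonneg_right S.norm_toCLM_le (norm_nonneg _))

/-- A bound that is linear in every kernel constant holds with the norm. -/
lemma le_norm_mul_of_forall_kernelConstants (S : CZO δ n) {X Y : ℝ} (hY : 0 ≤ Y)
    (h : ∀ C ∈ kernelConstants δ S.toCLM, X ≤ C * Y) : X ≤ ‖S‖ * Y := by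
  rcases hY.eq_or_lt with rfl | hY
  · obtain ⟨C, hC⟩ := S.nonempty
    simpa using h C hC
  · refine le_trans ?_ (mul_le_mul_of_nonneg_right S.kernelNorm_le hY.le)
    rw [← div_le_iff₀ hY]
    exact le_csInf S.nonempty fun C hC => (div_le_iff₀ hY).2 (h C hC)

lemma norm_form_le_of_right (hδ : 0 < δ) (S : CZO δ n) {f g : Test n} {y : Euc n} {s : ℝ}
    (hs : 0 < s) (hg0 : MeanZero g) (hg : ∀ x, g x ≠ 0 → ‖x - y‖ ≤ s)
    (hf : ∀ x, f x ≠ 0 → 2 * s ≤ ‖x - y‖) :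
    ‖S.form f g‖ ≤ ‖S‖ *
      (2 ^ ((n : ℝ) + δ) * ((∫ x, ‖g x‖) * ∫ u, ‖f u‖ * decayWeight δ s (u - y))) := by
  have h0 : 0 ≤ (∫ x, ‖g x‖) * ∫ u, ‖f u‖ * decayWeight δ s (u - y) :=
    mul_nonneg (integral_nonneg fun _ => norm_nonneg _)
      (integral_nonneg fun _ => mul_nonneg (norm_nonneg _) (decayWeight_nonneg hs.le _))
  refine S.le_norm_mul_of_forall_kernelConstants (by positivity) fun C hC => ?_
  obtain ⟨K, hK, hS⟩ := hC
  obtain ⟨hi, he⟩ := hS f g (disjoint_tsupport_of_separated hs hg hf)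
  have e : (fun p : Euc n × Euc n => K p.1 p.2 * f p.2 * g p.1) =
      fun p => f p.2 * g p.1 * K p.1 p.2 := by funext p; ring
  rw [e] at hi he
  rw [form, he]
  refine (norm_integral_kernel_le hδ hK.nonneg hK.smooth_left hi hs hg0 hg hf).trans_eq ?_
  ring

lemma norm_form_le_of_left (hδ : 0 < δ) (S : CZO δ n) {f g : Test n} {y : Euc n} {s : ℝ}
    (hs : 0 < s) (hf0 : MeanZero f) (hf : ∀ x, f x ≠ 0 → ‖x - y‖ ≤ s)
    (hg : ∀ x, g x ≠ 0 → 2 * s ≤ ‖x - y‖) :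
    ‖S.form f g‖ ≤ ‖S‖ *
      (2 ^ ((n : ℝ) + δ) * ((∫ x, ‖f x‖) * ∫ u, ‖g u‖ * decayWeight δ s (u - y))) := by
  have h0 : 0 ≤ (∫ x, ‖f x‖) * ∫ u, ‖g u‖ * decayWeight δ s (u - y) :=
    mul_nonneg (integral_nonneg fun _ => norm_nonneg _)
      (integral_nonneg fun _ => mul_nonneg (norm_nonneg _) (decayWeight_nonneg hs.le _))
  refine S.le_norm_mul_of_forall_kernelConstants (by positivity) fun C hC => ?_
  obtain ⟨K, hK, hS⟩ := hC
  obtain ⟨hi, he⟩ := hS f g (disjoint_tsupport_of_separated hs hf hg).symm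
  have e : (fun p : Euc n × Euc n => K p.1 p.2 * f p.2 * g p.1) =
      fun p => f p.2 * g p.1 * K p.1 p.2 := by funext p; ring
  rw [e] at hi he
  rw [form, he]
  refine (norm_integral_kernel_le_swap hδ hK.nonneg hK.smooth_right hi hs hf0 hf hg).trans_eq ?_
  ring

end CZO

section

variable {δ C Y : ℝ} {K : Euc n₁ → Euc n₁ → CZO δ n₂} {f g : Test n₁} {f' g' : Test n₂}
  {y : Euc n₁} {s : ℝ}

lemma norm_integral_form_le (hδ : 0 < δ) (hK : IsCZKernel δ C K) (hY0 : 0 ≤ Y)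
    (hY : ∀ S : CZO δ n₂, ‖S.form f' g'‖ ≤ ‖S‖ * Y)
    (hint : Integrable fun p : Euc n₁ × Euc n₁ => f p.2 * g p.1 * (K p.1 p.2).form f' g')
    (hs : 0 < s) (hg0 : MeanZero g) (hg : ∀ x, g x ≠ 0 → ‖x - y‖ ≤ s)
    (hf : ∀ x, f x ≠ 0 → 2 * s ≤ ‖x - y‖) :
    ‖∫ p : Euc n₁ × Euc n₁, f p.2 * g p.1 * (K p.1 p.2).form f' g'‖ ≤
      2 ^ ((n₁ : ℝ) + δ) * (C * Y) *
        ((∫ x, ‖g x‖) * ∫ u, ‖f u‖ * decayWeight δ s (u - y)) := by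
  refine norm_integral_kernel_le (κ := fun x y => (K x y).form f' g') hδ
    (mul_nonneg hK.nonneg hY0) (fun x y y' hxy hy => ?_) hint hs hg0 hg hf
  rw [← CZO.form_sub]
  refine (hY _).trans ((mul_le_mul_of_nonneg_right (hK.smooth_left x y y' hxy hy) hY0).trans_eq ?_)
  ring

lemma norm_integral_form_le_swap (hδ : 0 < δ) (hK : IsCZKernel δ C K) (hY0 : 0 ≤ Y)
    (hY : ∀ S : CZO δ n₂, ‖S.form f' g'‖ ≤ ‖S‖ * Y)
    (hint : Integrable fun p : Euc n₁ × Euc n₁ => f p.2 * g p.1 * (K p.1 p.2).form f' g')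
    (hs : 0 < s) (hf0 : MeanZero f) (hf : ∀ x, f x ≠ 0 → ‖x - y‖ ≤ s)
    (hg : ∀ x, g x ≠ 0 → 2 * s ≤ ‖x - y‖) :
    ‖∫ p : Euc n₁ × Euc n₁, f p.2 * g p.1 * (K p.1 p.2).form f' g'‖ ≤
      2 ^ ((n₁ : ℝ) + δ) * (C * Y) *
        ((∫ x, ‖f x‖) * ∫ u, ‖g u‖ * decayWeight δ s (u - y)) := by
  refine norm_integral_kernel_le_swap (κ := fun x y => (K x y).form f' g') hδ
    (mul_nonneg hK.nonneg hY0) (fun x y y' hxy hy => ?_) hint hs hf0 hf hg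
  rw [← CZO.form_sub]
  refine (hY _).trans ((mul_le_mul_of_nonneg_right (hK.smooth_right x y y' hxy hy) hY0).trans_eq ?_)
  ring

end

/-! ### The wavelet matrix of a bi-parameter operator -/

namespace BiOp

/-- The form `(f₁, g₁) ↦ ⟨T (f₁ ⊗ f₂), g₁ ⊗ g₂⟩` in the first parameter. -/
def slice₁ (T : BiOp n₁ n₂) (f₂ g₂ : Test n₂) : Test n₁ →ₗ[ℂ] Test n₁ →ₗ[ℂ] ℂ :=
  LinearMap.mk₂ ℂ (fun f₁ g₁ => T (f₁ ⊗ₜ f₂) (g₁ ⊗ₜ g₂))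
    (fun _ _ _ => by simp [add_tmul]) (fun _ _ _ => by simp [← smul_tmul'])
    (fun _ _ _ => by simp [add_tmul]) (fun _ _ _ => by simp [← smul_tmul'])

/-- The form `(f₂, g₂) ↦ ⟨T (f₁ ⊗ f₂), g₁ ⊗ g₂⟩` in the second parameter. -/
def slice₂ (T : BiOp n₁ n₂) (f₁ g₁ : Test n₁) : Test n₂ →ₗ[ℂ] Test n₂ →ₗ[ℂ] ℂ :=
  LinearMap.mk₂ ℂ (fun f₂ g₂ => T (f₁ ⊗ₜ f₂) (g₁ ⊗ₜ g₂))
    (fun _ _ _ => by simp [tmul_add]) (fun _ _ _ => by simp)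
    (fun _ _ _ => by simp [tmul_add]) (fun _ _ _ => by simp)

@[simp] lemma slice₂_apply (T : BiOp n₁ n₂) (f₁ g₁ : Test n₁) (f₂ g₂ : Test n₂) :
    T.slice₂ f₁ g₁ f₂ g₂ = T (f₁ ⊗ₜ f₂) (g₁ ⊗ₜ g₂) := rfl

variable {δ : ℝ} {T : BiOp n₁ n₂}

/-- The slice at arbitrary functions in the first parameter is a cancellative Calderón–Zygmund form,
controlled by the `L²` norms of these functions. -/
lemma exists_isCZForm_slice₂ (hδ : 0 < δ) (hT : T.IsCZO δ) (hcanc : T.IsFullyCancellative) :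
    ∃ C : ℝ, 0 ≤ C ∧ ∀ f₁ g₁ : Test n₁,
      IsCZForm δ (C * (‖toL2 f₁‖ * ‖toL2 g₁‖)) (T.slice₂ f₁ g₁) := by
  obtain ⟨S, hS⟩ := hT.bounded
  obtain ⟨C, K, hK, hTK⟩ := hT.isSingularIntegral.kernel₂
  have hC := hK.nonneg
  refine ⟨‖S‖ + 2 ^ ((n₂ : ℝ) + δ) * C, by positivity, fun f₁ g₁ => ?_⟩
  set Y := ‖toL2 f₁‖ * ‖toL2 g₁‖ with hY
  have hY0 : 0 ≤ Y := by positivity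
  have hmono : ∀ D : ℝ, 0 ≤ D → 2 ^ ((n₂ : ℝ) + δ) * (C * Y) * D ≤
      (‖S‖ + 2 ^ ((n₂ : ℝ) + δ) * C) * Y * D := fun D hD => by
    have : 0 ≤ ‖S‖ * Y * D := by positivity
    linarith
  refine ⟨fun f g => ?_, fun f g y s hs hg0 hg hf => ?_, fun f g y s hs hf0 hf hg => ?_,
    fun χ hχ g hg => hcanc.dot_one_dot_dot χ hχ f₁ g₁ g hg,
    fun χ hχ f hf => hcanc.dot_dot_dot_one χ hχ f₁ g₁ f hf⟩
  · rw [slice₂_apply, ← hS]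
    refine (norm_pairProd_le _ _ _).trans ?_
    have h1 : ‖S (tensorL2 f₁ f)‖ ≤ ‖S‖ * (‖toL2 f₁‖ * ‖toL2 f‖) := by
      rw [← norm_tensorL2]; exact S.le_opNorm _
    refine (mul_le_mul_of_nonneg_right h1 (by positivity)).trans ?_
    have : 0 ≤ 2 ^ ((n₂ : ℝ) + δ) * C * (Y * (‖toL2 f‖ * ‖toL2 g‖)) := by positivity
    rw [hY] at this ⊢
    linarith
  · obtain ⟨hi, he⟩ := hTK f₁ g₁ f g (disjoint_tsupport_of_separated hs hg hf)
    rw [slice₂_apply, he]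
    refine (norm_integral_form_le hδ hK hY0 (fun S => S.norm_form_le f₁ g₁) hi hs hg0 hg hf).trans
      (hmono _ ?_)
    exact mul_nonneg (integral_nonneg fun _ => norm_nonneg _)
      (integral_nonneg fun _ => mul_nonneg (norm_nonneg _) (decayWeight_nonneg hs.le _))
  · obtain ⟨hi, he⟩ := hTK f₁ g₁ f g (disjoint_tsupport_of_separated hs hf hg).symm
    rw [slice₂_apply, he]
    refine (norm_integral_form_le_swap hδ hK hY0 (fun S => S.norm_form_le f₁ g₁) hi hs hf0 hf
      hg).trans (hmono _ ?_)
    exact mul_nonneg (integral_nonneg fun _ => norm_nonneg _)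
      (integral_nonneg fun _ => mul_nonneg (norm_nonneg _) (decayWeight_nonneg hs.le _))

/-- A slice which is, for every pair in the second parameter, an average of the kernel in the first
parameter against functions of total weight `D`. -/
lemma isCZForm_slice₂_of_forall (hδ : 0 < δ) (hcanc : T.IsFullyCancellative) {f₁ g₁ : Test n₁}
    {D : ℝ} (hD : 0 ≤ D)
    (h : ∀ (f₂ g₂ : Test n₂) (Y : ℝ), 0 ≤ Y → (∀ S : CZO δ n₂, ‖S.form f₂ g₂‖ ≤ ‖S‖ * Y) →
      ‖T (f₁ ⊗ₜ f₂) (g₁ ⊗ₜ g₂)‖ ≤ D * Y) :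
    IsCZForm δ (D * 2 ^ ((n₂ : ℝ) + δ)) (T.slice₂ f₁ g₁) := by
  refine ⟨fun f g => ?_, fun f g y s hs hg0 hg hf => ?_, fun f g y s hs hf0 hf hg => ?_,
    fun χ hχ g hg => hcanc.dot_one_dot_dot χ hχ f₁ g₁ g hg,
    fun χ hχ f hf => hcanc.dot_dot_dot_one χ hχ f₁ g₁ f hf⟩
  · rw [slice₂_apply]
    refine (h f g _ (by positivity) fun S => S.norm_form_le f g).trans
      (mul_le_mul_of_nonneg_right (le_mul_of_one_le_right hD ?_) (by positivity))
    exact Real.one_le_rpow one_le_two (by positivity)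
  · have h0 : 0 ≤ (∫ x, ‖g x‖) * ∫ u, ‖f u‖ * decayWeight δ s (u - y) :=
      mul_nonneg (integral_nonneg fun _ => norm_nonneg _)
        (integral_nonneg fun _ => mul_nonneg (norm_nonneg _) (decayWeight_nonneg hs.le _))
    rw [slice₂_apply, mul_assoc]
    exact h f g _ (by positivity) fun S => S.norm_form_le_of_right hδ hs hg0 hg hf
  · have h0 : 0 ≤ (∫ x, ‖f x‖) * ∫ u, ‖g u‖ * decayWeight δ s (u - y) :=
      mul_nonneg (integral_nonneg fun _ => norm_nonneg _)
        (integral_nonneg fun _ => mul_nonneg (norm_nonneg _) (decayWeight_nonneg hs.le _))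
    rw [slice₂_apply, mul_assoc]
    exact h f g _ (by positivity) fun S => S.norm_form_le_of_left hδ hs hf0 hf hg

/-- The wavelet matrix of a fully cancellative bi-parameter operator is almost diagonal in both
parameters. The one-parameter estimate is applied to the slices in the second
parameter, and its conclusion says that the slices in the first parameter at wavelets are
cancellative Calderón–Zygmund forms with the almost diagonal factor as constant. -/
lemma exists_norm_le_almostDiag_mul {ψ₁ : Test n₁} {ψ₂ : Test n₂} (hψ₁ : IsMotherWavelet ψ₁)
    (hψ₂ : IsMotherWavelet ψ₂) (hδ : 0 < δ) (hδ1 : δ ≤ 1) (hT : T.IsCZO δ)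
    (hcanc : T.IsFullyCancellative) :
    ∃ C : ℝ, 0 ≤ C ∧ ∀ (z₁ w₁ : UpperHalf n₁) (z₂ w₂ : UpperHalf n₂),
      ‖T (atPoint ψ₁ z₁ ⊗ₜ atPoint ψ₂ z₂) (atPoint ψ₁ w₁ ⊗ₜ atPoint ψ₂ w₂)‖ ≤
        C * (almostDiag (δ / 2) z₁ w₁ * almostDiag (δ / 2) z₂ w₂) := by
  obtain ⟨D₁, hD₁, h₁⟩ := exists_norm_le_almostDiag hψ₁ hδ hδ1
  obtain ⟨D₂, hD₂, h₂⟩ := exists_norm_le_almostDiag hψ₂ hδ hδ1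
  obtain ⟨C, hC, hslice⟩ := exists_isCZForm_slice₂ hδ hT hcanc
  obtain ⟨C', K, hK, hTK⟩ := hT.isSingularIntegral.kernel₁
  have hC' := hK.nonneg
  set E := 2 ^ ((n₁ : ℝ) + δ) * C' * 2 ^ ((n₂ : ℝ) + δ) with hE
  have hE0 : 0 ≤ E := by positivity
  refine ⟨D₁ * (D₂ * (C + E)), by positivity, fun z₁ w₁ z₂ w₂ => ?_⟩
  have ha := almostDiag_nonneg (δ / 2) z₂ w₂
  have key : IsCZForm δ (D₂ * (C + E) * almostDiag (δ / 2) z₂ w₂)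
      (T.slice₁ (atPoint ψ₂ z₂) (atPoint ψ₂ w₂)) := by
    -- the far case in the first parameter, for either position of the cancellative function
    have far : ∀ {f g : Test n₁} {P : ℝ}, 0 ≤ P →
        (∀ (f₂ g₂ : Test n₂) (Y : ℝ), 0 ≤ Y → (∀ S : CZO δ n₂, ‖S.form f₂ g₂‖ ≤ ‖S‖ * Y) →
          ‖T (f ⊗ₜ f₂) (g ⊗ₜ g₂)‖ ≤ 2 ^ ((n₁ : ℝ) + δ) * (C' * Y) * P) →
        ‖T.slice₁ (atPoint ψ₂ z₂) (atPoint ψ₂ w₂) f g‖ ≤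
          D₂ * (C + E) * almostDiag (δ / 2) z₂ w₂ * P := by
      intro f g P hP h
      have hb := isCZForm_slice₂_of_forall (T := T) (f₁ := f) (g₁ := g)
        (D := 2 ^ ((n₁ : ℝ) + δ) * C' * P) hδ hcanc (by positivity) fun f₂ g₂ Y hY hS =>
          (h f₂ g₂ Y hY hS).trans_eq (by ring)
      refine (h₂ _ _ (by positivity) hb z₂ w₂).trans ?_
      have h3 : 0 ≤ D₂ * C * almostDiag (δ / 2) z₂ w₂ * P := by positivity
      rw [hE]
      linarith
    refine ⟨fun f g => ?_, fun f g y s hs hg0 hg hf => ?_, fun f g y s hs hf0 hf hg => ?_,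
      fun χ hχ g hg => hcanc.one_dot_dot_dot χ hχ g _ _ hg,
      fun χ hχ f hf => hcanc.dot_dot_one_dot χ hχ f _ _ hf⟩
    · refine (h₂ _ _ (by positivity) (hslice f g) z₂ w₂).trans ?_
      have h3 : 0 ≤ D₂ * E * almostDiag (δ / 2) z₂ w₂ * (‖toL2 f‖ * ‖toL2 g‖) := by positivity
      linarith
    · refine far (mul_nonneg (integral_nonneg fun _ => norm_nonneg _)
        (integral_nonneg fun _ => mul_nonneg (norm_nonneg _) (decayWeight_nonneg hs.le _)))
        fun f₂ g₂ Y hY hS => ?_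
      obtain ⟨hi, he⟩ := hTK f g f₂ g₂ (disjoint_tsupport_of_separated hs hg hf)
      rw [he]
      exact norm_integral_form_le hδ hK hY hS hi hs hg0 hg hf
    · refine far (mul_nonneg (integral_nonneg fun _ => norm_nonneg _)
        (integral_nonneg fun _ => mul_nonneg (norm_nonneg _) (decayWeight_nonneg hs.le _)))
        fun f₂ g₂ Y hY hS => ?_
      obtain ⟨hi, he⟩ := hTK f g f₂ g₂ (disjoint_tsupport_of_separated hs hf hg).symm
      rw [he]
      exact norm_integral_form_le_swap hδ hK hY hS hi hs hf0 hf hg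
  refine (h₁ _ _ (by positivity) key z₁ w₁).trans_eq ?_
  ring

end BiOp

/-! ### Plancherel's theorem for integrable functions -/

open scoped FourierTransform

lemma lintegral_enorm_sq_toLp {α : Type*} [MeasurableSpace α] {μ : Measure α} {f : α → ℂ}
    (hf : MemLp f 2 μ) : ∫⁻ x, ‖f x‖ₑ ^ 2 ∂μ = ENNReal.ofReal (‖hf.toLp f‖ ^ 2) := by
  have hi : Integrable (fun x => ‖f x‖ ^ 2) μ := by
    simpa using MemLp.integrable_norm_pow (p := 2) (by exact_mod_cast hf) two_ne_zero
  rw [norm_sq_toLp, ofReal_integral_eq_lintegral_ofReal hi (ae_of_all _ fun x => by positivity)]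
  refine lintegral_congr fun x => ?_
  rw [ENNReal.ofReal_pow (norm_nonneg _), ofReal_norm]

lemma lintegral_enorm_sq_Lp {α : Type*} [MeasurableSpace α] {μ : Measure α} (f : Lp ℂ 2 μ) :
    ∫⁻ x, ‖f x‖ₑ ^ 2 ∂μ = ENNReal.ofReal (‖f‖ ^ 2) := by
  rw [lintegral_enorm_sq_toLp (Lp.memLp f), Lp.toLp_coeFn]

lemma integral_mul_fourierInv {φ G : Euc n → ℂ} (hφ : Integrable φ) (hG : Integrable G) :
    ∫ ξ, 𝓕⁻ φ ξ * G ξ = ∫ x, φ x * 𝓕⁻ G x := by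
  have h := VectorFourier.integral_bilin_fourierIntegral_eq_flip (e := Real.fourierChar)
    (L := -innerₗ (Euc n)) (ContinuousLinearMap.mul ℂ ℂ) Real.continuous_fourierChar
    (by simpa using (continuous_inner (𝕜 := ℝ) (E := Euc n)).fun_neg) hφ hG
  have hflip : (-innerₗ (Euc n)).flip = -innerₗ (Euc n) := by
    ext x y
    simp [real_inner_comm]
  rw [hflip] at h
  exact h

/-- On integrable square integrable functions, the Fourier transform of `L²` is given by the
integral, so that the integral satisfies Plancherel's identity. -/
lemma lintegral_enorm_sq_fourierInv {G : Euc n → ℂ} (hG : Integrable G) (hG2 : MemLp G 2) :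
    ∫⁻ x, ‖𝓕⁻ G x‖ₑ ^ 2 = ∫⁻ ξ, ‖G ξ‖ₑ ^ 2 := by
  have hcont : Continuous (𝓕⁻ G) := by
    rw [Real.fourierInv_eq_fourier_comp_neg]
    exact VectorFourier.fourierIntegral_continuous Real.continuous_fourierChar
      (by simpa using continuous_inner) hG.comp_neg
  have hae : (𝓕⁻ (hG2.toLp G) : L2 n) =ᵐ[volume] 𝓕⁻ G := by
    refine ae_eq_of_integral_contDiff_smul_eq
      ((Lp.memLp (𝓕⁻ (hG2.toLp G) : L2 n)).locallyIntegrable one_le_two)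
      hcont.locallyIntegrable fun g hg hgc => ?_
    have hc : HasCompactSupport fun x => (g x : ℂ) :=
      hgc.comp_left (g := ((↑) : ℝ → ℂ)) Complex.ofReal_zero
    have hd : ContDiff ℝ ((⊤ : ℕ∞) : WithTop ℕ∞) fun x => (g x : ℂ) :=
      Complex.ofRealCLM.contDiff.comp hg
    let φ : SchwartzMap (Euc n) ℂ := hc.toSchwartzMap hd
    have hφ : ∀ x, φ x = (g x : ℂ) := fun x => rfl
    have h1 := congrArg (fun D => D φ) (Lp.fourierInv_toTemperedDistribution_eq (hG2.toLp G))
    simp only [TemperedDistribution.fourierInv_apply, Lp.toTemperedDistribution_apply,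
      smul_eq_mul] at h1
    have h2 : ∫ ξ, 𝓕⁻ φ ξ * hG2.toLp G ξ = ∫ ξ, 𝓕⁻ (φ : Euc n → ℂ) ξ * G ξ := by
      refine integral_congr_ae ?_
      filter_upwards [hG2.coeFn_toLp] with x hx
      rw [hx, SchwartzMap.fourierInv_coe]
    rw [h2, integral_mul_fourierInv φ.integrable hG] at h1
    simp only [Complex.real_smul]
    exact h1.symm
  calc ∫⁻ x, ‖𝓕⁻ G x‖ₑ ^ 2 = ∫⁻ x, ‖(𝓕⁻ (hG2.toLp G) : L2 n) x‖ₑ ^ 2 := by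
        refine lintegral_congr_ae ?_
        filter_upwards [hae] with x hx
        rw [hx]
    _ = ENNReal.ofReal (‖(𝓕⁻ (hG2.toLp G) : L2 n)‖ ^ 2) := lintegral_enorm_sq_Lp _
    _ = ENNReal.ofReal (‖hG2.toLp G‖ ^ 2) := by
        rw [← Lp.norm_fourier_eq (𝓕⁻ (hG2.toLp G) : L2 n), FourierTransform.fourier_fourierInv_eq]
    _ = _ := (lintegral_enorm_sq_toLp hG2).symm

/-! ### The Calderón reproducing formula -/

/-- The measure `dt / t^(n+1)` on `(0, ∞)`. -/
def scaleMeasure (n : ℕ) : Measure (Set.Ioi (0 : ℝ)) :=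
  (Measure.comap Subtype.val volume).withDensity fun t => ENNReal.ofReal (((t : ℝ) ^ (n + 1))⁻¹)

/-- The hyperbolic measure `dx dt / t^(n+1)` on the upper half-space. -/
def hypMeasure (n : ℕ) : Measure (UpperHalf n) := (volume : Measure (Euc n)).prod (scaleMeasure n)

instance : SigmaFinite (Measure.comap (Subtype.val : Set.Ioi (0 : ℝ) → ℝ) volume) := by
  refine SigmaFinite.of_map _ measurable_subtype_coe.aemeasurable ?_
  rw [map_comap_subtype_coe measurableSet_Ioi]
  infer_instance

instance (n : ℕ) : SFinite (scaleMeasure n) := by unfold scaleMeasure; infer_instance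

instance (n : ℕ) : SFinite (hypMeasure n) := by unfold hypMeasure; infer_instance

lemma measurable_density (n : ℕ) :
    Measurable fun t : Set.Ioi (0 : ℝ) => ENNReal.ofReal (((t : ℝ) ^ (n + 1))⁻¹) := by
  fun_prop

lemma lintegral_scaleMeasure {f : ℝ → ENNReal} (hf : Measurable f) :
    ∫⁻ t, f t ∂(scaleMeasure n) =
      ∫⁻ t in Set.Ioi (0 : ℝ), ENNReal.ofReal ((t ^ (n + 1))⁻¹) * f t := by
  have h := lintegral_withDensity_eq_lintegral_mul
    (Measure.comap (Subtype.val : Set.Ioi (0 : ℝ) → ℝ) volume) (measurable_density n)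
    (hf.comp measurable_subtype_coe)
  refine h.trans ?_
  exact lintegral_subtype_comap measurableSet_Ioi
    fun t : ℝ => ENNReal.ofReal ((t ^ (n + 1))⁻¹) * f t

lemma continuous_atPoint (ψ : Test n) :
    Continuous fun p : UpperHalf n × Euc n => atPoint ψ p.1 p.2 := by
  simp only [atPoint_apply]
  have h2 : Continuous fun p : UpperHalf n × Euc n => ((p.1.2 : Set.Ioi (0 : ℝ)) : ℝ) := by fun_prop
  have h0 : ∀ p : UpperHalf n × Euc n, ((p.1.2 : Set.Ioi (0 : ℝ)) : ℝ) ≠ 0 := fun p => p.1.2.2.ne'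
  refine (Complex.continuous_ofReal.comp (h2.rpow_const fun p => Or.inl (h0 p))).mul
    (ψ.continuous.comp ((h2.inv₀ h0).smul ?_))
  fun_prop

/-- The wavelet transform of `f`. -/
def waveletTransform (ψ : Test n) (f : Euc n → ℂ) (z : UpperHalf n) : ℂ :=
  ∫ u, f u * atPoint ψ z u

lemma aestronglyMeasurable_waveletTransform (ψ : Test n) {f : Euc n → ℂ}
    (hf : AEStronglyMeasurable f) (μ : Measure (UpperHalf n)) [SFinite μ] :
    AEStronglyMeasurable (waveletTransform ψ f) μ :=
  AEStronglyMeasurable.integral_prod_right' (f := fun p : UpperHalf n × Euc n =>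
    f p.2 * atPoint ψ p.1 p.2)
    (hf.comp_snd.mul (continuous_atPoint ψ).aestronglyMeasurable)

lemma fourier_atPoint (ψ : Test n) (z : UpperHalf n) (ξ : Euc n) :
    𝓕 (atPoint ψ z : Euc n → ℂ) ξ = (((z.2 : ℝ) ^ ((n : ℝ) / 2) : ℝ) : ℂ) *
      (Real.fourierChar (-(inner ℝ z.1 ξ)) * 𝓕 (ψ : Euc n → ℂ) ((z.2 : ℝ) • ξ)) := by
  have ht : (0 : ℝ) < z.2 := z.2.2
  set t := (z.2 : ℝ) with htdef
  rw [Real.fourier_eq, Real.fourier_eq]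
  let H : Euc n → ℂ := fun v =>
    (Real.fourierChar (-(inner ℝ z.1 ξ)) : ℂ) * (Real.fourierChar (-(inner ℝ v (t • ξ))) • ψ v)
  have e : ∀ u, Real.fourierChar (-(inner ℝ u ξ)) • atPoint ψ z u =
      ((t ^ (-(n : ℝ) / 2) : ℝ) : ℂ) * H (t⁻¹ • (u - z.1)) := fun u => by
    have h1 : -(inner ℝ u ξ) = -(inner ℝ z.1 ξ) + -(inner ℝ (t⁻¹ • (u - z.1)) (t • ξ)) := by
      rw [real_inner_smul_left, real_inner_smul_right, inner_sub_left]
      field_simp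
      ring
    rw [h1, AddChar.map_add_eq_mul, atPoint_apply]
    simp only [H, Circle.smul_def, smul_eq_mul, Circle.coe_mul]
    ring
  simp only [e]
  rw [integral_const_mul, integral_sub_right_eq_self (fun u => H (t⁻¹ • u)),
    Measure.integral_comp_inv_smul volume H, integral_const_mul]
  have h2 : ((t ^ (-(n : ℝ) / 2) : ℝ) : ℂ) * ((t ^ n : ℝ) : ℂ) = ((t ^ ((n : ℝ) / 2) : ℝ) : ℂ) := by
    rw [← Complex.ofReal_mul, ← Real.rpow_natCast, ← Real.rpow_add ht]
    congr 2; ring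
  rw [← h2]
  simp only [finrank_euclideanSpace, Fintype.card_fin, abs_of_pos (pow_pos ht n), Complex.real_smul]
  ring

lemma conj_atPoint {ψ : Test n} (hψ : ∀ x, (ψ x).im = 0) (z : UpperHalf n) (u : Euc n) :
    (starRingEnd ℂ) (atPoint ψ z u) = atPoint ψ z u := by
  rw [atPoint_apply, map_mul, Complex.conj_ofReal, Complex.conj_eq_iff_im.2 (hψ _)]

lemma toL2_fourier (f : Test n) : (𝓕 (toL2 f) : L2 n) =ᵐ[volume] 𝓕 (f : Euc n → ℂ) := by
  let φ : SchwartzMap (Euc n) ℂ := f.hasCompactSupport.toSchwartzMap f.contDiff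
  have h : toL2 f = φ.toLp 2 := rfl
  rw [h, SchwartzMap.toLp_fourier_eq]
  filter_upwards [(𝓕 φ).coeFn_toLp 2 volume] with x hx
  rw [hx, SchwartzMap.fourier_coe]
  rfl

lemma continuous_fourier_test (f : Test n) : Continuous (𝓕 (f : Euc n → ℂ)) :=
  VectorFourier.fourierIntegral_continuous Real.continuous_fourierChar
    (by simpa using continuous_inner) f.integrable

/-- At a fixed scale, the wavelet transform is the inverse Fourier transform of the product of the
Fourier transforms of the function and of the dilated wavelet. -/
lemma lintegral_waveletTransform_fixed_scale {ψ : Test n} (hψ : IsMotherWavelet ψ)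
    {f : Euc n → ℂ} (hf : MemLp f 2) (t : Set.Ioi (0 : ℝ)) :
    ∫⁻ x : Euc n, ‖waveletTransform ψ f (x, t)‖ₑ ^ 2 =
      ∫⁻ ξ, ‖(𝓕 (hf.toLp f) : L2 n) ξ‖ₑ ^ 2 *
        ENNReal.ofReal ((t : ℝ) ^ n * ‖𝓕 (ψ : Euc n → ℂ) ((t : ℝ) • ξ)‖ ^ 2) := by
  have ht : (0 : ℝ) < t := t.2
  set F : L2 n := 𝓕 (hf.toLp f) with hF
  set m : Euc n → ℂ := fun ξ => ((((t : ℝ) ^ ((n : ℝ) / 2) : ℝ) : ℂ)) *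
    (starRingEnd ℂ) (𝓕 (ψ : Euc n → ℂ) ((t : ℝ) • ξ)) with hm
  have hmc : Continuous m :=
    continuous_const.mul (Complex.continuous_conj.comp
      ((continuous_fourier_test ψ).comp (continuous_const_smul _)))
  have hFz : ∀ x : Euc n, waveletTransform ψ f (x, t) = 𝓕⁻ (fun ξ => F ξ * m ξ) x ∧
      ∀ᵐ ξ, F ξ * m ξ * Real.fourierChar (inner ℝ x ξ) =
        F ξ * (starRingEnd ℂ) ((𝓕 (toL2 (atPoint ψ (x, t))) : L2 n) ξ) := fun x => by
    have hae : ∀ᵐ ξ, F ξ * m ξ * Real.fourierChar (inner ℝ x ξ) =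
        F ξ * (starRingEnd ℂ) ((𝓕 (toL2 (atPoint ψ (x, t))) : L2 n) ξ) := by
      filter_upwards [toL2_fourier (atPoint ψ (x, t))] with ξ hξ
      rw [hξ, fourier_atPoint, AddChar.map_neg_eq_inv, Circle.coe_inv_eq_conj]
      simp only [hm, map_mul, Complex.conj_conj, Complex.conj_ofReal]
      ring
    refine ⟨?_, hae⟩
    have h1 : waveletTransform ψ f (x, t) =
        inner ℂ (toL2 (atPoint ψ (x, t))) (hf.toLp f) := by
      rw [MeasureTheory.L2.inner_def]
      refine integral_congr_ae ?_
      filter_upwards [((atPoint ψ (x, t)).memLp 2).coeFn_toLp, hf.coeFn_toLp] with u hu hu'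
      rw [toL2, hu, hu', RCLike.inner_apply, conj_atPoint hψ.real]
    rw [h1, ← Lp.inner_fourier_eq, MeasureTheory.L2.inner_def, Real.fourierInv_eq]
    refine integral_congr_ae ?_
    filter_upwards [hae] with ξ hξ
    rw [RCLike.inner_apply, ← hξ, Circle.smul_def, smul_eq_mul, real_inner_comm]
    ring
  have hm2 : MemLp m 2 := by
    have h0 : MemLp (fun ξ => (starRingEnd ℂ) (m ξ)) 2 := by
      refine (Lp.memLp (𝓕 (toL2 (atPoint ψ (0, t))) : L2 n)).ae_eq ?_
      filter_upwards [toL2_fourier (atPoint ψ (0, t))] with ξ hξ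
      rw [hξ, fourier_atPoint]
      simp [hm]
    convert h0.star using 1
    funext ξ
    simp
  have hFm : Integrable fun ξ => F ξ * m ξ := (Lp.memLp F).integrable_mul hm2
  have hmb : ∃ B, ∀ ξ, ‖m ξ‖ ≤ B := by
    refine ⟨(t : ℝ) ^ ((n : ℝ) / 2) * ∫ x, ‖ψ x‖, fun ξ => ?_⟩
    rw [hm, norm_mul, Complex.norm_real, Real.norm_of_nonneg (by positivity), RCLike.norm_conj]
    exact mul_le_mul_of_nonneg_left
      (VectorFourier.norm_fourierIntegral_le_integral_norm _ _ _ _ _) (by positivity)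
  obtain ⟨B, hB⟩ := hmb
  have hFm2 : MemLp (fun ξ => F ξ * m ξ) 2 := by
    refine ((Lp.memLp F).const_mul (B : ℂ)).mono
      ((Lp.aestronglyMeasurable F).mul hmc.aestronglyMeasurable) (ae_of_all _ fun ξ => ?_)
    have hB0 : 0 ≤ B := (norm_nonneg _).trans (hB 0)
    rw [norm_mul, norm_mul (B : ℂ), Complex.norm_real, Real.norm_of_nonneg hB0, mul_comm]
    exact mul_le_mul_of_nonneg_right (hB ξ) (norm_nonneg _)
  simp only [fun x => (hFz x).1]
  rw [lintegral_enorm_sq_fourierInv hFm hFm2]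
  refine lintegral_congr fun ξ => ?_
  rw [enorm_mul, mul_pow]
  congr 1
  rw [← ofReal_norm, ← ENNReal.ofReal_pow (norm_nonneg _), hm, norm_mul, Complex.norm_real,
    Real.norm_of_nonneg (by positivity), RCLike.norm_conj, mul_pow, ← Real.rpow_natCast (_ ^ _),
    ← Real.rpow_mul ht.le, ← Real.rpow_natCast (t : ℝ) n]
  norm_num

/-- The wavelet transform is an isometry from `L²(ℝⁿ)` into `L²` of the upper half-space. -/
lemma lintegral_waveletTransform {ψ : Test n} (hn : 0 < n) (hψ : IsMotherWavelet ψ)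
    {f : Euc n → ℂ} (hf : MemLp f 2) :
    ∫⁻ z, ‖waveletTransform ψ f z‖ₑ ^ 2 ∂(hypMeasure n) = ∫⁻ u, ‖f u‖ₑ ^ 2 := by
  have hmeas : AEMeasurable (fun z => ‖waveletTransform ψ f z‖ₑ ^ 2) (hypMeasure n) :=
    (aestronglyMeasurable_waveletTransform ψ hf.aestronglyMeasurable _).enorm.pow_const 2
  set F : L2 n := 𝓕 (hf.toLp f) with hF
  have hFm : Measurable fun ξ => ‖F ξ‖ₑ ^ 2 :=
    (Lp.stronglyMeasurable F).measurable.enorm.pow_const 2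
  have hψm : Measurable fun p : ℝ × Euc n => ENNReal.ofReal (p.1 ^ n *
      ‖𝓕 (ψ : Euc n → ℂ) (p.1 • p.2)‖ ^ 2) := by
    refine ENNReal.measurable_ofReal.comp (Continuous.measurable ?_)
    exact (continuous_fst.pow n).mul
      (((continuous_fourier_test ψ).comp (continuous_fst.smul continuous_snd)).norm.pow 2)
  have hψm' : Measurable fun p : Set.Ioi (0 : ℝ) × Euc n => ENNReal.ofReal ((p.1 : ℝ) ^ n *
      ‖𝓕 (ψ : Euc n → ℂ) ((p.1 : ℝ) • p.2)‖ ^ 2) :=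
    hψm.comp ((measurable_subtype_coe.comp measurable_fst).prodMk measurable_snd)
  rw [hypMeasure, lintegral_prod_symm _ hmeas]
  simp only [lintegral_waveletTransform_fixed_scale hψ hf]
  rw [lintegral_lintegral_swap ((hFm.comp measurable_snd).mul hψm').aemeasurable]
  have : Nonempty (Fin n) := ⟨⟨0, hn⟩⟩
  have hne : ∀ᵐ ξ : Euc n, ξ ≠ 0 := by simp [ae_iff]
  calc ∫⁻ ξ, ∫⁻ t, ‖F ξ‖ₑ ^ 2 * ENNReal.ofReal ((t : ℝ) ^ n *
          ‖𝓕 (ψ : Euc n → ℂ) ((t : ℝ) • ξ)‖ ^ 2) ∂(scaleMeasure n)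
      = ∫⁻ ξ, ‖F ξ‖ₑ ^ 2 := by
        refine lintegral_congr_ae ?_
        filter_upwards [hne] with ξ hξ
        rw [lintegral_const_mul _ (f := fun t : Set.Ioi (0 : ℝ) => ENNReal.ofReal ((t : ℝ) ^ n *
          ‖𝓕 (ψ : Euc n → ℂ) ((t : ℝ) • ξ)‖ ^ 2)) (hψm'.comp measurable_prodMk_right)]
        have h1 : ∫⁻ t, ENNReal.ofReal ((t : ℝ) ^ n *
            ‖𝓕 (ψ : Euc n → ℂ) ((t : ℝ) • ξ)‖ ^ 2) ∂(scaleMeasure n) = 1 := by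
          rw [lintegral_scaleMeasure (f := fun t : ℝ => ENNReal.ofReal (t ^ n *
            ‖𝓕 (ψ : Euc n → ℂ) (t • ξ)‖ ^ 2)) (hψm.comp measurable_prodMk_right)]
          have hcal := hψ.calderon ξ hξ
          -- the Calderón integral has the value one, so that its integrand is integrable
          have hi : IntegrableOn (fun t : ℝ => ‖𝓕 (ψ : Euc n → ℂ) (t • ξ)‖ ^ 2 / t)
              (Set.Ioi 0) := by
            by_contra h
            rw [integral_undef h] at hcal
            exact zero_ne_one hcal
          rw [← ENNReal.ofReal_one, ← hcal, ofReal_integral_eq_lintegral_ofReal hi]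
          · refine setLIntegral_congr_fun measurableSet_Ioi fun t ht => ?_
            have ht' : (0 : ℝ) < t := ht
            rw [← ENNReal.ofReal_mul (by positivity)]
            congr 1
            field_simp
            ring
          · filter_upwards [ae_restrict_mem measurableSet_Ioi] with t ht
            have ht' : (0 : ℝ) < t := ht
            positivity
        rw [h1, mul_one]
    _ = ENNReal.ofReal (‖F‖ ^ 2) := lintegral_enorm_sq_Lp F
    _ = ENNReal.ofReal (‖hf.toLp f‖ ^ 2) := by rw [hF, Lp.norm_fourier_eq]
    _ = _ := (lintegral_enorm_sq_toLp hf).symm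

/-! ### The product wavelet transform -/

/-- The product of the upper half-spaces, which indexes the product wavelets. -/
abbrev BiUpperHalf (n₁ n₂ : ℕ) : Type := UpperHalf n₁ × UpperHalf n₂

/-- The product of the hyperbolic measures. -/
def biHypMeasure (n₁ n₂ : ℕ) : Measure (BiUpperHalf n₁ n₂) :=
  (hypMeasure n₁).prod (hypMeasure n₂)

instance (n₁ n₂ : ℕ) : SFinite (biHypMeasure n₁ n₂) := by unfold biHypMeasure; infer_instance

/-- The product wavelet `ψ_z = ψ_{z₁} ⊗ ψ_{z₂}` in `L²`. -/
def biWavelet (ψ₁ : Test n₁) (ψ₂ : Test n₂) (z : BiUpperHalf n₁ n₂) : L2Prod n₁ n₂ :=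
  tensorL2 (atPoint ψ₁ z.1) (atPoint ψ₂ z.2)

lemma memLp_tensorFun (f₁ : Test n₁) (f₂ : Test n₂) :
    MemLp (tensorFun f₁ f₂) 2 (volume : Measure (Euc n₁ × Euc n₂)) :=
  (continuous_tensorFun f₁ f₂).memLp_of_hasCompactSupport (hasCompactSupport_tensorFun f₁ f₂)

lemma inner_biWavelet {ψ₁ : Test n₁} {ψ₂ : Test n₂} (hψ₁ : ∀ x, (ψ₁ x).im = 0)
    (hψ₂ : ∀ x, (ψ₂ x).im = 0) (z : BiUpperHalf n₁ n₂) (F : L2Prod n₁ n₂) :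
    inner ℂ (biWavelet ψ₁ ψ₂ z) F = pairProd F (atPoint ψ₁ z.1) (atPoint ψ₂ z.2) := by
  rw [MeasureTheory.L2.inner_def]
  refine integral_congr_ae ?_
  filter_upwards [(memLp_tensorFun (atPoint ψ₁ z.1) (atPoint ψ₂ z.2)).coeFn_toLp] with p hp
  rw [biWavelet, tensorL2, hp, RCLike.inner_apply, tensorFun, map_mul, conj_atPoint hψ₁,
    conj_atPoint hψ₂]

lemma continuous_tensorFun_atPoint (ψ₁ : Test n₁) (ψ₂ : Test n₂) :
    Continuous fun q : BiUpperHalf n₁ n₂ × (Euc n₁ × Euc n₂) =>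
      tensorFun (atPoint ψ₁ q.1.1) (atPoint ψ₂ q.1.2) q.2 := by
  have h₁ : Continuous fun q : BiUpperHalf n₁ n₂ × (Euc n₁ × Euc n₂) => (q.1.1, q.2.1) := by
    fun_prop
  have h₂ : Continuous fun q : BiUpperHalf n₁ n₂ × (Euc n₁ × Euc n₂) => (q.1.2, q.2.2) := by
    fun_prop
  exact ((continuous_atPoint ψ₁).comp h₁).mul ((continuous_atPoint ψ₂).comp h₂)

/-- The product wavelet transform is an isometry. The one-parameter isometry is applied in each
variable in turn. -/
lemma lintegral_biWaveletTransform {ψ₁ : Test n₁} {ψ₂ : Test n₂} (hn₁ : 0 < n₁) (hn₂ : 0 < n₂)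
    (hψ₁ : IsMotherWavelet ψ₁) (hψ₂ : IsMotherWavelet ψ₂) {F : Euc n₁ × Euc n₂ → ℂ}
    (hFm : StronglyMeasurable F)
    (hF : MemLp F 2 ((volume : Measure (Euc n₁)).prod (volume : Measure (Euc n₂)))) :
    ∫⁻ z : BiUpperHalf n₁ n₂, ‖∫ p, F p * tensorFun (atPoint ψ₁ z.1) (atPoint ψ₂ z.2) p
      ∂((volume : Measure (Euc n₁)).prod (volume : Measure (Euc n₂)))‖ₑ ^ 2 ∂(biHypMeasure n₁ n₂) =
      ∫⁻ p, ‖F p‖ₑ ^ 2 ∂((volume : Measure (Euc n₁)).prod (volume : Measure (Euc n₂))) := by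
  have hF2 : ∫⁻ p, ‖F p‖ₑ ^ 2 ∂((volume : Measure (Euc n₁)).prod (volume : Measure (Euc n₂))) ≠
      ⊤ := by
    rw [lintegral_enorm_sq_toLp hF]
    exact ENNReal.ofReal_ne_top
  have hFe : Measurable fun p => ‖F p‖ₑ ^ 2 := hFm.measurable.enorm.pow_const 2
  -- the partial transform in the first variable
  set g : UpperHalf n₁ → Euc n₂ → ℂ := fun z x => waveletTransform ψ₁ (fun u => F (u, x)) z with hg
  have hgm : StronglyMeasurable fun p : UpperHalf n₁ × Euc n₂ => g p.1 p.2 := by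
    refine StronglyMeasurable.integral_prod_right' (f := fun q : (UpperHalf n₁ × Euc n₂) × Euc n₁ =>
      F (q.2, q.1.2) * atPoint ψ₁ q.1.1 q.2) ?_
    have hc : Continuous fun q : (UpperHalf n₁ × Euc n₂) × Euc n₁ => (q.1.1, q.2) := by fun_prop
    exact (hFm.comp_measurable (by fun_prop)).mul
      ((continuous_atPoint ψ₁).comp hc).stronglyMeasurable
  have hgm2 : Measurable fun p : UpperHalf n₁ × Euc n₂ => ‖g p.1 p.2‖ₑ ^ 2 :=
    hgm.measurable.enorm.pow_const 2
  have hsec : ∀ᵐ x : Euc n₂, MemLp (fun u : Euc n₁ => F (u, x)) 2 := by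
    have h1 : ∫⁻ x : Euc n₂, ∫⁻ u : Euc n₁, ‖F (u, x)‖ₑ ^ 2 ≠ ⊤ := by
      rw [← lintegral_prod_symm _ hFe.aemeasurable]
      exact hF2
    filter_upwards [ae_lt_top hFe.lintegral_prod_left' h1] with x hx
    refine ⟨(hFm.comp_measurable measurable_prodMk_right).aestronglyMeasurable, ?_⟩
    rw [eLpNorm_lt_top_iff_lintegral_rpow_enorm_lt_top (by simp) (by simp)]
    simpa using hx
  have htot : ∫⁻ z, ∫⁻ x, ‖g z x‖ₑ ^ 2 ∂volume ∂(hypMeasure n₁) =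
      ∫⁻ p, ‖F p‖ₑ ^ 2 ∂((volume : Measure (Euc n₁)).prod (volume : Measure (Euc n₂))) := by
    rw [lintegral_lintegral_swap hgm2.aemeasurable, lintegral_prod_symm _ hFe.aemeasurable]
    refine lintegral_congr_ae ?_
    filter_upwards [hsec] with x hx
    exact lintegral_waveletTransform hn₁ hψ₁ hx
  have hgL2 : ∀ᵐ z ∂(hypMeasure n₁), MemLp (g z) 2 := by
    have h1 : ∫⁻ z, ∫⁻ x, ‖g z x‖ₑ ^ 2 ∂volume ∂(hypMeasure n₁) ≠ ⊤ := by
      rw [htot]; exact hF2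
    filter_upwards [ae_lt_top hgm2.lintegral_prod_right' h1] with z hz
    refine ⟨(hgm.comp_measurable measurable_prodMk_left).aestronglyMeasurable, ?_⟩
    rw [eLpNorm_lt_top_iff_lintegral_rpow_enorm_lt_top (by simp) (by simp)]
    simpa using hz
  have hiter : ∀ z₁ z₂, ∫ p, F p * tensorFun (atPoint ψ₁ z₁) (atPoint ψ₂ z₂) p
      ∂((volume : Measure (Euc n₁)).prod (volume : Measure (Euc n₂))) =
      waveletTransform ψ₂ (g z₁) z₂ := fun z₁ z₂ => by
    have hi : Integrable (fun p => F p * tensorFun (atPoint ψ₁ z₁) (atPoint ψ₂ z₂) p)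
        ((volume : Measure (Euc n₁)).prod (volume : Measure (Euc n₂))) :=
      hF.integrable_mul (memLp_tensorFun _ _)
    rw [integral_prod_symm _ hi, waveletTransform]
    congr 1
    funext x
    change _ = (∫ u, F (u, x) * atPoint ψ₁ z₁ u) * atPoint ψ₂ z₂ x
    rw [← integral_mul_const]
    congr 1
    funext u
    rw [tensorFun, mul_assoc]
  have hmeas : Measurable fun z : BiUpperHalf n₁ n₂ =>
      ‖∫ p, F p * tensorFun (atPoint ψ₁ z.1) (atPoint ψ₂ z.2) p
        ∂((volume : Measure (Euc n₁)).prod (volume : Measure (Euc n₂)))‖ₑ ^ 2 := by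
    refine (StronglyMeasurable.integral_prod_right'
      (f := fun q : BiUpperHalf n₁ n₂ × (Euc n₁ × Euc n₂) =>
        F q.2 * tensorFun (atPoint ψ₁ q.1.1) (atPoint ψ₂ q.1.2) q.2) ?_).measurable.enorm.pow_const 2
    exact (hFm.comp_measurable measurable_snd).mul
      (continuous_tensorFun_atPoint ψ₁ ψ₂).stronglyMeasurable
  rw [biHypMeasure, lintegral_prod _ hmeas.aemeasurable, ← htot]
  refine lintegral_congr_ae ?_
  filter_upwards [hgL2] with z hz
  simp only [hiter]
  exact lintegral_waveletTransform hn₂ hψ₂ hz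

lemma lintegral_inner_biWavelet {ψ₁ : Test n₁} {ψ₂ : Test n₂} (hn₁ : 0 < n₁) (hn₂ : 0 < n₂)
    (hψ₁ : IsMotherWavelet ψ₁) (hψ₂ : IsMotherWavelet ψ₂) (F : L2Prod n₁ n₂) :
    ∫⁻ z, ‖inner ℂ (biWavelet ψ₁ ψ₂ z) F‖ₑ ^ 2 ∂(biHypMeasure n₁ n₂) =
      ENNReal.ofReal (‖F‖ ^ 2) := by
  simp only [inner_biWavelet hψ₁.real hψ₂.real]
  rw [← lintegral_enorm_sq_Lp F]
  exact lintegral_biWaveletTransform hn₁ hn₂ hψ₁ hψ₂ (Lp.stronglyMeasurable F) (Lp.memLp F)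

lemma norm_le_of_atPoint_ne_zero {ψ : Test n} (hψ : tsupport ψ ⊆ Metric.closedBall 0 1)
    {z : UpperHalf n} {u : Euc n} (hu : atPoint ψ z u ≠ 0) : ‖u‖ ≤ ‖z.1‖ + z.2 := by
  obtain ⟨M, -, h⟩ := exists_isBump_atPoint ψ hψ
  have h1 := (h z).support u hu
  have h2 := norm_le_norm_sub_add u z.1
  linarith

lemma continuousAt_toLp {Z α : Type*} [TopologicalSpace Z] [FirstCountableTopology Z]
    [LocallyCompactSpace Z] [TopologicalSpace α] [SecondCountableTopology α] [MeasurableSpace α]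
    [OpensMeasurableSpace α] {μ : Measure α} [IsLocallyFiniteMeasure μ] {G : Z → α → ℂ}
    (hG : Continuous fun q : Z × α => G q.1 q.2) (hmem : ∀ z, MemLp (G z) 2 μ) {K : Set α}
    (hK : IsCompact K) {z₀ : Z} (hGK : ∀ᶠ z in 𝓝 z₀, ∀ p ∉ K, G z p = 0) :
    ContinuousAt (fun z => (hmem z).toLp (G z)) z₀ := by
  have hnorm : ∀ᶠ z in 𝓝 z₀, ‖(hmem z).toLp (G z) - (hmem z₀).toLp (G z₀)‖ ^ 2 =
      ∫ p in K, ‖G z p - G z₀ p‖ ^ 2 ∂μ := by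
    filter_upwards [hGK] with z hz
    rw [setIntegral_eq_integral_of_forall_compl_eq_zero fun p hp => by
      rw [hz p hp, hGK.self_of_nhds p hp, sub_zero, norm_zero, zero_pow two_ne_zero],
      ← MemLp.toLp_sub]
    exact norm_sq_toLp _
  have hG₀ : Continuous fun q : Z × α => G z₀ q.2 :=
    hG.comp (continuous_const.prodMk continuous_snd)
  have hcont : Continuous fun z => ∫ p in K, ‖G z p - G z₀ p‖ ^ 2 ∂μ :=
    continuous_parametric_integral_of_continuous
      (f := fun z p => ‖G z p - G z₀ p‖ ^ 2) ((hG.fun_sub hG₀).norm.fun_pow 2) hK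
  have hlim : Tendsto (fun z => ‖(hmem z).toLp (G z) - (hmem z₀).toLp (G z₀)‖ ^ 2) (𝓝 z₀)
      (𝓝 0) := by
    refine Tendsto.congr' (EventuallyEq.symm hnorm) ?_
    have h := hcont.tendsto z₀
    simpa using h
  rw [ContinuousAt, tendsto_iff_norm_sub_tendsto_zero]
  have h := hlim.sqrt
  simpa [Real.sqrt_sq] using h

lemma continuous_biWavelet {ψ₁ : Test n₁} {ψ₂ : Test n₂} (hψ₁ : IsMotherWavelet ψ₁)
    (hψ₂ : IsMotherWavelet ψ₂) : Continuous (biWavelet ψ₁ ψ₂) := by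
  have : LocallyCompactSpace (Set.Ioi (0 : ℝ)) := isOpen_Ioi.locallyCompactSpace
  refine continuous_iff_continuousAt.2 fun z₀ => ?_
  have e1 : ∀ᶠ z : BiUpperHalf n₁ n₂ in 𝓝 z₀, ‖z.1.1‖ + z.1.2 < ‖z₀.1.1‖ + z₀.1.2 + 1 :=
    (show Continuous fun z : BiUpperHalf n₁ n₂ => ‖z.1.1‖ + ((z.1.2 : Set.Ioi (0 : ℝ)) : ℝ) by
      fun_prop).continuousAt.eventually_lt continuousAt_const (lt_add_one _)
  have e2 : ∀ᶠ z : BiUpperHalf n₁ n₂ in 𝓝 z₀, ‖z.2.1‖ + z.2.2 < ‖z₀.2.1‖ + z₀.2.2 + 1 :=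
    (show Continuous fun z : BiUpperHalf n₁ n₂ => ‖z.2.1‖ + ((z.2.2 : Set.Ioi (0 : ℝ)) : ℝ) by
      fun_prop).continuousAt.eventually_lt continuousAt_const (lt_add_one _)
  refine continuousAt_toLp (K := Metric.closedBall 0 (‖z₀.1.1‖ + z₀.1.2 + 1) ×ˢ
    Metric.closedBall 0 (‖z₀.2.1‖ + z₀.2.2 + 1)) (continuous_tensorFun_atPoint ψ₁ ψ₂)
    (fun z => memLp_tensorFun _ _) ((isCompact_closedBall _ _).prod (isCompact_closedBall _ _)) ?_
  filter_upwards [e1, e2] with z h1 h2 p hp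
  by_contra h
  refine hp (Set.mk_mem_prod ?_ ?_)
  · rw [mem_closedBall_zero_iff]
    exact (norm_le_of_atPoint_ne_zero hψ₁.support (left_ne_zero_of_mul h)).trans h1.le
  · rw [mem_closedBall_zero_iff]
    exact (norm_le_of_atPoint_ne_zero hψ₂.support (right_ne_zero_of_mul h)).trans h2.le

/-! ### Compactness by localization to a Parseval frame -/

section Frame

variable {H : Type*} [NormedAddCommGroup H] [InnerProductSpace ℂ H]
  {Z : Type*} [TopologicalSpace Z] [MeasurableSpace Z] [OpensMeasurableSpace Z] {μ : Measure Z}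

/-- A continuous Parseval frame: `f ↦ ⟨Ψ_z, f⟩` is an isometry from `H` into `L²(μ)`. -/
structure IsParsevalFrame (μ : Measure Z) (Ψ : Z → H) : Prop where
  continuous : Continuous Ψ
  lintegral_inner : ∀ f : H, ∫⁻ z, ‖inner ℂ (Ψ z) f‖ₑ ^ 2 ∂μ = ENNReal.ofReal (‖f‖ ^ 2)

namespace IsParsevalFrame

variable {Ψ : Z → H}

lemma memLp (h : IsParsevalFrame μ Ψ) (f : H) : MemLp (fun z => inner ℂ (Ψ z) f) 2 μ := by
  refine ⟨(h.continuous.inner continuous_const).aestronglyMeasurable, ?_⟩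
  rw [eLpNorm_lt_top_iff_lintegral_rpow_enorm_lt_top (by simp) (by simp)]
  simp [h.lintegral_inner f]

/-- The polarized Parseval identity. -/
lemma integral_inner_mul_inner (h : IsParsevalFrame μ Ψ) (f g : H) :
    ∫ z, inner ℂ g (Ψ z) * inner ℂ (Ψ z) f ∂μ = inner ℂ g f := by
  let V : H →ₗᵢ[ℂ] Lp ℂ 2 μ :=
    { toFun := fun f => (h.memLp f).toLp _
      map_add' := fun f g => by
        rw [← MemLp.toLp_add]
        congr 1
        funext z
        simp
      map_smul' := fun c f => by
        rw [RingHom.id_apply, ← MemLp.toLp_const_smul]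
        congr 1
        funext z
        simp
      norm_map' := fun f => by
        have h1 := lintegral_enorm_sq_toLp (h.memLp f)
        rw [h.lintegral_inner, ENNReal.ofReal_eq_ofReal_iff (by positivity) (by positivity)] at h1
        exact ((pow_left_inj₀ (norm_nonneg _) (norm_nonneg _) two_ne_zero).1 h1).symm }
  rw [← V.inner_map_map g f, MeasureTheory.L2.inner_def]
  refine integral_congr_ae ?_
  filter_upwards [(h.memLp f).coeFn_toLp, (h.memLp g).coeFn_toLp] with z hf hg
  change _ = inner ℂ ((h.memLp g).toLp _ z) ((h.memLp f).toLp _ z)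
  rw [hf, hg, RCLike.inner_apply, inner_conj_symm, mul_comm]

lemma integrable_inner_mul_inner (h : IsParsevalFrame μ Ψ) (f g : H) :
    Integrable (fun z => inner ℂ g (Ψ z) * inner ℂ (Ψ z) f) μ := by
  have hg : MemLp (fun z => inner ℂ g (Ψ z)) 2 μ := by
    refine (h.memLp g).star.ae_eq (ae_of_all _ fun z => ?_)
    exact inner_conj_symm _ _
  exact hg.integrable_mul (h.memLp f)

end IsParsevalFrame

lemma isCompactOperator_rankOne (x y : H) :
    IsCompactOperator (InnerProductSpace.rankOne ℂ x y : H →L[ℂ] H) := by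
  have h : IsCompactOperator (ContinuousLinearMap.toSpanSingleton ℂ x : ℂ →L[ℂ] H) :=
    isCompactOperator_of_locallyCompactSpace_rng _
  exact h.comp_clm (innerSL ℂ y)

variable [CompleteSpace H] [SecondCountableTopology Z]

lemma isCompactOperator_setIntegral {φ : Z → H →L[ℂ] H} (hφ : Continuous φ)
    (hc : ∀ z, IsCompactOperator (φ z)) {D : Set Z} (hD : IntegrableOn φ D μ) :
    IsCompactOperator (∫ z in D, φ z ∂μ : H →L[ℂ] H) := by
  let 𝒦 : Submodule ℂ (H →L[ℂ] H) := compactOperator (RingHom.id ℂ) H H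
  have hcl : IsClosed (𝒦 : Set (H →L[ℂ] H)) := isClosed_setOfPred_isCompactOperator
  have : CompleteSpace 𝒦 := hcl.completeSpace_coe
  let φ' : Z → 𝒦 := fun z => ⟨φ z, hc z⟩
  have hφ' : Continuous φ' := hφ.subtype_mk _
  have : SecondCountableTopologyEither Z 𝒦 := ⟨Or.inl inferInstance⟩
  have hi : Integrable φ' (μ.restrict D) := by
    refine ⟨hφ'.aestronglyMeasurable, ?_⟩
    exact hD.2
  have e : ∫ z in D, φ z ∂μ = (𝒦.subtypeL (∫ z in D, φ' z ∂μ)) := by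
    rw [← ContinuousLinearMap.integral_comp_comm _ hi]
    rfl
  rw [e]
  exact (∫ z in D, φ' z ∂μ).2

/-- An operator is compact if its matrix with respect to a Parseval frame, restricted to columns
outside a set on which the frame is square integrable, has an arbitrarily small form. -/
lemma IsParsevalFrame.isCompactOperator {Ψ : Z → H} (h : IsParsevalFrame μ Ψ) (S : H →L[ℂ] H)
    (hS : ∀ ε : ℝ, 0 < ε → ∃ D : Set Z, MeasurableSet D ∧
      IntegrableOn (fun z => ‖Ψ z‖ ^ 2) D μ ∧ ∀ f g : H,
        ∫⁻ z in Dᶜ, ∫⁻ w, ‖inner ℂ (Ψ w) (S (Ψ z))‖ₑ *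
          (‖inner ℂ (Ψ z) f‖ₑ * ‖inner ℂ (Ψ w) g‖ₑ) ∂μ ∂μ ≤
          ENNReal.ofReal (ε * (‖f‖ ^ 2 + ‖g‖ ^ 2))) :
    IsCompactOperator S := by
  have hcl : IsClosed {A : H →L[ℂ] H | IsCompactOperator A} := isClosed_setOfPred_isCompactOperator
  refine hcl.closure_subset (Metric.mem_closure_iff.2 fun ε hε => ?_)
  obtain ⟨D, hDm, hDi, hD⟩ := hS (ε / 4) (by positivity)
  set φ : Z → H →L[ℂ] H := fun z => InnerProductSpace.rankOne ℂ (Ψ z) (Ψ z) with hφ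
  have hφc : Continuous φ :=
    (ContinuousLinearMap.smulRightL ℂ H H).continuous₂.comp
      (((innerSL ℂ).continuous.comp h.continuous).prodMk h.continuous)
  have hφi : IntegrableOn φ D μ := by
    refine Integrable.mono hDi hφc.aestronglyMeasurable (ae_of_all _ fun z => ?_)
    simp [hφ, sq]
  set P : H →L[ℂ] H := ∫ z in D, φ z ∂μ with hP
  have hPc : IsCompactOperator P :=
    isCompactOperator_setIntegral hφc (fun z => isCompactOperator_rankOne _ _) hφi
  refine ⟨S ∘L P, hPc.clm_comp S, ?_⟩
  have key : ∀ f g : H, ‖inner ℂ g (S f - S (P f))‖ ≤ ε / 4 * (‖f‖ ^ 2 + ‖g‖ ^ 2) := by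
    intro f g
    have e1 : inner ℂ g (S f) = ∫ z, inner ℂ g (S (Ψ z)) * inner ℂ (Ψ z) f ∂μ := by
      rw [← ContinuousLinearMap.adjoint_inner_left, ← h.integral_inner_mul_inner]
      simp only [ContinuousLinearMap.adjoint_inner_left]
    have i1 : Integrable (fun z => inner ℂ g (S (Ψ z)) * inner ℂ (Ψ z) f) μ := by
      have := h.integrable_inner_mul_inner f (ContinuousLinearMap.adjoint S g)
      simpa only [ContinuousLinearMap.adjoint_inner_left] using this
    have e2 : inner ℂ g (S (P f)) = ∫ z in D, inner ℂ g (S (Ψ z)) * inner ℂ (Ψ z) f ∂μ := by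
      have hφf : Integrable (fun z => φ z f) (μ.restrict D) :=
        (ContinuousLinearMap.apply ℂ H f).integrable_comp hφi
      rw [hP, ContinuousLinearMap.integral_apply hφi, ← ContinuousLinearMap.integral_comp_comm S hφf,
        ← integral_inner (S.integrable_comp hφf)]
      refine integral_congr_ae (ae_of_all _ fun z => ?_)
      simp [hφ, inner_smul_right, mul_comm]
    have e3 : inner ℂ g (S f - S (P f)) =
        ∫ z in Dᶜ, inner ℂ g (S (Ψ z)) * inner ℂ (Ψ z) f ∂μ := by
      rw [inner_sub_right, e1, e2, ← integral_add_compl hDm i1, add_sub_cancel_left]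
    have e4 : ‖inner ℂ g (S f - S (P f))‖ₑ ≤
        ENNReal.ofReal (ε / 4 * (‖f‖ ^ 2 + ‖g‖ ^ 2)) := by
      rw [e3]
      refine (enorm_integral_le_lintegral_enorm _).trans (le_trans ?_ (hD f g))
      refine lintegral_mono fun z => ?_
      rw [← h.integral_inner_mul_inner (S (Ψ z)) g, ← integral_mul_const]
      refine (enorm_integral_le_lintegral_enorm _).trans_eq (lintegral_congr fun w => ?_)
      rw [enorm_mul, enorm_mul, ← ofReal_norm (inner ℂ g (Ψ w)), norm_inner_symm, ofReal_norm]
      ring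
    rw [← ofReal_norm] at e4
    exact (ENNReal.ofReal_le_ofReal_iff (by positivity)).1 e4
  have hop : ‖S - S ∘L P‖ ≤ ε / 2 := by
    refine ContinuousLinearMap.opNorm_le_bound _ (by positivity) fun f => ?_
    change ‖S f - S (P f)‖ ≤ _
    set u := S f - S (P f) with hu
    rcases eq_or_ne u 0 with h0 | h0
    · rw [h0, norm_zero]; positivity
    have hu0 : 0 < ‖u‖ := norm_pos_iff.2 h0
    have hf0 : 0 < ‖f‖ := norm_pos_iff.2 fun hf => h0 (by simp [hu, hf])
    -- the bound is quadratic in `f` and `g`, so that `g` is chosen with the norm of `f`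
    have h1 := key f (((‖f‖ / ‖u‖ : ℝ) : ℂ) • u)
    rw [← hu, inner_smul_left, inner_self_eq_norm_sq_to_K, norm_mul, RCLike.norm_conj, norm_smul,
      Complex.norm_real, Real.norm_of_nonneg (by positivity)] at h1
    have h2 : ‖((‖u‖ : ℂ)) ^ 2‖ = ‖u‖ ^ 2 := by simp
    have h3 : ‖f‖ / ‖u‖ * ‖u‖ ^ 2 = ‖f‖ * ‖u‖ := by field_simp
    have h4 : ‖f‖ / ‖u‖ * ‖u‖ = ‖f‖ := by field_simp
    rw [h4] at h1
    have h5 : ‖f‖ * ‖u‖ ≤ ‖f‖ * (ε / 2 * ‖f‖) := by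
      rw [← h3, ← h2]
      refine h1.trans_eq ?_
      ring
    exact le_of_mul_le_mul_left h5 hf0
  rw [dist_eq_norm]
  linarith

end Frame

/-! ### Schur's test -/

lemma ennreal_mul_le_weighted {a b r : ENNReal} (hr : r ≠ 0) (hr' : r ≠ ⊤) :
    a * b ≤ a ^ 2 * r + b ^ 2 * r⁻¹ := by
  rcases le_total (a * r) b with h | h
  · refine le_trans ?_ le_add_self
    have : a ≤ b * r⁻¹ := (ENNReal.le_div_iff_mul_le (Or.inl hr) (Or.inl hr')).2 h
    calc a * b ≤ b * r⁻¹ * b := by gcongr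
      _ = _ := by ring
  · refine le_trans ?_ le_self_add
    calc a * b ≤ a * (a * r) := by gcongr
      _ = _ := by ring

/-- Schur's test for a symmetric kernel, in the quadratic form which the inequality
`a b ≤ r a² + r⁻¹ b²` gives at once. -/
lemma lintegral_lintegral_le_of_schur {Z : Type*} [MeasurableSpace Z] {μ : Measure Z}
    [SFinite μ] {k : Z → Z → ENNReal} {h F G : Z → ENNReal}
    {C : ENNReal} (hk : Measurable (Function.uncurry k)) (hksymm : ∀ z w, k z w = k w z)
    (hh : Measurable h) (hh0 : ∀ z, h z ≠ 0) (hhtop : ∀ z, h z ≠ ⊤)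
    (hschur : ∀ z, ∫⁻ w, k z w * h w ∂μ ≤ C * h z) (hF : Measurable F) (hG : Measurable G) :
    ∫⁻ z, ∫⁻ w, k z w * (F z * G w) ∂μ ∂μ ≤ C * (∫⁻ z, F z ^ 2 ∂μ + ∫⁻ z, G z ^ 2 ∂μ) := by
  have one : ∀ F : Z → ENNReal, Measurable F →
      ∫⁻ z, ∫⁻ w, F z ^ 2 * (h z)⁻¹ * (k z w * h w) ∂μ ∂μ ≤ C * ∫⁻ z, F z ^ 2 ∂μ := by
    intro F hF
    rw [← lintegral_const_mul _ (hF.pow_const 2)]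
    refine lintegral_mono fun z => ?_
    rw [lintegral_const_mul _ (f := fun w => k z w * h w)
      ((hk.comp measurable_prodMk_left).mul hh)]
    calc F z ^ 2 * (h z)⁻¹ * ∫⁻ w, k z w * h w ∂μ ≤ F z ^ 2 * (h z)⁻¹ * (C * h z) := by
          gcongr; exact hschur z
      _ = C * F z ^ 2 * ((h z)⁻¹ * h z) := by ring
      _ = C * F z ^ 2 := by rw [ENNReal.inv_mul_cancel (hh0 z) (hhtop z), mul_one]
  have m1 : Measurable fun p : Z × Z => F p.1 ^ 2 * (h p.1)⁻¹ * (k p.1 p.2 * h p.2) :=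
    (((hF.comp measurable_fst).pow_const 2).mul (hh.comp measurable_fst).inv).mul
      (hk.mul (hh.comp measurable_snd))
  have m2 : Measurable fun p : Z × Z => G p.2 ^ 2 * (h p.2)⁻¹ * (k p.2 p.1 * h p.1) :=
    (((hG.comp measurable_snd).pow_const 2).mul (hh.comp measurable_snd).inv).mul
      ((hk.comp measurable_swap).mul (hh.comp measurable_fst))
  calc ∫⁻ z, ∫⁻ w, k z w * (F z * G w) ∂μ ∂μ
      ≤ ∫⁻ z, ∫⁻ w, (F z ^ 2 * (h z)⁻¹ * (k z w * h w) +
          G w ^ 2 * (h w)⁻¹ * (k w z * h z)) ∂μ ∂μ := by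
        refine lintegral_mono fun z => lintegral_mono fun w => ?_
        have h1 := ennreal_mul_le_weighted (a := F z) (b := G w) (r := h w * (h z)⁻¹)
          (mul_ne_zero (hh0 w) (ENNReal.inv_ne_zero.2 (hhtop z)))
          (ENNReal.mul_ne_top (hhtop w) (ENNReal.inv_ne_top.2 (hh0 z)))
        rw [ENNReal.mul_inv (Or.inl (hh0 w)) (Or.inl (hhtop w)), inv_inv] at h1
        calc k z w * (F z * G w)
            ≤ k z w * (F z ^ 2 * (h w * (h z)⁻¹) + G w ^ 2 * ((h w)⁻¹ * h z)) := by gcongr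
          _ = _ := by rw [hksymm w z]; ring
    _ = (∫⁻ z, ∫⁻ w, F z ^ 2 * (h z)⁻¹ * (k z w * h w) ∂μ ∂μ) +
          ∫⁻ z, ∫⁻ w, G w ^ 2 * (h w)⁻¹ * (k w z * h z) ∂μ ∂μ := by
        rw [← lintegral_add_left m1.lintegral_prod_right']
        refine lintegral_congr fun z => ?_
        exact lintegral_add_left (m1.comp measurable_prodMk_left) _
    _ ≤ C * ∫⁻ z, F z ^ 2 ∂μ + C * ∫⁻ z, G z ^ 2 ∂μ := by
        refine add_le_add (one F hF) ?_
        rw [lintegral_lintegral_swap m2.aemeasurable]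
        exact one G hG
    _ = _ := (mul_add _ _ _).symm

/-! ### Hyperbolic distance and the almost diagonal kernel -/

/-- The ratio `m / (M + |x - y|)` for `z = (x, t)` and `w = (y, s)`, where `m` and `M` are the minimum
and the maximum of `t` and `s`. It is small exactly when the hyperbolic distance is large. -/
def scaleRatio (z w : UpperHalf n) : ℝ :=
  min (z.2 : ℝ) w.2 / (max (z.2 : ℝ) w.2 + ‖z.1 - w.1‖)

section

variable (z w : UpperHalf n)

lemma min_scale_pos : 0 < min (z.2 : ℝ) w.2 := lt_min z.2.2 w.2.2

lemma max_scale_pos : 0 < max (z.2 : ℝ) w.2 := (min_scale_pos z w).trans_le min_le_max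

lemma max_add_pos : 0 < max (z.2 : ℝ) w.2 + ‖z.1 - w.1‖ :=
  add_pos_of_pos_of_nonneg (max_scale_pos z w) (norm_nonneg _)

lemma scaleRatio_pos : 0 < scaleRatio z w := div_pos (min_scale_pos z w) (max_add_pos z w)

lemma scaleRatio_le_one : scaleRatio z w ≤ 1 :=
  (div_le_one (max_add_pos z w)).2
    (min_le_max.trans (le_add_of_nonneg_right (norm_nonneg _)))

lemma almostDiag_two_mul (β : ℝ) :
    almostDiag (2 * β) z w = almostDiag β z w * scaleRatio z w ^ β := by
  have hm := min_scale_pos z w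
  have hM := max_scale_pos z w
  have hD := max_add_pos z w
  set m := min (z.2 : ℝ) w.2 with hmdef
  set M := max (z.2 : ℝ) w.2 with hMdef
  have h1 : scaleRatio z w = m / M * (M / (M + ‖z.1 - w.1‖)) := by
    rw [scaleRatio, ← hmdef, ← hMdef]
    field_simp
  rw [h1, almostDiag, almostDiag, ← hmdef, ← hMdef,
    Real.mul_rpow (by positivity) (by positivity),
    show (n : ℝ) / 2 + 2 * β = (n : ℝ) / 2 + β + β by ring,
    show (n : ℝ) + 2 * β = (n : ℝ) + β + β by ring, Real.rpow_add (by positivity) _ β,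
    Real.rpow_add (by positivity : 0 < M / (M + ‖z.1 - w.1‖)) _ β]
  ring

lemma le_almostDiag {β : ℝ} (hβ : 0 < β) :
    scaleRatio z w ^ ((n : ℝ) / 2 + β + ((n : ℝ) + β)) ≤ almostDiag β z w := by
  have hm := min_scale_pos z w
  have hM := max_scale_pos z w
  have hD := max_add_pos z w
  have hd := norm_nonneg (z.1 - w.1)
  rw [Real.rpow_add (scaleRatio_pos z w), almostDiag]
  refine mul_le_mul (Real.rpow_le_rpow (scaleRatio_pos z w).le ?_ (by positivity))
    (Real.rpow_le_rpow (scaleRatio_pos z w).le ?_ (by positivity))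
    (Real.rpow_nonneg (scaleRatio_pos z w).le _) (by positivity)
  · exact div_le_div_of_nonneg_left hm.le hM (le_add_of_nonneg_right hd)
  · exact div_le_div_of_nonneg_right min_le_max hD.le

/-- Points at a large hyperbolic distance have a small scale ratio. -/
lemma scaleRatio_le_of_le_hdist {R : ℝ} (hR : 0 < R) (h : R ≤ UpperHalf.hdist z w) :
    scaleRatio z w ≤ 1 / (2 * Real.sinh (R / 2)) := by
  have hm := min_scale_pos z w
  have hM := max_scale_pos z w
  have hd := norm_nonneg (z.1 - w.1)
  have ht : (0 : ℝ) < z.2 := z.2.2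
  have hs : (0 : ℝ) < w.2 := w.2.2
  have hsinh : 0 < Real.sinh (R / 2) := Real.sinh_pos_iff.2 (by positivity)
  have h1 : Real.sinh (R / 2) ≤ √(‖z.1 - w.1‖ ^ 2 + ((z.2 : ℝ) - w.2) ^ 2) /
      (2 * √((z.2 : ℝ) * w.2)) := by
    rw [← Real.arsinh_le_arsinh, Real.arsinh_sinh]
    rw [UpperHalf.hdist] at h
    linarith
  have h2 : √(‖z.1 - w.1‖ ^ 2 + ((z.2 : ℝ) - w.2) ^ 2) ≤ max (z.2 : ℝ) w.2 + ‖z.1 - w.1‖ := by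
    refine Real.sqrt_le_iff.2 ⟨by positivity, ?_⟩
    have h3 : ((z.2 : ℝ) - w.2) ^ 2 ≤ max (z.2 : ℝ) w.2 ^ 2 := by
      refine sq_le_sq' ?_ ?_
      · linarith [le_max_right (z.2 : ℝ) w.2]
      · linarith [le_max_left (z.2 : ℝ) w.2]
    nlinarith [mul_nonneg hM.le hd]
  have h3 : min (z.2 : ℝ) w.2 ≤ √((z.2 : ℝ) * w.2) := by
    refine Real.le_sqrt_of_sq_le ?_
    rw [sq]
    exact mul_le_mul (min_le_left _ _) (min_le_right _ _) hm.le ht.le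
  have h4 : Real.sinh (R / 2) * (2 * min (z.2 : ℝ) w.2) ≤ max (z.2 : ℝ) w.2 + ‖z.1 - w.1‖ := by
    rw [le_div_iff₀ (by positivity)] at h1
    exact (mul_le_mul_of_nonneg_left (by linarith) hsinh.le).trans (h1.trans h2)
  rw [scaleRatio, div_le_div_iff₀ (max_add_pos z w) (by positivity)]
  linarith

/-- Points at a bounded hyperbolic distance have a scale ratio bounded from below. -/
lemma le_scaleRatio_of_hdist_lt {R : ℝ} (h : UpperHalf.hdist z w < R) :
    ((1 + 2 * Real.sinh (R / 2)) ^ 3)⁻¹ ≤ scaleRatio z w := by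
  have hm := min_scale_pos z w
  have hM := max_scale_pos z w
  have hd := norm_nonneg (z.1 - w.1)
  have ht : (0 : ℝ) < z.2 := z.2.2
  have hs : (0 : ℝ) < w.2 := w.2.2
  have h1 : √(‖z.1 - w.1‖ ^ 2 + ((z.2 : ℝ) - w.2) ^ 2) /
      (2 * √((z.2 : ℝ) * w.2)) < Real.sinh (R / 2) := by
    rw [← Real.arsinh_lt_arsinh, Real.arsinh_sinh]
    rw [UpperHalf.hdist] at h
    linarith
  have hq : 0 < Real.sinh (R / 2) := lt_of_le_of_lt (by positivity) h1
  set q := Real.sinh (R / 2)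
  have hmM : (z.2 : ℝ) * w.2 = min (z.2 : ℝ) w.2 * max (z.2 : ℝ) w.2 := (min_mul_max _ _).symm
  have hsub : ((z.2 : ℝ) - w.2) ^ 2 = (max (z.2 : ℝ) w.2 - min (z.2 : ℝ) w.2) ^ 2 := by
    rcases le_total (z.2 : ℝ) (w.2 : ℝ) with hle | hle
    · rw [max_eq_right hle, min_eq_left hle]; ring
    · rw [max_eq_left hle, min_eq_right hle]
  rw [hmM, hsub] at h1
  rw [scaleRatio]
  have hle : min (z.2 : ℝ) w.2 ≤ max (z.2 : ℝ) w.2 := min_le_max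
  generalize min (z.2 : ℝ) w.2 = m at *
  generalize max (z.2 : ℝ) w.2 = M at *
  generalize ‖z.1 - w.1‖ = d at *
  -- in terms of the square roots `a` and `b` of the two scales
  obtain ⟨a, ha, rfl⟩ : ∃ a : ℝ, 0 < a ∧ a ^ 2 = m := ⟨√m, Real.sqrt_pos.2 hm, Real.sq_sqrt hm.le⟩
  obtain ⟨b, hb, rfl⟩ : ∃ b : ℝ, 0 < b ∧ b ^ 2 = M := ⟨√M, Real.sqrt_pos.2 hM, Real.sq_sqrt hM.le⟩
  have hab : a ≤ b := le_of_sq_le_sq hle hb.le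
  have e : √(a ^ 2 * b ^ 2) = a * b := by
    rw [← mul_pow, Real.sqrt_sq (by positivity)]
  rw [e, div_lt_iff₀ (by positivity)] at h1
  have hd1 : d ≤ q * (2 * (a * b)) := by
    refine (Real.le_sqrt_of_sq_le ?_).trans h1.le
    nlinarith [sq_nonneg (b ^ 2 - a ^ 2)]
  have hb1 : b ^ 2 - a ^ 2 ≤ q * (2 * (a * b)) := by
    refine (Real.le_sqrt_of_sq_le ?_).trans h1.le
    nlinarith [sq_nonneg d]
  have hba : b ≤ (1 + 2 * q) * a := by
    by_contra hcon
    push Not at hcon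
    nlinarith [mul_lt_mul_of_pos_right hcon hb, mul_le_mul_of_nonneg_left hab ha.le]
  have hsum : b ^ 2 + d ≤ (1 + 2 * q) ^ 3 * a ^ 2 := by
    have h5 : b ^ 2 + d ≤ (1 + 2 * q) * b ^ 2 := by
      nlinarith [mul_le_mul_of_nonneg_right hab hb.le]
    have h6 : b ^ 2 ≤ ((1 + 2 * q) * a) ^ 2 := pow_le_pow_left₀ hb.le hba 2
    calc b ^ 2 + d ≤ (1 + 2 * q) * b ^ 2 := h5
      _ ≤ (1 + 2 * q) * ((1 + 2 * q) * a) ^ 2 := by gcongr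
      _ = _ := by ring
  rw [inv_eq_one_div, div_le_div_iff₀ (by positivity) (by positivity)]
  linarith

end

/-- The box of points `(x, t)` with `|x| ≤ ρ` and `1/ρ ≤ t ≤ ρ`. -/
def box (n : ℕ) (ρ : ℝ) : Set (UpperHalf n) :=
  Metric.closedBall (0 : Euc n) ρ ×ˢ {t : Set.Ioi (0 : ℝ) | ρ⁻¹ ≤ (t : ℝ) ∧ (t : ℝ) ≤ ρ}

lemma measurableSet_box (n : ℕ) (ρ : ℝ) : MeasurableSet (box n ρ) :=
  measurableSet_closedBall.prod
    ((measurableSet_le measurable_const measurable_subtype_coe).inter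
      (measurableSet_le measurable_subtype_coe measurable_const))

lemma mem_box_of_hdist_lt {N : ℝ} {z : UpperHalf n}
    (h : UpperHalf.hdist UpperHalf.base z < N) {ρ : ℝ}
    (hρ : (1 + 2 * Real.sinh (N / 2)) ^ 3 ≤ ρ) : z ∈ box n ρ := by
  have ht : (0 : ℝ) < z.2 := z.2.2
  have hd := norm_nonneg z.1
  have h1 := le_scaleRatio_of_hdist_lt _ _ h
  rw [scaleRatio] at h1
  simp only [UpperHalf.base, zero_sub, norm_neg] at h1
  have hN : 0 < 1 + 2 * Real.sinh (N / 2) := by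
    have : 0 ≤ UpperHalf.hdist UpperHalf.base z := by
      unfold UpperHalf.hdist
      exact mul_nonneg zero_le_two (Real.arsinh_nonneg_iff.2 (by positivity))
    have := Real.sinh_nonneg_iff.2 (by linarith : 0 ≤ N / 2)
    linarith
  have hρ0 : 0 < ρ := lt_of_lt_of_le (by positivity) hρ
  have h2 : ρ⁻¹ ≤ min 1 (z.2 : ℝ) / (max 1 (z.2 : ℝ) + ‖z.1‖) :=
    (inv_anti₀ (by positivity) hρ).trans h1
  rw [le_div_iff₀ (by positivity)] at h2
  have h3 : max 1 (z.2 : ℝ) + ‖z.1‖ ≤ ρ * min 1 (z.2 : ℝ) := by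
    rw [inv_mul_le_iff₀ hρ0] at h2; exact h2
  have h4 : ρ * min 1 (z.2 : ℝ) ≤ ρ := mul_le_of_le_one_right hρ0.le (min_le_left _ _)
  refine Set.mk_mem_prod ?_ ⟨?_, ?_⟩
  · rw [mem_closedBall_zero_iff]
    linarith [le_max_left 1 (z.2 : ℝ)]
  · have h5 : ρ⁻¹ * 1 ≤ ρ⁻¹ * (max 1 (z.2 : ℝ) + ‖z.1‖) :=
      mul_le_mul_of_nonneg_left (by linarith [le_max_left 1 (z.2 : ℝ)]) (by positivity)
    linarith [min_le_right 1 (z.2 : ℝ)]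
  · linarith [le_max_right 1 (z.2 : ℝ)]

lemma hypMeasure_box_lt_top (n : ℕ) (ρ : ℝ) : hypMeasure n (box n ρ) < ⊤ := by
  rcases le_or_gt ρ 0 with hρ | hρ
  · have : box n ρ = ∅ := by
      refine Set.eq_empty_of_forall_notMem fun z hz => ?_
      have h1 : (z.2 : ℝ) ≤ ρ := hz.2.2
      have h2 : (0 : ℝ) < z.2 := z.2.2
      linarith
    simp [this]
  rw [hypMeasure, box, Measure.prod_prod]
  refine ENNReal.mul_lt_top (isCompact_closedBall _ _).measure_lt_top ?_
  have hm : MeasurableSet {t : ℝ | ρ⁻¹ ≤ t ∧ t ≤ ρ} := measurableSet_Icc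
  have h1 := lintegral_scaleMeasure (n := n) (f := {t : ℝ | ρ⁻¹ ≤ t ∧ t ≤ ρ}.indicator 1)
    (measurable_one.indicator hm)
  have h2 : ∫⁻ t : Set.Ioi (0 : ℝ), {t : ℝ | ρ⁻¹ ≤ t ∧ t ≤ ρ}.indicator 1 (t : ℝ) ∂(scaleMeasure n) =
      scaleMeasure n {t | ρ⁻¹ ≤ (t : ℝ) ∧ (t : ℝ) ≤ ρ} :=
    lintegral_indicator_one (hm.preimage measurable_subtype_coe)
  rw [← h2, h1]
  refine lt_of_le_of_lt (b := ∫⁻ t, (Set.Icc ρ⁻¹ ρ).indicator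
    (fun _ => ENNReal.ofReal (ρ ^ (n + 1))) t) ?_ ?_
  · refine (setLIntegral_le_lintegral _ _).trans (lintegral_mono fun t => ?_)
    by_cases ht : t ∈ Set.Icc ρ⁻¹ ρ
    · rw [Set.indicator_of_mem ht, Set.indicator_of_mem (show t ∈ {t : ℝ | ρ⁻¹ ≤ t ∧ t ≤ ρ} from ht),
        Pi.one_apply, mul_one]
      refine ENNReal.ofReal_le_ofReal ?_
      rw [← inv_pow]
      have : t⁻¹ ≤ ρ := inv_le_of_inv_le₀ hρ ht.1
      have ht0 : 0 < t := lt_of_lt_of_le (by positivity) ht.1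
      exact pow_le_pow_left₀ (by positivity) this _
    · rw [Set.indicator_of_notMem (show t ∉ {t : ℝ | ρ⁻¹ ≤ t ∧ t ≤ ρ} from ht), mul_zero]
      exact zero_le
  · rw [lintegral_indicator_const measurableSet_Icc]
    exact ENNReal.mul_lt_top ENNReal.ofReal_lt_top (by simp)

lemma measurable_almostDiag (α : ℝ) :
    Measurable fun p : UpperHalf n × UpperHalf n => almostDiag α p.1 p.2 := by
  unfold almostDiag
  fun_prop

/-- The integral in Schur's test for the almost diagonal kernel at a fixed scale: the integral over
the space variable is the mass of the decay weight. -/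
lemma lintegral_almostDiag_fixed_scale {α : ℝ} (hα : 0 < α) (z : UpperHalf n)
    (s : Set.Ioi (0 : ℝ)) :
    ∫⁻ y : Euc n, ENNReal.ofReal (almostDiag α z (y, s) * (s : ℝ) ^ ((n : ℝ) / 2)) =
      ENNReal.ofReal ((min (z.2 : ℝ) s / max (z.2 : ℝ) s) ^ ((n : ℝ) / 2 + α) *
        max (z.2 : ℝ) s ^ n * (s : ℝ) ^ ((n : ℝ) / 2) * weightMass n α) := by
  have hM : 0 < max (z.2 : ℝ) s := max_scale_pos z (z.1, s)
  have hs : (0 : ℝ) < s := s.2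
  have hm : 0 < min (z.2 : ℝ) s := min_scale_pos z (z.1, s)
  set M := max (z.2 : ℝ) s
  set c := (min (z.2 : ℝ) s / M) ^ ((n : ℝ) / 2 + α) * M ^ n * (s : ℝ) ^ ((n : ℝ) / 2) with hc
  have hc0 : 0 ≤ c := by positivity
  have e : ∀ y : Euc n, almostDiag α z (y, s) * (s : ℝ) ^ ((n : ℝ) / 2) =
      c * decayWeight α M (y - z.1) := fun y => by
    change (min (z.2 : ℝ) s / M) ^ ((n : ℝ) / 2 + α) * (M / (M + ‖z.1 - y‖)) ^ ((n : ℝ) + α) *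
      (s : ℝ) ^ ((n : ℝ) / 2) = _
    rw [hc, decayWeight, norm_sub_rev, Real.div_rpow hM.le (by positivity), Real.rpow_add hM,
      Real.rpow_natCast]
    ring
  simp only [e]
  rw [← ofReal_integral_eq_lintegral_ofReal ((integrable_decayWeight hα hM z.1).const_mul c)
    (ae_of_all _ fun y => mul_nonneg hc0 (decayWeight_nonneg hM.le _)), integral_const_mul,
    integral_decayWeight hM, weightMass]

/-- The hypothesis of Schur's test for the almost diagonal kernel, with weight `t^(n/2)`. -/
lemma lintegral_almostDiag_le {α : ℝ} (hα : 0 < α) (z : UpperHalf n) :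
    ∫⁻ w, ENNReal.ofReal (almostDiag α z w * (w.2 : ℝ) ^ ((n : ℝ) / 2)) ∂(hypMeasure n) ≤
      ENNReal.ofReal (2 * weightMass n α / α * (z.2 : ℝ) ^ ((n : ℝ) / 2)) := by
  have hW := weightMass_nonneg n α
  have ht : (0 : ℝ) < z.2 := z.2.2
  have hmeas : Measurable fun w : UpperHalf n =>
      ENNReal.ofReal (almostDiag α z w * (w.2 : ℝ) ^ ((n : ℝ) / 2)) := by
    have h1 := (measurable_almostDiag (n := n) α).comp (measurable_prodMk_left (x := z))
    refine ENNReal.measurable_ofReal.comp (h1.mul ?_)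
    fun_prop
  rw [hypMeasure, lintegral_prod_symm _ hmeas.aemeasurable]
  simp only [lintegral_almostDiag_fixed_scale hα]
  rw [lintegral_scaleMeasure (f := fun s : ℝ => ENNReal.ofReal
    ((min (z.2 : ℝ) s / max (z.2 : ℝ) s) ^ ((n : ℝ) / 2 + α) * max (z.2 : ℝ) s ^ n *
      s ^ ((n : ℝ) / 2) * weightMass n α)) (by fun_prop)]
  generalize (z.2 : ℝ) = t at *
  set W := weightMass n α
  have hsplit : Set.Ioi (0 : ℝ) = Set.Ioc 0 t ∪ Set.Ioi t := (Set.Ioc_union_Ioi_eq_Ioi ht.le).symm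
  rw [hsplit]
  refine (lintegral_union_le _ _ _).trans ?_
  have hpow : ∀ s : ℝ, 0 < s → (s ^ (n + 1))⁻¹ * s ^ ((n : ℝ) / 2) = s ^ (-(n : ℝ) / 2 - 1) := by
    intro s hs
    rw [← Real.rpow_natCast, ← Real.rpow_neg hs.le, ← Real.rpow_add hs]
    congr 1
    push_cast
    ring
  -- scales below `t`
  have hlow : ∫⁻ s in Set.Ioc 0 t, ENNReal.ofReal ((s ^ (n + 1))⁻¹) * ENNReal.ofReal
      ((min t s / max t s) ^ ((n : ℝ) / 2 + α) * max t s ^ n * s ^ ((n : ℝ) / 2) * W) =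
      ENNReal.ofReal (W / α * t ^ ((n : ℝ) / 2)) := by
    have hint : IntegrableOn (fun s : ℝ => W * t ^ ((n : ℝ) / 2 - α) * s ^ (α - 1)) (Set.Ioc 0 t) :=
      (((intervalIntegrable_iff_integrableOn_Ioc_of_le ht.le).1
        (intervalIntegral.intervalIntegrable_rpow' (by linarith))).const_mul _)
    have h1 : ∫ s in Set.Ioc 0 t, W * t ^ ((n : ℝ) / 2 - α) * s ^ (α - 1) =
        W / α * t ^ ((n : ℝ) / 2) := by
      rw [← intervalIntegral.integral_of_le ht.le, intervalIntegral.integral_const_mul,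
        integral_rpow (Or.inl (by linarith)), sub_add_cancel, Real.zero_rpow hα.ne', sub_zero,
        Real.rpow_sub ht]
      field_simp
    rw [← h1, ofReal_integral_eq_lintegral_ofReal hint]
    · refine setLIntegral_congr_fun measurableSet_Ioc fun s hs => ?_
      have hs0 : 0 < s := hs.1
      rw [← ENNReal.ofReal_mul (by positivity)]
      congr 1
      rw [min_eq_right hs.2, max_eq_left hs.2]
      calc (s ^ (n + 1))⁻¹ * ((s / t) ^ ((n : ℝ) / 2 + α) * t ^ n * s ^ ((n : ℝ) / 2) * W)
          = ((s ^ (n + 1))⁻¹ * s ^ ((n : ℝ) / 2)) * (s / t) ^ ((n : ℝ) / 2 + α) * t ^ n * W := by ring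
        _ = W * t ^ ((n : ℝ) / 2 - α) * s ^ (α - 1) := by
          rw [hpow s hs0, Real.div_rpow hs0.le ht.le, ← Real.rpow_natCast,
            show α - 1 = (-(n : ℝ) / 2 - 1) + ((n : ℝ) / 2 + α) by ring, Real.rpow_add hs0 (_ - 1),
            show (n : ℝ) / 2 - α = (n : ℝ) - ((n : ℝ) / 2 + α) by ring, Real.rpow_sub ht]
          ring
    · filter_upwards [ae_restrict_mem measurableSet_Ioc] with s hs
      have hs0 : 0 < s := hs.1
      positivity
  -- scales above `t`
  have hhigh : ∫⁻ s in Set.Ioi t, ENNReal.ofReal ((s ^ (n + 1))⁻¹) * ENNReal.ofReal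
      ((min t s / max t s) ^ ((n : ℝ) / 2 + α) * max t s ^ n * s ^ ((n : ℝ) / 2) * W) =
      ENNReal.ofReal (W / α * t ^ ((n : ℝ) / 2)) := by
    have hint : IntegrableOn (fun s : ℝ => W * t ^ ((n : ℝ) / 2 + α) * s ^ (-α - 1)) (Set.Ioi t) :=
      (integrableOn_Ioi_rpow_of_lt (by linarith) ht).const_mul _
    have h1 : ∫ s in Set.Ioi t, W * t ^ ((n : ℝ) / 2 + α) * s ^ (-α - 1) =
        W / α * t ^ ((n : ℝ) / 2) := by
      rw [integral_const_mul, integral_Ioi_rpow_of_lt (by linarith) ht, sub_add_cancel,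
        Real.rpow_add ht, Real.rpow_neg ht.le]
      field_simp
    rw [← h1, ofReal_integral_eq_lintegral_ofReal hint]
    · refine setLIntegral_congr_fun measurableSet_Ioi fun s hs => ?_
      have hs' : t < s := hs
      have hs0 : 0 < s := ht.trans hs'
      rw [← ENNReal.ofReal_mul (by positivity)]
      congr 1
      rw [min_eq_left hs'.le, max_eq_right hs'.le]
      calc (s ^ (n + 1))⁻¹ * ((t / s) ^ ((n : ℝ) / 2 + α) * s ^ n * s ^ ((n : ℝ) / 2) * W)
          = ((s ^ (n + 1))⁻¹ * s ^ ((n : ℝ) / 2)) * (t / s) ^ ((n : ℝ) / 2 + α) * s ^ n * W := by ring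
        _ = W * t ^ ((n : ℝ) / 2 + α) * s ^ (-α - 1) := by
          have e : s ^ (-α - 1) =
              s ^ (-(n : ℝ) / 2 - 1) * s ^ (n : ℝ) / s ^ ((n : ℝ) / 2 + α) := by
            rw [← Real.rpow_add hs0, ← Real.rpow_sub hs0]
            congr 1
            ring
          rw [hpow s hs0, Real.div_rpow ht.le hs0.le, ← Real.rpow_natCast, e]
          ring
    · filter_upwards [ae_restrict_mem measurableSet_Ioi] with s hs
      have hs0 : 0 < s := ht.trans hs
      positivity
  rw [hlow, hhigh, ← ENNReal.ofReal_add (by positivity) (by positivity)]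
  refine le_of_eq ?_
  congr 1
  ring

/-! ### Compactness -/

namespace BiOp

variable {ψ₁ : Test n₁} {ψ₂ : Test n₂} {δ : ℝ} {T : BiOp n₁ n₂}

/-- The matrix of `T` is bounded by an arbitrarily small multiple of the almost diagonal kernel,
outside a bounded box of columns. Far from the diagonal, part of the decay of the matrix is given
up for smallness; near the diagonal, where the almost diagonal kernel is bounded from below, the
smallness is weak compactness. -/
lemma exists_box_norm_le (hψ₁ : IsMotherWavelet ψ₁) (hψ₂ : IsMotherWavelet ψ₂) (hδ₀ : 0 < δ)
    (hδ₁ : δ ≤ 1) (hT : T.IsCZO δ) (hcanc : T.IsFullyCancellative)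
    (hweak : T.ProductWeakCompactness ψ₁ ψ₂) {η : ℝ} (hη : 0 < η) :
    ∃ ρ : ℝ, ∀ z : BiUpperHalf n₁ n₂, z ∉ box n₁ ρ ×ˢ box n₂ ρ → ∀ w : BiUpperHalf n₁ n₂,
      ‖T (atPoint ψ₁ z.1 ⊗ₜ atPoint ψ₂ z.2) (atPoint ψ₁ w.1 ⊗ₜ atPoint ψ₂ w.2)‖ ≤
        η * (almostDiag (δ / 4) z.1 w.1 * almostDiag (δ / 4) z.2 w.2) := by
  obtain ⟨C, hC, hbound⟩ := exists_norm_le_almostDiag_mul hψ₁ hψ₂ hδ₀ hδ₁ hT hcanc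
  set β := δ / 4 with hβdef
  have hβ : 0 < β := by positivity
  have h2β : δ / 2 = 2 * β := by rw [hβdef]; ring
  rw [h2β] at hbound
  -- beyond the distance `R`, a scale ratio is at most `σ`, and `C σ ^ β ≤ η`
  obtain ⟨σ, hσ, hCσ⟩ : ∃ σ : ℝ, 0 < σ ∧ C * σ ^ β ≤ η := by
    refine ⟨(η / (C + 1)) ^ β⁻¹, by positivity, ?_⟩
    rw [Real.rpow_inv_rpow (by positivity) hβ.ne', mul_div_assoc', div_le_iff₀ (by positivity)]
    nlinarith
  obtain ⟨R, hR, hRσ⟩ : ∃ R : ℝ, 0 < R ∧ 1 / (2 * Real.sinh (R / 2)) = σ := by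
    refine ⟨2 * Real.arsinh (1 / (2 * σ)),
      mul_pos two_pos (Real.arsinh_pos_iff.2 (by positivity)), ?_⟩
    rw [mul_div_cancel_left₀ _ two_ne_zero, Real.sinh_arsinh]
    field_simp
  have hsinh : 0 < Real.sinh (R / 2) := Real.sinh_pos_iff.2 (by positivity)
  have hfar : ∀ {n : ℕ} (z w : UpperHalf n), R ≤ UpperHalf.hdist z w →
      scaleRatio z w ^ β ≤ σ ^ β := fun z w h =>
    Real.rpow_le_rpow (scaleRatio_pos z w).le (hRσ ▸ scaleRatio_le_of_le_hdist z w hR h) hβ.le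
  have hone : ∀ {n : ℕ} (z w : UpperHalf n), scaleRatio z w ^ β ≤ 1 := fun z w =>
    Real.rpow_le_one (scaleRatio_pos z w).le (scaleRatio_le_one z w) hβ.le
  set c : ℕ → ℝ := fun n =>
    (((1 + 2 * Real.sinh (R / 2)) ^ 3)⁻¹) ^ ((n : ℝ) / 2 + β + ((n : ℝ) + β)) with hc
  have hc0 : ∀ n, 0 < c n := fun n => by positivity
  have hnear : ∀ {n : ℕ} (z w : UpperHalf n), UpperHalf.hdist z w < R →
      c n ≤ almostDiag β z w := fun z w h =>
    (Real.rpow_le_rpow (by positivity) (le_scaleRatio_of_hdist_lt z w h) (by positivity)).trans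
      (le_almostDiag z w hβ)
  obtain ⟨N, hN⟩ := hweak R hR (η * (c n₁ * c n₂))
    (mul_pos hη (mul_pos (hc0 n₁) (hc0 n₂)))
  refine ⟨(1 + 2 * Real.sinh (N / 2)) ^ 3, fun z hz w => ?_⟩
  have ha₁ := almostDiag_nonneg β z.1 w.1
  have ha₂ := almostDiag_nonneg β z.2 w.2
  by_cases hd : UpperHalf.hdist z.1 w.1 < R ∧ UpperHalf.hdist z.2 w.2 < R
  · have hz' : N ≤ UpperHalf.hdist UpperHalf.base z.1 ∨
        N ≤ UpperHalf.hdist UpperHalf.base z.2 := by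
      by_contra hcon
      push Not at hcon
      exact hz (Set.mk_mem_prod (mem_box_of_hdist_lt hcon.1 le_rfl)
        (mem_box_of_hdist_lt hcon.2 le_rfl))
    refine (hN z.1 z.2 hz' w.1 w.2 hd.1 hd.2).trans (mul_le_mul_of_nonneg_left ?_ hη.le)
    exact mul_le_mul (hnear _ _ hd.1) (hnear _ _ hd.2) (hc0 _).le ha₁
  · have hr : scaleRatio z.1 w.1 ^ β * scaleRatio z.2 w.2 ^ β ≤ σ ^ β := by
      have p₁ := Real.rpow_nonneg (scaleRatio_pos z.1 w.1).le β
      have p₂ := Real.rpow_nonneg (scaleRatio_pos z.2 w.2).le β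
      rcases not_and_or.1 hd with h | h
      · exact (mul_le_of_le_one_right p₁ (hone _ _)).trans (hfar _ _ (not_lt.1 h))
      · exact (mul_le_of_le_one_left p₂ (hone _ _)).trans (hfar _ _ (not_lt.1 h))
    refine (hbound z.1 w.1 z.2 w.2).trans ?_
    rw [almostDiag_two_mul, almostDiag_two_mul]
    calc C * (almostDiag β z.1 w.1 * scaleRatio z.1 w.1 ^ β *
          (almostDiag β z.2 w.2 * scaleRatio z.2 w.2 ^ β))
        = C * (scaleRatio z.1 w.1 ^ β * scaleRatio z.2 w.2 ^ β) *
          (almostDiag β z.1 w.1 * almostDiag β z.2 w.2) := by ring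
      _ ≤ C * σ ^ β * (almostDiag β z.1 w.1 * almostDiag β z.2 w.2) := by gcongr
      _ ≤ _ := by gcongr

end BiOp

lemma isParsevalFrame_biWavelet {ψ₁ : Test n₁} {ψ₂ : Test n₂} (hn₁ : 0 < n₁) (hn₂ : 0 < n₂)
    (hψ₁ : IsMotherWavelet ψ₁) (hψ₂ : IsMotherWavelet ψ₂) :
    IsParsevalFrame (biHypMeasure n₁ n₂) (biWavelet ψ₁ ψ₂) :=
  ⟨continuous_biWavelet hψ₁ hψ₂, lintegral_inner_biWavelet hn₁ hn₂ hψ₁ hψ₂⟩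

lemma integrableOn_norm_sq_biWavelet {ψ₁ : Test n₁} {ψ₂ : Test n₂} (hψ₁ : IsMotherWavelet ψ₁)
    (hψ₂ : IsMotherWavelet ψ₂) (ρ : ℝ) :
    IntegrableOn (fun z => ‖biWavelet ψ₁ ψ₂ z‖ ^ 2) (box n₁ ρ ×ˢ box n₂ ρ)
      (biHypMeasure n₁ n₂) := by
  obtain ⟨M₁, hM₁, h₁⟩ := exists_isBump_atPoint ψ₁ hψ₁.support
  obtain ⟨M₂, hM₂, h₂⟩ := exists_isBump_atPoint ψ₂ hψ₂.support
  have hfin : biHypMeasure n₁ n₂ (box n₁ ρ ×ˢ box n₂ ρ) < ⊤ := by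
    rw [biHypMeasure, Measure.prod_prod]
    exact ENNReal.mul_lt_top (hypMeasure_box_lt_top _ _) (hypMeasure_box_lt_top _ _)
  refine Measure.integrableOn_of_bounded
    (M := (M₁ * √(unitVol n₁) * (M₂ * √(unitVol n₂))) ^ 2) hfin.ne
    ((continuous_biWavelet hψ₁ hψ₂).norm.pow 2).aestronglyMeasurable (ae_of_all _ fun z => ?_)
  rw [Real.norm_of_nonneg (by positivity), biWavelet, norm_tensorL2]
  gcongr
  · exact (h₁ z.1).norm_toL2_le hM₁ z.1.2.2
  · exact (h₂ z.2).norm_toL2_le hM₂ z.2.2.2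

lemma lintegral_almostDiag_mul_le {β : ℝ} (hβ : 0 < β) (z : BiUpperHalf n₁ n₂) :
    ∫⁻ w, ENNReal.ofReal (almostDiag β z.1 w.1 * almostDiag β z.2 w.2) *
        ENNReal.ofReal ((w.1.2 : ℝ) ^ ((n₁ : ℝ) / 2) * (w.2.2 : ℝ) ^ ((n₂ : ℝ) / 2))
        ∂(biHypMeasure n₁ n₂) ≤
      ENNReal.ofReal (2 * weightMass n₁ β / β * (2 * weightMass n₂ β / β)) *
        ENNReal.ofReal ((z.1.2 : ℝ) ^ ((n₁ : ℝ) / 2) * (z.2.2 : ℝ) ^ ((n₂ : ℝ) / 2)) := by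
  have hW₁ := weightMass_nonneg n₁ β
  have hW₂ := weightMass_nonneg n₂ β
  have hm : ∀ {n : ℕ} (z : UpperHalf n), Measurable fun w : UpperHalf n =>
      ENNReal.ofReal (almostDiag β z w * (w.2 : ℝ) ^ ((n : ℝ) / 2)) := fun {n} z => by
    have h1 := (measurable_almostDiag (n := n) β).comp (measurable_prodMk_left (x := z))
    refine ENNReal.measurable_ofReal.comp (h1.mul ?_)
    fun_prop
  have hp : ∀ {n : ℕ} (z : UpperHalf n), 0 ≤ (z.2 : ℝ) ^ ((n : ℝ) / 2) := fun z =>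
    Real.rpow_nonneg (le_of_lt z.2.2) _
  have e : ∀ w : BiUpperHalf n₁ n₂,
      ENNReal.ofReal (almostDiag β z.1 w.1 * almostDiag β z.2 w.2) *
        ENNReal.ofReal ((w.1.2 : ℝ) ^ ((n₁ : ℝ) / 2) * (w.2.2 : ℝ) ^ ((n₂ : ℝ) / 2)) =
      ENNReal.ofReal (almostDiag β z.1 w.1 * (w.1.2 : ℝ) ^ ((n₁ : ℝ) / 2)) *
        ENNReal.ofReal (almostDiag β z.2 w.2 * (w.2.2 : ℝ) ^ ((n₂ : ℝ) / 2)) := fun w => by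
    have ha₁ := almostDiag_nonneg β z.1 w.1
    have ha₂ := almostDiag_nonneg β z.2 w.2
    rw [← ENNReal.ofReal_mul (mul_nonneg ha₁ ha₂), ← ENNReal.ofReal_mul (mul_nonneg ha₁ (hp _))]
    congr 1
    ring
  simp only [e]
  rw [biHypMeasure, lintegral_prod_mul (hm z.1).aemeasurable (hm z.2).aemeasurable]
  refine (mul_le_mul' (lintegral_almostDiag_le hβ z.1)
    (lintegral_almostDiag_le hβ z.2)).trans_eq ?_
  rw [← ENNReal.ofReal_mul (mul_nonneg (by positivity) (hp _)), ← ENNReal.ofReal_mul (by positivity)]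
  congr 1
  ring

/-- Schur's test for the product almost diagonal kernel in the product wavelet frame. -/
lemma lintegral_almostDiag_mul_inner_le {ψ₁ : Test n₁} {ψ₂ : Test n₂} (hn₁ : 0 < n₁) (hn₂ : 0 < n₂)
    (hψ₁ : IsMotherWavelet ψ₁) (hψ₂ : IsMotherWavelet ψ₂) {β : ℝ} (hβ : 0 < β)
    (f g : L2Prod n₁ n₂) :
    ∫⁻ z, ∫⁻ w, ENNReal.ofReal (almostDiag β z.1 w.1 * almostDiag β z.2 w.2) *
        (‖inner ℂ (biWavelet ψ₁ ψ₂ z) f‖ₑ * ‖inner ℂ (biWavelet ψ₁ ψ₂ w) g‖ₑ)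
        ∂(biHypMeasure n₁ n₂) ∂(biHypMeasure n₁ n₂) ≤
      ENNReal.ofReal (2 * weightMass n₁ β / β * (2 * weightMass n₂ β / β) *
        (‖f‖ ^ 2 + ‖g‖ ^ 2)) := by
  have hW₁ := weightMass_nonneg n₁ β
  have hW₂ := weightMass_nonneg n₂ β
  have hΨ := isParsevalFrame_biWavelet hn₁ hn₂ hψ₁ hψ₂
  have hF : ∀ f : L2Prod n₁ n₂, Measurable fun z => ‖inner ℂ (biWavelet ψ₁ ψ₂ z) f‖ₑ := fun f =>
    (hΨ.continuous.inner continuous_const).enorm.measurable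
  have hk : Measurable (Function.uncurry fun z w : BiUpperHalf n₁ n₂ =>
      ENNReal.ofReal (almostDiag β z.1 w.1 * almostDiag β z.2 w.2)) := by
    have h₁ := (measurable_almostDiag (n := n₁) β).comp
      (f := fun p : BiUpperHalf n₁ n₂ × BiUpperHalf n₁ n₂ => (p.1.1, p.2.1)) (by fun_prop)
    have h₂ := (measurable_almostDiag (n := n₂) β).comp
      (f := fun p : BiUpperHalf n₁ n₂ × BiUpperHalf n₁ n₂ => (p.1.2, p.2.2)) (by fun_prop)
    exact ENNReal.measurable_ofReal.comp (h₁.mul h₂)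
  have h := lintegral_lintegral_le_of_schur (μ := biHypMeasure n₁ n₂) hk
    (h := fun z => ENNReal.ofReal
      ((z.1.2 : ℝ) ^ ((n₁ : ℝ) / 2) * (z.2.2 : ℝ) ^ ((n₂ : ℝ) / 2)))
    (fun z w => by rw [almostDiag_comm β z.1, almostDiag_comm β z.2]) (by fun_prop)
    (fun z => (ENNReal.ofReal_pos.2 (mul_pos (Real.rpow_pos_of_pos z.1.2.2 _)
      (Real.rpow_pos_of_pos z.2.2.2 _))).ne')
    (fun z => ENNReal.ofReal_ne_top) (lintegral_almostDiag_mul_le hβ) (hF f) (hF g)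
  refine h.trans_eq ?_
  rw [hΨ.lintegral_inner, hΨ.lintegral_inner, ← ENNReal.ofReal_add (by positivity) (by positivity),
    ← ENNReal.ofReal_mul (by positivity)]

lemma BiOp.IsL2Extension.isCompactOperator {ψ₁ : Test n₁} {ψ₂ : Test n₂} (hn₁ : 0 < n₁)
    (hn₂ : 0 < n₂) (hψ₁ : IsMotherWavelet ψ₁) (hψ₂ : IsMotherWavelet ψ₂) {δ : ℝ} (hδ₀ : 0 < δ)
    (hδ₁ : δ ≤ 1) {T : BiOp n₁ n₂} (hT : T.IsCZO δ) (hcanc : T.IsFullyCancellative)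
    (hweak : T.ProductWeakCompactness ψ₁ ψ₂) {S : L2Prod n₁ n₂ →L[ℂ] L2Prod n₁ n₂}
    (hS : T.IsL2Extension S) : IsCompactOperator S := by
  refine (isParsevalFrame_biWavelet hn₁ hn₂ hψ₁ hψ₂).isCompactOperator S fun ε hε => ?_
  have hβ : 0 < δ / 4 := by positivity
  have hW₁ := weightMass_nonneg n₁ (δ / 4)
  have hW₂ := weightMass_nonneg n₂ (δ / 4)
  set A := 2 * weightMass n₁ (δ / 4) / (δ / 4) * (2 * weightMass n₂ (δ / 4) / (δ / 4)) with hA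
  have hA0 : 0 ≤ A := by positivity
  have hη : 0 < ε / (A + 1) := by positivity
  obtain ⟨ρ, hρ⟩ := exists_box_norm_le hψ₁ hψ₂ hδ₀ hδ₁ hT hcanc hweak hη
  have hm : MeasurableSet (box n₁ ρ ×ˢ box n₂ ρ) :=
    (measurableSet_box n₁ ρ).prod (measurableSet_box n₂ ρ)
  refine ⟨_, hm, integrableOn_norm_sq_biWavelet hψ₁ hψ₂ ρ, fun f g => ?_⟩
  have hentry : ∀ z ∈ (box n₁ ρ ×ˢ box n₂ ρ)ᶜ, ∀ w,
      ‖inner ℂ (biWavelet ψ₁ ψ₂ w) (S (biWavelet ψ₁ ψ₂ z))‖ₑ ≤ ENNReal.ofReal (ε / (A + 1)) *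
        ENNReal.ofReal (almostDiag (δ / 4) z.1 w.1 * almostDiag (δ / 4) z.2 w.2) := by
    intro z hz w
    rw [inner_biWavelet hψ₁.real hψ₂.real, biWavelet, hS, ← ofReal_norm, ← ENNReal.ofReal_mul hη.le]
    exact ENNReal.ofReal_le_ofReal (hρ z hz w)
  set k : BiUpperHalf n₁ n₂ → BiUpperHalf n₁ n₂ → ENNReal := fun z w =>
    ENNReal.ofReal (almostDiag (δ / 4) z.1 w.1 * almostDiag (δ / 4) z.2 w.2) *
      (‖inner ℂ (biWavelet ψ₁ ψ₂ z) f‖ₑ * ‖inner ℂ (biWavelet ψ₁ ψ₂ w) g‖ₑ) with hk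
  calc ∫⁻ z in (box n₁ ρ ×ˢ box n₂ ρ)ᶜ, ∫⁻ w,
        ‖inner ℂ (biWavelet ψ₁ ψ₂ w) (S (biWavelet ψ₁ ψ₂ z))‖ₑ *
          (‖inner ℂ (biWavelet ψ₁ ψ₂ z) f‖ₑ * ‖inner ℂ (biWavelet ψ₁ ψ₂ w) g‖ₑ)
          ∂(biHypMeasure n₁ n₂) ∂(biHypMeasure n₁ n₂)
      ≤ ∫⁻ z in (box n₁ ρ ×ˢ box n₂ ρ)ᶜ, ENNReal.ofReal (ε / (A + 1)) *
          ∫⁻ w, k z w ∂(biHypMeasure n₁ n₂) ∂(biHypMeasure n₁ n₂) := by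
        refine setLIntegral_mono' hm.compl fun z hz => ?_
        rw [← lintegral_const_mul' _ _ ENNReal.ofReal_ne_top]
        refine lintegral_mono fun w => ?_
        simp only [hk]
        rw [← mul_assoc (ENNReal.ofReal (ε / (A + 1)))]
        exact mul_le_mul' (hentry z hz w) le_rfl
    _ ≤ ENNReal.ofReal (ε / (A + 1)) *
          ∫⁻ z, ∫⁻ w, k z w ∂(biHypMeasure n₁ n₂) ∂(biHypMeasure n₁ n₂) := by
        rw [lintegral_const_mul' _ _ ENNReal.ofReal_ne_top]
        gcongr
        exact Measure.restrict_le_self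
    _ ≤ ENNReal.ofReal (ε / (A + 1)) * ENNReal.ofReal (A * (‖f‖ ^ 2 + ‖g‖ ^ 2)) := by
        gcongr
        exact lintegral_almostDiag_mul_inner_le hn₁ hn₂ hψ₁ hψ₂ hβ f g
    _ ≤ ENNReal.ofReal (ε * (‖f‖ ^ 2 + ‖g‖ ^ 2)) := by
        rw [← ENNReal.ofReal_mul hη.le, ← mul_assoc]
        refine ENNReal.ofReal_le_ofReal (mul_le_mul_of_nonneg_right ?_ (by positivity))
        rw [div_mul_eq_mul_div, div_le_iff₀ (by positivity)]
        nlinarith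

end

end BiParam

theorem mainTheorem6 (n₁ n₂ : ℕ) (hn₁ : 0 < n₁) (hn₂ : 0 < n₂)
    (ψ₁ : BiParam.Test n₁) (ψ₂ : BiParam.Test n₂)
    (hψ₁ : BiParam.IsMotherWavelet ψ₁) (hψ₂ : BiParam.IsMotherWavelet ψ₂)
    (δ : ℝ) (hδ₀ : 0 < δ) (hδ₁ : δ ≤ 1) (T : BiParam.BiOp n₁ n₂)
    (hT : T.IsCZO δ) (hcanc : T.IsFullyCancellative)
    (hweak : T.ProductWeakCompactness ψ₁ ψ₂) :
    T.IsL2Compact := by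
  obtain ⟨S, hS⟩ := hT.bounded
  exact ⟨S, hS, hS.isCompactOperator hn₁ hn₂ hψ₁ hψ₂ hδ₀ hδ₁ hT hcanc hweak⟩
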